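/- A graph is a compact Hausdorff space that is a union of finitely many homeomorphic copies of $[0,1]$, any two of which intersect at most at their endpoints; its vertices are the points having no open neighbourhood homeomorphic to $]0,1[$. A continuous map $f:G\to G$ of a graph is a piecewise monotone graph (PMG) map if there is a finite set $C\subseteq G$ such that $f$ is injective on each connected component of $G\setminus C$. Let $\Omega=[a_1,b_1]\cup\dots\cup[a_m,b_m]$ with $a_1<b_1<a_2<\dots<a_m<b_m$, and $\partial\Omega=\{a_1,b_1,\dots,a_m,b_m\}$. A piecewise monotone (PM) map is a map $F:\Omega\setminus C_F\to\Omega$, with $C_F\subseteq\Omega$ finite and $\partial\Omega\subseteq C_F$, that is continuous and strictly monotone on each connected component of $\Omega\setminus C_F$. For $n\ge1$, $F^n$ is defined on $\Omega\setminus C_{F^n}$, where $C_{F^n}=\{x\in\Omega: F^k(x)\in C_F\text{ for some }0\le k<n\}$. A lap of $F^n$ is an interval $[c,d]\subseteq\Omega$, $c<d$, with $[c,d]\cap C_{F^n}=\{c,d\}$, and $\mathrm{Var}(F^n)=\sum_{[c,d]}|F^n(d-)-F^n(c+)|$, the sum being over all laps of $F^n$. The map $f$ is induced by $F$ if there is a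 continuous $\pi:\Omega\to G$ such that $\pi(\partial\Omega)$ contains all vertices of $G$, $\pi$ maps $\Omega\setminus\partial\Omega$ homeomorphically onto $G\setminus\pi(\partial\Omega)$, and $\pi\circ F=f\circ\pi$ on $\Omega\setminus C_F$. Let $S_0$ be the real vector space with basis $\Omega$, and $S_1\subseteq S_0$ the span of the vectors $y-x$ with $x,y$ in the same component of $\Omega$. Let $\epsilon F_{\#0}:S_0\to S_0$ be the linear map with $x\mapsto\epsilon(x)F(x)$ for $x\in\Omega\setminus C_F$, where $\epsilon(x)=\pm1$ according to whether $F$ is increasing or decreasing near $x$, and $x\mapsto 0$ for $x\in C_F$. Let $\epsilon F_{\#1}:S_1\to S_1$ be the unique linear map with $\epsilon F_{\#1}(y-x)=\epsilon([x,y])\,(F(y-)-F(x+))$ for all $x<y$ in $\Omega$ with $]x,y[\,\subseteq\Omega\setminus C_F$, where $\epsilon([x,y])=\pm1$ according to whether $F$ is increasing or decreasing on $]x,y[$. For endomorphisms $\varphi_0,\varphi_1$ of finite-codimensional subspaces $V_0,V_1$ of a vector space $V$ that have extensions $\psi_0,\psi_1:V\to V$ with $\psi_1-\psi_0$ of finite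 rank, put $\mathrm{tr}(\varphi_0,\varphi_1)=\mathrm{tr}(\psi_1-\psi_0)-\mathrm{tr}\,\widetilde\psi_1+\mathrm{tr}\,\widetilde\psi_0$, where $\widetilde\psi_j$ is the endomorphism of $V/V_j$ induced by $\psi_j$ (this is independent of the extensions). The kneading determinant of $F$ is the formal power series $$D(z)=\exp\Bigl(-\sum_{n\ge1}\mathrm{tr}\bigl((\epsilon F_{\#0})^n,(\epsilon F_{\#1})^n\bigr)\frac{z^n}{n}\Bigr).$$ Theorem. Let $f:G\to G$ be a PMG map of a graph $G$, induced by a PM map $F:\Omega\setminus C_F\to\Omega$, and suppose that its topological entropy satisfies $h_{\mathrm{top}}(f)>0$. Then the limit $r=\lim_{n\to\infty}\mathrm{Var}(F^n)^{-1/n}$ exists, and there is a complex number $z$ with $|z|=r$ at which the power series $D$ converges and $D(z)=0$. -/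

import Mathlib

open Set Filter Topology

noncomputable section

namespace PMGraph

/-! ### Graphs and piecewise monotone graph maps -/

/-- A compact Hausdorff space is a graph if it is a union of finitely many homeomorphic copies of
the closed interval `[0,1]`, any two of which intersect at most at their endpoints. -/
def IsGraph (G : Type*) [TopologicalSpace G] [CompactSpace G] [T2Space G] : Prop :=
  ∃ (k : ℕ) (e : Fin k → unitInterval → G),
    (∀ i, IsEmbedding (e i)) ∧ (⋃ i, range (e i)) = univ ∧
    ∀ i j, i ≠ j → ∀ s t, e i s = e j t → (s = 0 ∨ s = 1) ∧ (t = 0 ∨ t = 1)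

/-- The vertices: the points without an open neighbourhood homeomorphic to `]0,1[`. -/
def vertices (G : Type*) [TopologicalSpace G] : Set G :=
  {x | ∀ U : Set G, IsOpen U → x ∈ U → ¬ Nonempty (U ≃ₜ Ioo (0 : ℝ) 1)}

/-- A piecewise monotone graph (PMG) map. -/
structure IsPMGMap {G : Type*} [TopologicalSpace G] (f : G → G) : Prop where
  continuous : Continuous f
  exists_cut : ∃ C : Set G, C.Finite ∧ ∀ x ∈ Cᶜ, InjOn f (connectedComponentIn Cᶜ x)

/-- The topological entropy of a self-map of a compact Hausdorff space, computed with the unique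
uniform structure compatible with the topology. -/
def topEntropy {G : Type*} [TopologicalSpace G] [CompactSpace G] [T2Space G] (f : G → G) : EReal :=
  letI : UniformSpace G := uniformSpaceOfCompactR1
  Dynamics.coverEntropy f univ

/-! ### Finite unions of compact intervals and piecewise monotone maps -/

/-- The data `a₁ < b₁ < a₂ < b₂ < ⋯ < aₘ < bₘ`. -/
structure IntervalUnion where
  m : ℕ
  a : Fin m → ℝ
  b : Fin m → ℝ
  lt : ∀ i, a i < b i
  gap : ∀ i j, i < j → b i < a j

/-- `Ω = [a₁,b₁] ∪ ⋯ ∪ [aₘ,bₘ]`; the intervals `[aᵢ,bᵢ]` are its connected components. -/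
def IntervalUnion.carrier (Ω : IntervalUnion) : Set ℝ := ⋃ i, Icc (Ω.a i) (Ω.b i)

/-- `∂Ω = {a₁, b₁, …, aₘ, bₘ}`. -/
def IntervalUnion.boundary (Ω : IntervalUnion) : Set ℝ := range Ω.a ∪ range Ω.b

/-- A piecewise monotone (PM) map `F : Ω \ C → Ω`. Only the values of `toFun` on `Ω \ C` matter. -/
structure PMMap (Ω : IntervalUnion) where
  toFun : ℝ → ℝ
  C : Set ℝ
  finite_C : C.Finite
  C_subset : C ⊆ Ω.carrier
  boundary_subset : Ω.boundary ⊆ C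
  mapsTo : MapsTo toFun (Ω.carrier \ C) Ω.carrier
  continuousOn : ∀ x ∈ Ω.carrier \ C,
    ContinuousOn toFun (connectedComponentIn (Ω.carrier \ C) x)
  monotone : ∀ x ∈ Ω.carrier \ C,
    StrictMonoOn toFun (connectedComponentIn (Ω.carrier \ C) x) ∨
    StrictAntiOn toFun (connectedComponentIn (Ω.carrier \ C) x)

namespace PMMap

variable {Ω : IntervalUnion} (F : PMMap Ω)

/-- `C_{F^n}`, the set of points of `Ω` whose orbit meets `C_F` before time `n`. Off this set
the `n`-th iterate of the partial map `F` is defined and agrees with the iterate of `F.toFun`. -/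
def cutIter (n : ℕ) : Set ℝ := {x ∈ Ω.carrier | ∃ k < n, F.toFun^[k] x ∈ F.C}

/-- The laps `[c,d]` of `F^n`, recorded as pairs `(c,d)`. -/
def laps (n : ℕ) : Set (ℝ × ℝ) :=
  {I | I.1 < I.2 ∧ Icc I.1 I.2 ⊆ Ω.carrier ∧ Icc I.1 I.2 ∩ F.cutIter n = {I.1, I.2}}

/-- `Var(F^n)`, the sum over the laps `[c,d]` of `F^n` of `|F^n(d-) - F^n(c+)|`. -/
def variation (n : ℕ) : ℝ :=
  ∑ᶠ I ∈ F.laps n, |Function.leftLim (F.toFun^[n]) I.2 - Function.rightLim (F.toFun^[n]) I.1|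

open Classical in
/-- The sign `ε(x)`: `0` on `C_F`, and `1` or `-1` elsewhere according to whether `F` is increasing
or decreasing on a neighbourhood of `x`. -/
def sign (x : ℝ) : ℝ :=
  if x ∈ F.C then 0 else if ∃ U ∈ 𝓝 x, StrictMonoOn F.toFun U then 1 else -1

/-- `F` is monotone on `[x,y]`, where `x < y`. -/
def MonotoneBetween (x y : Ω.carrier) : Prop := x < y ∧ Ioo (x : ℝ) y ⊆ Ω.carrier \ F.C

open Classical in
/-- The sign `ε([x,y])` of an interval on which `F` is monotone. -/
def signBetween (x y : ℝ) : ℝ := if StrictMonoOn F.toFun (Ioo x y) then 1 else -1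

end PMMap

/-! ### The vector spaces `S₀`, `S₁` and the endomorphisms `εF_{#0}`, `εF_{#1}` -/

/-- `S₀(Ω;ℝ)`, the real vector space with basis `Ω`. -/
abbrev S0 (Ω : IntervalUnion) : Type := Ω.carrier →₀ ℝ

/-- The basis vector of `S₀(Ω;ℝ)` given by a point. -/
def pt {Ω : IntervalUnion} (x : Ω.carrier) : S0 Ω := Finsupp.single x 1

/-- `S₁(Ω;ℝ)`, spanned by the vectors `y - x` with `x`, `y` in the same component of `Ω`. -/
def S1 (Ω : IntervalUnion) : Submodule ℝ (S0 Ω) :=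
  Submodule.span ℝ {v | ∃ (i : Fin Ω.m) (x y : Ω.carrier),
    (x : ℝ) ∈ Icc (Ω.a i) (Ω.b i) ∧ (y : ℝ) ∈ Icc (Ω.a i) (Ω.b i) ∧ v = pt y - pt x}

namespace PMMap

variable {Ω : IntervalUnion} (F : PMMap Ω)

open Classical in
/-- `F_{#0}` on basis vectors: `x ↦ F(x)` off `C_F`, and `x ↦ 0` on `C_F`. -/
def push0Pt (x : Ω.carrier) : S0 Ω :=
  if h : (x : ℝ) ∈ F.C then 0 else pt ⟨F.toFun x, F.mapsTo ⟨x.2, h⟩⟩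

/-- `εF_{#0}`, the endomorphism of `S₀(Ω;ℝ)` with `x ↦ ε(x) F_{#0}(x)`. -/
def signedPush0 : S0 Ω →ₗ[ℝ] S0 Ω :=
  Finsupp.linearCombination ℝ fun x : Ω.carrier => F.sign x • F.push0Pt x

/-- The relation that characterizes `εF_{#1}`: `εF_{#1}(y - x) = ε([x,y]) (F(y-) - F(x+))`
whenever `F` is monotone on `[x,y]`. -/
def IsSignedPush1 (φ : S1 Ω →ₗ[ℝ] S1 Ω) : Prop :=
  ∀ x y p q : Ω.carrier, F.MonotoneBetween x y →
    Tendsto F.toFun (𝓝[>] (x : ℝ)) (𝓝 (p : ℝ)) → Tendsto F.toFun (𝓝[<] (y : ℝ)) (𝓝 (q : ℝ)) →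
    ∀ v : S1 Ω, (v : S0 Ω) = pt y - pt x →
      (φ v : S0 Ω) = F.signBetween x y • (pt q - pt p)

/-! The following facts prove that there is exactly one such endomorphism. -/

theorem ioo_props {x y : ℝ} (h : Ioo x y ⊆ Ω.carrier \ F.C) :
    ContinuousOn F.toFun (Ioo x y) ∧
      (StrictMonoOn F.toFun (Ioo x y) ∨ StrictAntiOn F.toFun (Ioo x y)) := by
  rcases (Ioo x y).eq_empty_or_nonempty with he | ⟨z, hz⟩
  · rw [he]; exact ⟨continuousOn_empty _, Or.inl (by intro a ha; exact ha.elim)⟩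
  · have hs := isPreconnected_Ioo.subset_connectedComponentIn hz h
    exact ⟨(F.continuousOn z (h hz)).mono hs,
      (F.monotone z (h hz)).imp (fun m => m.mono hs) (fun m => m.mono hs)⟩

theorem same_component {x y : Ω.carrier} (h : F.MonotoneBetween x y) :
    ∃ i, (x : ℝ) ∈ Icc (Ω.a i) (Ω.b i) ∧ (y : ℝ) ∈ Icc (Ω.a i) (Ω.b i) := by
  obtain ⟨hxy, hI⟩ := h
  have hxy' : (x : ℝ) < y := hxy
  obtain ⟨m, hm⟩ := exists_between hxy'
  obtain ⟨i, hi⟩ := mem_iUnion.1 (hI hm).1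
  have ha : Ω.a i ≤ x := by
    by_contra! hc
    exact (hI ⟨hc, hi.1.trans_lt hm.2⟩).2 (F.boundary_subset (Or.inl ⟨i, rfl⟩))
  have hb : (y : ℝ) ≤ Ω.b i := by
    by_contra! hc
    exact (hI ⟨hm.1.trans_le hi.2, hc⟩).2 (F.boundary_subset (Or.inr ⟨i, rfl⟩))
  exact ⟨i, ⟨ha, hxy'.le.trans hb⟩, ⟨ha.trans hxy'.le, hb⟩⟩

theorem image_in_component {x y : Ω.carrier} (h : F.MonotoneBetween x y) :
    ∃ j, F.toFun '' Ioo (x : ℝ) y ⊆ Icc (Ω.a j) (Ω.b j) := by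
  obtain ⟨hxy, hI⟩ := h
  have hxy' : (x : ℝ) < y := hxy
  obtain ⟨m, hm⟩ := exists_between hxy'
  obtain ⟨j, hj⟩ := mem_iUnion.1 (F.mapsTo (hI hm))
  refine ⟨j, ?_⟩
  have hpre : IsPreconnected (F.toFun '' Ioo (x : ℝ) y) :=
    isPreconnected_Ioo.image _ (F.ioo_props hI).1
  have hcl : IsClosed (⋃ k ∈ {k : Fin Ω.m | k ≠ j}, Icc (Ω.a k) (Ω.b k)) :=
    (toFinite _).isClosed_biUnion fun _ _ => isClosed_Icc
  have hdisj : ∀ k, k ≠ j → ∀ t ∈ Icc (Ω.a k) (Ω.b k), t ∉ Icc (Ω.a j) (Ω.b j) := by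
    intro k hk t ht ht'
    rcases lt_or_gt_of_ne hk with h | h
    · have := Ω.gap _ _ h; linarith [ht.2, ht'.1]
    · have := Ω.gap _ _ h; linarith [ht.1, ht'.2]
  rcases isPreconnected_iff_subset_of_disjoint_closed.1 hpre _ _ (isClosed_Icc) hcl
    (by
      rintro _ ⟨t, ht, rfl⟩
      obtain ⟨k, hk⟩ := mem_iUnion.1 (F.mapsTo (hI ht))
      by_cases hkj : k = j
      · subst hkj; exact Or.inl hk
      · exact Or.inr (mem_biUnion (show k ∈ {k : Fin Ω.m | k ≠ j} from hkj) hk))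
    (by
      rw [eq_empty_iff_forall_notMem]
      rintro t ⟨-, ht, ht'⟩
      obtain ⟨k, hk, hk'⟩ := mem_iUnion₂.1 ht'
      exact hdisj k hk t hk' ht) with h | h
  · exact h
  · obtain ⟨k, hk, hk'⟩ := mem_iUnion₂.1 (h ⟨m, hm, rfl⟩)
    exact (hdisj k hk _ hk' hj).elim

theorem exists_limits {x y : Ω.carrier} (h : F.MonotoneBetween x y) :
    ∃ (j : Fin Ω.m) (p q : Ω.carrier), (p : ℝ) ∈ Icc (Ω.a j) (Ω.b j) ∧
      (q : ℝ) ∈ Icc (Ω.a j) (Ω.b j) ∧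
      Tendsto F.toFun (𝓝[>] (x : ℝ)) (𝓝 (p : ℝ)) ∧ Tendsto F.toFun (𝓝[<] (y : ℝ)) (𝓝 (q : ℝ)) := by
  obtain ⟨j, hj⟩ := F.image_in_component h
  have hxy' : (x : ℝ) < y := h.1
  have hne : (Ioo (x : ℝ) y).Nonempty := nonempty_Ioo.2 hxy'
  have hba : BddAbove (F.toFun '' Ioo (x : ℝ) y) := bddAbove_Icc.mono hj
  have hbb : BddBelow (F.toFun '' Ioo (x : ℝ) y) := bddBelow_Icc.mono hj
  have key : ∃ p q, Tendsto F.toFun (𝓝[>] (x : ℝ)) (𝓝 p) ∧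
      Tendsto F.toFun (𝓝[<] (y : ℝ)) (𝓝 q) := by
    rcases (F.ioo_props h.2).2 with hm | hm
    · exact ⟨_, _, hm.monotoneOn.tendsto_nhdsWithin_Ioo_right hne hbb,
        hm.monotoneOn.tendsto_nhdsWithin_Ioo_left hne hba⟩
    · have hneg : MonotoneOn (fun t => -F.toFun t) (Ioo (x : ℝ) y) := hm.antitoneOn.neg
      have him : (fun t => -F.toFun t) '' Ioo (x : ℝ) y ⊆ Icc (-Ω.b j) (-Ω.a j) := by
        rintro _ ⟨t, ht, rfl⟩
        have := hj ⟨t, ht, rfl⟩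
        exact ⟨neg_le_neg this.2, neg_le_neg this.1⟩
      have h1 := (hneg.tendsto_nhdsWithin_Ioo_right hne (bddBelow_Icc.mono him)).neg
      have h2 := (hneg.tendsto_nhdsWithin_Ioo_left hne (bddAbove_Icc.mono him)).neg
      simp only [neg_neg] at h1 h2
      exact ⟨_, _, h1, h2⟩
  obtain ⟨p, q, hp, hq⟩ := key
  have hpj : p ∈ Icc (Ω.a j) (Ω.b j) := isClosed_Icc.mem_of_tendsto hp
    (by filter_upwards [Ioo_mem_nhdsGT hxy'] with t ht using hj ⟨t, ht, rfl⟩)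
  have hqj : q ∈ Icc (Ω.a j) (Ω.b j) := isClosed_Icc.mem_of_tendsto hq
    (by filter_upwards [Ioo_mem_nhdsLT hxy'] with t ht using hj ⟨t, ht, rfl⟩)
  exact ⟨j, ⟨p, mem_iUnion.2 ⟨j, hpj⟩⟩, ⟨q, mem_iUnion.2 ⟨j, hqj⟩⟩, hpj, hqj, hp, hq⟩

/-- `S₁(Ω;ℝ)` is spanned by the vectors `y - x` for which `F` is monotone on `[x,y]`. -/
theorem S1_eq_span : S1 Ω =
    Submodule.span ℝ {v | ∃ x y : Ω.carrier, F.MonotoneBetween x y ∧ v = pt y - pt x} := by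
  apply le_antisymm
  · have key : ∀ (n : ℕ) (i : Fin Ω.m) (x y : Ω.carrier), (x : ℝ) ∈ Icc (Ω.a i) (Ω.b i) →
        (y : ℝ) ∈ Icc (Ω.a i) (Ω.b i) → x < y → (F.C ∩ Ioo (x : ℝ) y).ncard ≤ n →
        pt y - pt x ∈ Submodule.span ℝ
          {v | ∃ x y : Ω.carrier, F.MonotoneBetween x y ∧ v = pt y - pt x} := by
      intro n
      induction n with
      | zero =>
        intro i x y hx hy hxy hn
        have hfin : (F.C ∩ Ioo (x : ℝ) y).Finite := F.finite_C.inter_of_left _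
        have he := (ncard_eq_zero hfin).1 (Nat.le_zero.1 hn)
        refine Submodule.subset_span ⟨x, y, ⟨hxy, fun t ht => ⟨?_, fun hC => ?_⟩⟩, rfl⟩
        · exact mem_iUnion.2 ⟨i, hx.1.trans ht.1.le, ht.2.le.trans hy.2⟩
        · exact (he.subset ⟨hC, ht⟩ : t ∈ (∅ : Set ℝ))
      | succ n ih =>
        intro i x y hx hy hxy hn
        have hfin : (F.C ∩ Ioo (x : ℝ) y).Finite := F.finite_C.inter_of_left _
        rcases (F.C ∩ Ioo (x : ℝ) y).eq_empty_or_nonempty with he | ⟨c, hc, hcI⟩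
        · exact ih i x y hx hy hxy (by rw [he]; simp)
        · let c' : Ω.carrier := ⟨c, F.C_subset hc⟩
          have hci : (c' : ℝ) ∈ Icc (Ω.a i) (Ω.b i) :=
            ⟨hx.1.trans hcI.1.le, hcI.2.le.trans hy.2⟩
          have e : pt y - pt x = (pt y - pt c') + (pt c' - pt x) := by abel
          rw [e]
          refine Submodule.add_mem _ (ih i c' y hci hy hcI.2 ?_) (ih i x c' hx hci hcI.1 ?_)
          · refine Nat.lt_succ_iff.1 (lt_of_lt_of_le (ncard_lt_ncard ?_ hfin) hn)
            refine ⟨fun t ht => ⟨ht.1, hcI.1.trans ht.2.1, ht.2.2⟩, fun hsub => ?_⟩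
            exact lt_irrefl _ (hsub ⟨hc, hcI⟩).2.1
          · refine Nat.lt_succ_iff.1 (lt_of_lt_of_le (ncard_lt_ncard ?_ hfin) hn)
            refine ⟨fun t ht => ⟨ht.1, ht.2.1, ht.2.2.trans hcI.2⟩, fun hsub => ?_⟩
            exact lt_irrefl _ (hsub ⟨hc, hcI⟩).2.2
    refine Submodule.span_le.2 ?_
    rintro _ ⟨i, x, y, hx, hy, rfl⟩
    rcases lt_trichotomy x y with h | h | h
    · exact key _ i x y hx hy h le_rfl
    · subst h; rw [sub_self]; exact Submodule.zero_mem _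
    · rw [← neg_sub]; exact Submodule.neg_mem _ (key _ i y x hy hx h le_rfl)
  · refine Submodule.span_mono ?_
    rintro _ ⟨x, y, h, rfl⟩
    obtain ⟨i, hx, hy⟩ := F.same_component h
    exact ⟨i, x, y, hx, hy, rfl⟩

theorem signBetween_eq_of_subset {x y x' y' : ℝ} (hxy : x' < y')
    (h : Ioo x y ⊆ Ω.carrier \ F.C) (hsub : Ioo x' y' ⊆ Ioo x y) :
    F.signBetween x' y' = F.signBetween x y := by
  obtain ⟨s, hs⟩ := exists_between hxy
  obtain ⟨t, ht⟩ := exists_between hs.2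
  have ht' : t ∈ Ioo x' y' := ⟨hs.1.trans ht.1, ht.2⟩
  unfold signBetween
  rcases (F.ioo_props h).2 with hm | hm
  · rw [if_pos hm, if_pos (hm.mono hsub)]
  · rw [if_neg, if_neg]
    · intro hm'; exact lt_asymm (hm' (hsub hs) (hsub ht') ht.1) (hm (hsub hs) (hsub ht') ht.1)
    · intro hm'; exact lt_asymm (hm' hs ht' ht.1) (hm (hsub hs) (hsub ht') ht.1)

/-- Auxiliary relation: `v = ε(y-) F(y-)`. -/
def IsLeftVal (y : Ω.carrier) (v : S0 Ω) : Prop :=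
  ∃ x q : Ω.carrier, F.MonotoneBetween x y ∧ Tendsto F.toFun (𝓝[<] (y : ℝ)) (𝓝 (q : ℝ)) ∧
    v = F.signBetween x y • pt q

/-- Auxiliary relation: `v = ε(x+) F(x+)`. -/
def IsRightVal (x : Ω.carrier) (v : S0 Ω) : Prop :=
  ∃ y p : Ω.carrier, F.MonotoneBetween x y ∧ Tendsto F.toFun (𝓝[>] (x : ℝ)) (𝓝 (p : ℝ)) ∧
    v = F.signBetween x y • pt p

theorem IsLeftVal.unique {y : Ω.carrier} {v w : S0 Ω} (hv : F.IsLeftVal y v)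
    (hw : F.IsLeftVal y w) : v = w := by
  obtain ⟨x, q, h, hq, rfl⟩ := hv
  obtain ⟨x', q', h', hq', rfl⟩ := hw
  obtain rfl : q = q' := Subtype.ext (tendsto_nhds_unique hq hq')
  have hm : max (x : ℝ) x' < y := max_lt h.1 h'.1
  rw [← F.signBetween_eq_of_subset hm h.2 (Ioo_subset_Ioo_left (le_max_left _ _)),
    ← F.signBetween_eq_of_subset hm h'.2 (Ioo_subset_Ioo_left (le_max_right _ _))]

theorem IsRightVal.unique {y : Ω.carrier} {v w : S0 Ω} (hv : F.IsRightVal y v)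
    (hw : F.IsRightVal y w) : v = w := by
  obtain ⟨x, q, h, hq, rfl⟩ := hv
  obtain ⟨x', q', h', hq', rfl⟩ := hw
  obtain rfl : q = q' := Subtype.ext (tendsto_nhds_unique hq hq')
  have hm : (y : ℝ) < min (x : ℝ) x' := lt_min h.1 h'.1
  rw [← F.signBetween_eq_of_subset hm h.2 (Ioo_subset_Ioo_right (min_le_left _ _)),
    ← F.signBetween_eq_of_subset hm h'.2 (Ioo_subset_Ioo_right (min_le_right _ _))]

/-- Off `C_F` the two one-sided values agree. -/
theorem left_eq_right {x w y : Ω.carrier} (hx : (x : ℝ) ∉ F.C) (hw : F.MonotoneBetween w x)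
    (hy : F.MonotoneBetween x y) {u v : S0 Ω} (hu : F.IsLeftVal x u) (hv : F.IsRightVal x v) :
    u = v := by
  have hwx : (w : ℝ) < x := hw.1
  have hxy : (x : ℝ) < y := hy.1
  have hI : Ioo (w : ℝ) y ⊆ Ω.carrier \ F.C := by
    intro t ht
    rcases lt_trichotomy t (x : ℝ) with h | h | h
    · exact hw.2 ⟨ht.1, h⟩
    · rw [h]; exact ⟨x.2, hx⟩
    · exact hy.2 ⟨h, ht.2⟩
  have hc : ContinuousAt F.toFun x :=
    (F.ioo_props hI).1.continuousAt (Ioo_mem_nhds hwx hxy)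
  let q : Ω.carrier := ⟨F.toFun x, F.mapsTo ⟨x.2, hx⟩⟩
  have e1 := IsLeftVal.unique F hu ⟨w, q, hw, hc.tendsto.mono_left nhdsWithin_le_nhds, rfl⟩
  have e2 := IsRightVal.unique F hv ⟨y, q, hy, hc.tendsto.mono_left nhdsWithin_le_nhds, rfl⟩
  rw [e1, e2, F.signBetween_eq_of_subset hwx hI (Ioo_subset_Ioo_right hxy.le),
    F.signBetween_eq_of_subset hxy hI (Ioo_subset_Ioo_left hwx.le)]

open Classical in
/-- Auxiliary: `ε(y-) F(y-)`, with value `0` at left endpoints. -/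
def leftVal (y : Ω.carrier) : S0 Ω := if h : ∃ v, F.IsLeftVal y v then h.choose else 0

open Classical in
/-- Auxiliary: `ε(x+) F(x+)`, with value `0` at right endpoints. -/
def rightVal (x : Ω.carrier) : S0 Ω := if h : ∃ v, F.IsRightVal x v then h.choose else 0

theorem leftVal_eq {y : Ω.carrier} {v : S0 Ω} (h : F.IsLeftVal y v) : F.leftVal y = v := by
  have he : ∃ v, F.IsLeftVal y v := ⟨v, h⟩
  rw [leftVal, dif_pos he]
  exact IsLeftVal.unique F he.choose_spec h

theorem rightVal_eq {y : Ω.carrier} {v : S0 Ω} (h : F.IsRightVal y v) : F.rightVal y = v := by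
  have he : ∃ v, F.IsRightVal y v := ⟨v, h⟩
  rw [rightVal, dif_pos he]
  exact IsRightVal.unique F he.choose_spec h

/-- Around a point off `C_F` there are intervals of monotonicity on both sides. -/
theorem exists_sides {x : Ω.carrier} (hx : (x : ℝ) ∉ F.C) :
    (∃ w, F.MonotoneBetween w x) ∧ ∃ y, F.MonotoneBetween x y := by
  obtain ⟨i, hi⟩ := mem_iUnion.1 x.2
  have ha : Ω.a i < x := lt_of_le_of_ne hi.1 fun h =>
    hx (h ▸ F.boundary_subset (Or.inl ⟨i, rfl⟩))
  have hb : (x : ℝ) < Ω.b i := lt_of_le_of_ne hi.2 fun h =>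
    hx (h ▸ F.boundary_subset (Or.inr ⟨i, rfl⟩))
  have hn : Ioo (Ω.a i) (Ω.b i) \ F.C ∈ 𝓝 (x : ℝ) :=
    (isOpen_Ioo.sdiff F.finite_C.isClosed).mem_nhds ⟨⟨ha, hb⟩, hx⟩
  obtain ⟨l, u, hlu, hsub⟩ := mem_nhds_iff_exists_Ioo_subset.1 hn
  obtain ⟨w, hw⟩ := exists_between hlu.1
  obtain ⟨y, hy⟩ := exists_between hlu.2
  have mem : ∀ t ∈ Ioo l u, t ∈ Ω.carrier \ F.C := fun t ht =>
    ⟨mem_iUnion.2 ⟨i, Ioo_subset_Icc_self (hsub ht).1⟩, (hsub ht).2⟩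
  exact ⟨⟨⟨w, (mem w ⟨hw.1, hw.2.trans hlu.2⟩).1⟩, hw.2,
      fun t ht => mem t ⟨hw.1.trans ht.1, ht.2.trans hlu.2⟩⟩,
    ⟨⟨y, (mem y ⟨hlu.1.trans hy.1, hy.2⟩).1⟩, hy.1,
      fun t ht => mem t ⟨hlu.1.trans ht.1, ht.2.trans hy.2⟩⟩⟩

theorem leftVal_eq_rightVal {x : Ω.carrier} (hx : (x : ℝ) ∉ F.C) :
    F.leftVal x = F.rightVal x := by
  obtain ⟨⟨w, hw⟩, ⟨y, hy⟩⟩ := F.exists_sides hx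
  obtain ⟨-, -, q, -, -, -, hq⟩ := F.exists_limits hw
  obtain ⟨-, p, -, -, -, hp, -⟩ := F.exists_limits hy
  have h1 : F.IsLeftVal x _ := ⟨w, q, hw, hq, rfl⟩
  have h2 : F.IsRightVal x _ := ⟨y, p, hy, hp, rfl⟩
  rw [F.leftVal_eq h1, F.rightVal_eq h2]
  exact F.left_eq_right hx hw hy h1 h2

open Classical in
/-- Auxiliary: a primitive whose increments give `εF_{#1}`. -/
def primitive (x : Ω.carrier) : S0 Ω :=
  F.leftVal x + ∑ c ∈ F.finite_C.toFinset,
    if h : c ∈ F.C ∧ c < (x : ℝ) then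
      F.leftVal ⟨c, F.C_subset h.1⟩ - F.rightVal ⟨c, F.C_subset h.1⟩ else 0

theorem primitive_sub {x y : Ω.carrier} (h : F.MonotoneBetween x y) :
    F.primitive y - F.primitive x = F.leftVal y - F.rightVal x := by
  classical
  have hxy : (x : ℝ) < y := h.1
  have key : ∀ c ∈ F.finite_C.toFinset,
      ((if h : c ∈ F.C ∧ c < (y : ℝ) then
        F.leftVal ⟨c, F.C_subset h.1⟩ - F.rightVal ⟨c, F.C_subset h.1⟩ else 0) -
      if h : c ∈ F.C ∧ c < (x : ℝ) then
        F.leftVal ⟨c, F.C_subset h.1⟩ - F.rightVal ⟨c, F.C_subset h.1⟩ else 0) =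
      if c = (x : ℝ) then F.leftVal x - F.rightVal x else 0 := by
    intro c hc
    have hcC : c ∈ F.C := F.finite_C.mem_toFinset.1 hc
    rcases lt_trichotomy c (x : ℝ) with hlt | heq | hgt
    · rw [dif_pos ⟨hcC, hlt.trans hxy⟩, dif_pos ⟨hcC, hlt⟩, if_neg hlt.ne, sub_self]
    · subst heq
      rw [dif_pos ⟨hcC, hxy⟩, dif_neg (fun hh => lt_irrefl _ hh.2), if_pos rfl, sub_zero]
    · have hny : ¬ c < (y : ℝ) := fun hcy => (h.2 ⟨hgt, hcy⟩).2 hcC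
      rw [dif_neg (fun hh => hny hh.2), dif_neg (fun hh => lt_asymm hgt hh.2), if_neg hgt.ne',
        sub_zero]
  have e : F.primitive y - F.primitive x = F.leftVal y - F.leftVal x +
      ∑ c ∈ F.finite_C.toFinset, if c = (x : ℝ) then F.leftVal x - F.rightVal x else 0 := by
    rw [← Finset.sum_congr rfl key, Finset.sum_sub_distrib]
    unfold primitive
    abel
  rw [e, Finset.sum_ite_eq' F.finite_C.toFinset (x : ℝ)]
  split_ifs with hx
  · abel
  · rw [F.leftVal_eq_rightVal fun hh => hx (F.finite_C.mem_toFinset.2 hh), add_zero]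

theorem primitive_sub_eq {x y p q : Ω.carrier} (h : F.MonotoneBetween x y)
    (hp : Tendsto F.toFun (𝓝[>] (x : ℝ)) (𝓝 (p : ℝ)))
    (hq : Tendsto F.toFun (𝓝[<] (y : ℝ)) (𝓝 (q : ℝ))) :
    F.primitive y - F.primitive x = F.signBetween x y • (pt q - pt p) := by
  rw [F.primitive_sub h, F.leftVal_eq ⟨x, q, h, hq, rfl⟩, F.rightVal_eq ⟨y, p, h, hp, rfl⟩,
    smul_sub]

/-- Existence and uniqueness of `εF_{#1}`. -/
theorem existsUnique_signedPush1 : ∃! φ : S1 Ω →ₗ[ℝ] S1 Ω, F.IsSignedPush1 φ := by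
  let ψ : S0 Ω →ₗ[ℝ] S0 Ω := Finsupp.linearCombination ℝ F.primitive
  have hpt : ∀ x, ψ (pt x) = F.primitive x := fun x => by
    simp [ψ, pt, Finsupp.linearCombination_single]
  have hmap : ∀ v ∈ S1 Ω, ψ v ∈ S1 Ω := by
    intro v hv
    rw [F.S1_eq_span] at hv
    induction hv using Submodule.span_induction with
    | mem v hv =>
      obtain ⟨x, y, h, rfl⟩ := hv
      obtain ⟨j, p, q, hpj, hqj, hp, hq⟩ := F.exists_limits h
      rw [map_sub, hpt, hpt, F.primitive_sub_eq h hp hq]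
      exact Submodule.smul_mem _ _ (Submodule.subset_span ⟨j, p, q, hpj, hqj, rfl⟩)
    | zero => rw [map_zero]; exact Submodule.zero_mem _
    | add v w _ _ hv hw => rw [map_add]; exact Submodule.add_mem _ hv hw
    | smul r v _ hv => rw [map_smul]; exact Submodule.smul_mem _ _ hv
  refine ⟨ψ.restrict hmap, ?_, ?_⟩
  · intro x y p q h hp hq v hv
    rw [LinearMap.coe_restrict_apply, hv, map_sub, hpt, hpt, F.primitive_sub_eq h hp hq]
  · intro φ hφ
    refine LinearMap.ext fun v => Subtype.ext ?_
    have hmem : (v : S0 Ω) ∈ Submodule.span ℝ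
        {v | ∃ x y : Ω.carrier, F.MonotoneBetween x y ∧ v = pt y - pt x} := by
      rw [← F.S1_eq_span]; exact v.2
    have key : ∀ w ∈ Submodule.span ℝ
        {v | ∃ x y : Ω.carrier, F.MonotoneBetween x y ∧ v = pt y - pt x},
        ∀ u : S1 Ω, (u : S0 Ω) = w → (φ u : S0 Ω) = ψ w := by
      intro w hw
      induction hw using Submodule.span_induction with
      | mem w hw =>
        obtain ⟨x, y, h, rfl⟩ := hw
        intro u hu
        obtain ⟨j, p, q, hpj, hqj, hp, hq⟩ := F.exists_limits h
        rw [hφ x y p q h hp hq u hu, map_sub, hpt, hpt, F.primitive_sub_eq h hp hq]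
      | zero =>
        intro u hu
        obtain rfl : u = 0 := Subtype.ext hu
        simp
      | add a b ha hb iha ihb =>
        intro u hu
        rw [← F.S1_eq_span] at ha hb
        obtain rfl : u = ⟨a, ha⟩ + ⟨b, hb⟩ := Subtype.ext hu
        rw [map_add, map_add, Submodule.coe_add, iha ⟨a, ha⟩ rfl, ihb ⟨b, hb⟩ rfl]
      | smul r a ha iha =>
        intro u hu
        rw [← F.S1_eq_span] at ha
        obtain rfl : u = r • ⟨a, ha⟩ := Subtype.ext hu
        rw [map_smul, map_smul, Submodule.coe_smul, iha ⟨a, ha⟩ rfl]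
    rw [key v hmem v rfl, LinearMap.coe_restrict_apply]

/-- `εF_{#1}`, the unique endomorphism of `S₁(Ω;ℝ)` with
`εF_{#1}(y - x) = ε([x,y]) (F(y-) - F(x+))` whenever `F` is monotone on `[x,y]`. -/
def signedPush1 : S1 Ω →ₗ[ℝ] S1 Ω := F.existsUnique_signedPush1.choose

end PMMap

/-! ### Traces and determinants of pairs of endomorphisms -/

section Pairs

variable {V : Type*} [AddCommGroup V] [Module ℝ V]

/-- The trace of an endomorphism of finite rank, that is the trace of its restriction to its
(finite-dimensional) image. -/
def finTrace (φ : V →ₗ[ℝ] V) : ℝ :=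
  LinearMap.trace ℝ (LinearMap.range φ)
    (φ.restrict (p := LinearMap.range φ) (q := LinearMap.range φ)
      fun x _ => LinearMap.mem_range_self φ x)

/-- `t` is a trace of the pair `(φ₀, φ₁)` of endomorphisms of finite-codimensional subspaces
`V₀`, `V₁` of `V`: there are extensions `ψ₀`, `ψ₁` to `V` whose difference has finite rank, and
`t = tr(ψ₁ - ψ₀) - tr χ₁ + tr χ₀`, where `χⱼ` is induced by `ψⱼ` on `V/Vⱼ`. -/
def HasPairTrace {V₀ V₁ : Submodule ℝ V} (φ₀ : Module.End ℝ V₀) (φ₁ : Module.End ℝ V₁)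
    (t : ℝ) : Prop :=
  FiniteDimensional ℝ (V ⧸ V₀) ∧ FiniteDimensional ℝ (V ⧸ V₁) ∧
  ∃ (ψ₀ ψ₁ : V →ₗ[ℝ] V) (χ₀ : (V ⧸ V₀) →ₗ[ℝ] (V ⧸ V₀)) (χ₁ : (V ⧸ V₁) →ₗ[ℝ] (V ⧸ V₁)),
    (∀ v : V₀, ψ₀ v = φ₀ v) ∧ (∀ v : V₁, ψ₁ v = φ₁ v) ∧
    (∀ v, χ₀ (V₀.mkQ v) = V₀.mkQ (ψ₀ v)) ∧ (∀ v, χ₁ (V₁.mkQ v) = V₁.mkQ (ψ₁ v)) ∧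
    FiniteDimensional ℝ (LinearMap.range (ψ₁ - ψ₀)) ∧
    t = finTrace (ψ₁ - ψ₀) - LinearMap.trace ℝ (V ⧸ V₁) χ₁ + LinearMap.trace ℝ (V ⧸ V₀) χ₀

open Classical in
/-- The trace of a pair of finite rank (it does not depend on the extensions chosen). -/
def pairTrace {V₀ V₁ : Submodule ℝ V} (φ₀ : Module.End ℝ V₀) (φ₁ : Module.End ℝ V₁) : ℝ :=
  if h : ∃ t, HasPairTrace φ₀ φ₁ t then h.choose else 0

/-- The determinant of a pair of finite rank, the formal power series
`exp (- ∑_{n ≥ 1} tr(φ₀ⁿ, φ₁ⁿ) zⁿ / n)`. The coefficient at `n = 0` of the series under the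
exponential is a division by `0`, hence `0`. -/
def pairDet {V₀ V₁ : Submodule ℝ V} (φ₀ : Module.End ℝ V₀) (φ₁ : Module.End ℝ V₁) :
    PowerSeries ℝ :=
  (PowerSeries.exp ℝ).subst
    (PowerSeries.mk fun n : ℕ => -(pairTrace (φ₀ ^ n) (φ₁ ^ n) / (n : ℝ)))

end Pairs

/-- The kneading determinant `D(z)` of `F`, the determinant of the pair `(εF_{#0}, εF_{#1})` on
`S₀(Ω;ℝ)`; here `εF_{#0}` is an endomorphism of the whole space. -/
def PMMap.kneadingDet {Ω : IntervalUnion} (F : PMMap Ω) : PowerSeries ℝ :=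
  pairDet (V₀ := (⊤ : Submodule ℝ (S0 Ω))) (V₁ := S1 Ω)
    (F.signedPush0.restrict fun _ _ => Submodule.mem_top) F.signedPush1

/-! ### The relation between graph maps and piecewise monotone maps -/

/-- `f : G → G` is induced by `F : Ω \ C_F → Ω`: there is a continuous `π : Ω → G` such that
`Ver(G) ⊆ π(∂Ω)`, `π` maps `Ω \ ∂Ω` homeomorphically onto `G \ π(∂Ω)`, and `π ∘ F = f ∘ π` on
`Ω \ C_F`. -/
def InducedBy {G : Type*} [TopologicalSpace G] (f : G → G) {Ω : IntervalUnion} (F : PMMap Ω) :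
    Prop :=
  ∃ π : Ω.carrier → G, Continuous π ∧
    vertices G ⊆ π '' {x | (x : ℝ) ∈ Ω.boundary} ∧
    IsEmbedding ({x : Ω.carrier | (x : ℝ) ∉ Ω.boundary}.domRestrict π) ∧
    π '' {x | (x : ℝ) ∉ Ω.boundary} = (π '' {x | (x : ℝ) ∈ Ω.boundary})ᶜ ∧
    ∀ (x : ℝ) (hx : x ∈ Ω.carrier \ F.C), π ⟨F.toFun x, F.mapsTo hx⟩ = f (π ⟨x, hx.1⟩)

end PMGraph

end

noncomputable section
namespace PMGraph

/-! ### Traces of endomorphisms of finite rank -/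

section FinTrace

variable {V : Type*} [AddCommGroup V] [Module ℝ V]

/-! Write ψ₀ for `εF_{#0}` and ψ₁ for `push1Ext`, an extension of `εF_{#1}` to S₀ with values in S₁.
Because of these values no quotient trace survives, and the pair trace of the n-th powers is tr(ψ₁ⁿ
- ψ₀ⁿ). Moreover ψ₁ - ψ₀ = ∑ lⱼ(·) wⱼ has finite rank, with one term for each side of each point c
of C_F: lⱼ is a step function jumping at c, and wⱼ is, up to sign, the one-sided value of εF at c
(`push1Ext_eq`). Hence D is the determinant of the finite matrix with entries δᵢⱼ - z ∑ zⁿ lᵢ(ψ₀ⁿ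
wⱼ) (`exp_trace_eq_det`, `kneadingDet_eq_det`). Since ψ₀ sends a point to plus or minus a point or
to 0, the entries have bounded coefficients and D converges for |z| < 1.

The sign ε makes ψ₁ preserve the cone of positively oriented chains. Let u be the sum of the
components of Ω. Each lap of Fⁿ contributes to ψ₁ⁿu the interval onto which it is mapped; so for n ≥
1 the length of ψ₁ⁿu is Var(Fⁿ), and step functionals of ψ₁ⁿu bound numbers of preimages
(`variation_eq`, `ncard_preimages_le`).

Let S(z) = ∑ⱼ ∑ₙ zⁿ lⱼ(ψ₁ⁿu), a series with nonnegative coefficients. If S converged in the whole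
unit disc, numbers of preimages would grow subexponentially, and so would the covering numbers of f
(`coverEntropy_nonpos`). Positive entropy therefore gives S a radius of convergence r < 1. By
Cramer's rule DS converges in the unit disc, so S is meromorphic there. If S were bounded on [0,r[,
nonnegativity would bound it on |z| < r, exclude poles on |z| = r and give convergence beyond r. So
S(t) → ∞ as t ↑ r, and D(r) = lim (DS)(t)/S(t) = 0 (`IsRadius.evalAt_kneadingDet`). The zero is z =
r itself.

It remains to see that Var(Fⁿ) grows like r⁻ⁿ. The upper bound is convergence below r. For the lower
bound put σ = S(t), let v be a long partial sum of ∑ tⁿψ₁ⁿu, and let L(n) be the length of ψ₁ⁿu. All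
step functionals are at most Bσ on v, so Bσu - v lies in the cone; and v contains a multiple of σ of
a fixed interval, so its length is at least κσ (`IsRadius.exists_lower`). Applying ψ₁ᵐ to Bσu - v
gives ∑ L(m+n)tⁿ ≤ BσL(m). Splitting the length of v after m terms gives κσ ≤ ∑_{k<m} L(k) +
tᵐBσL(m). Dividing by σ → ∞ leaves κ ≤ B L(m) rᵐ (`IsRadius.le_chainLength`). -/

theorem finTrace_eq_trace_restrict {φ : V →ₗ[ℝ] V} (W : Submodule ℝ V) [FiniteDimensional ℝ W]
    (hW : ∀ x, φ x ∈ W) :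
    finTrace φ = LinearMap.trace ℝ W (φ.restrict fun x _ => hW x) := by
  have hle : LinearMap.range φ ≤ W := by rintro _ ⟨x, rfl⟩; exact hW x
  have : FiniteDimensional ℝ (LinearMap.range φ) := Submodule.finiteDimensional_of_le hle
  let A : W →ₗ[ℝ] LinearMap.range φ := φ.rangeRestrict ∘ₗ W.subtype
  let B : LinearMap.range φ →ₗ[ℝ] W := Submodule.inclusion hle
  -- `B ∘ A` is the restriction of φ to W and `A ∘ B` its restriction to the range.
  have h := LinearMap.trace_comp_comm' A B
  unfold finTrace
  convert h.symm using 2 <;> ext x <;> rfl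

/-- Cyclicity of the trace when only the intermediate space is finite-dimensional; it reduces traces
on `V` to traces on `V ⧸ V₁` or on a line. -/
theorem finTrace_comp {E : Type*} [AddCommGroup E] [Module ℝ E] [FiniteDimensional ℝ E]
    (A : V →ₗ[ℝ] E) (B : E →ₗ[ℝ] V) : finTrace (B ∘ₗ A) = LinearMap.trace ℝ E (A ∘ₗ B) := by
  rw [finTrace_eq_trace_restrict (LinearMap.range B) fun x => LinearMap.mem_range_self B (A x)]
  have h := LinearMap.trace_comp_comm' (A ∘ₗ (LinearMap.range B).subtype) B.rangeRestrict
  exact Eq.trans rfl (h.trans rfl)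

theorem finTrace_smulRight (l : V →ₗ[ℝ] ℝ) (w : V) : finTrace (l.smulRight w) = l w := by
  have h : l.smulRight w = (LinearMap.toSpanSingleton ℝ V w) ∘ₗ l := by ext; simp
  rw [h, finTrace_comp, LinearMap.trace_eq_matrix_trace ℝ (Module.Basis.singleton Unit ℝ)]
  simp [Matrix.trace, LinearMap.toMatrix_apply]

theorem finTrace_add {φ ψ : V →ₗ[ℝ] V} (hφ : FiniteDimensional ℝ (LinearMap.range φ))
    (hψ : FiniteDimensional ℝ (LinearMap.range ψ)) :
    finTrace (φ + ψ) = finTrace φ + finTrace ψ := by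
  let W := LinearMap.range φ ⊔ LinearMap.range ψ
  have h1 : ∀ x, φ x ∈ W := fun x => le_sup_left (a := LinearMap.range φ) ⟨x, rfl⟩
  have h2 : ∀ x, ψ x ∈ W := fun x => le_sup_right (a := LinearMap.range φ) ⟨x, rfl⟩
  have h3 : ∀ x, (φ + ψ) x ∈ W := fun x => W.add_mem (h1 x) (h2 x)
  rw [finTrace_eq_trace_restrict W h1, finTrace_eq_trace_restrict W h2,
    finTrace_eq_trace_restrict W h3, ← map_add]
  rfl

theorem finiteDimensional_range_add {φ ψ : V →ₗ[ℝ] V}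
    (hφ : FiniteDimensional ℝ (LinearMap.range φ)) (hψ : FiniteDimensional ℝ (LinearMap.range ψ)) :
    FiniteDimensional ℝ (LinearMap.range (φ + ψ)) :=
  Submodule.finiteDimensional_of_le (LinearMap.range_add_le φ ψ)

theorem finTrace_zero : finTrace (0 : V →ₗ[ℝ] V) = 0 := by
  have h := finTrace_smulRight (0 : V →ₗ[ℝ] ℝ) 0
  rwa [LinearMap.zero_apply, LinearMap.smulRight_zero] at h

theorem finiteDimensional_range_sum {ι : Type*} (s : Finset ι) {φ : ι → V →ₗ[ℝ] V}
    (h : ∀ i ∈ s, FiniteDimensional ℝ (LinearMap.range (φ i))) :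
    FiniteDimensional ℝ (LinearMap.range (∑ i ∈ s, φ i)) := by
  classical
  induction s using Finset.induction_on with
  | empty => rw [Finset.sum_empty, LinearMap.range_zero]; infer_instance
  | insert a s ha ih =>
    rw [Finset.sum_insert ha]
    exact finiteDimensional_range_add (h a (Finset.mem_insert_self a s))
      (ih fun i hi => h i (Finset.mem_insert_of_mem hi))

theorem finTrace_sum {ι : Type*} (s : Finset ι) {φ : ι → V →ₗ[ℝ] V}
    (h : ∀ i ∈ s, FiniteDimensional ℝ (LinearMap.range (φ i))) :
    finTrace (∑ i ∈ s, φ i) = ∑ i ∈ s, finTrace (φ i) := by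
  classical
  induction s using Finset.induction_on with
  | empty => simp [finTrace_zero]
  | insert a s ha ih =>
    have h' := fun i (hi : i ∈ s) => h i (Finset.mem_insert_of_mem hi)
    rw [Finset.sum_insert ha, Finset.sum_insert ha,
      finTrace_add (h a (Finset.mem_insert_self a s)) (finiteDimensional_range_sum s h'), ih h']

theorem finiteDimensional_range_smulRight (l : V →ₗ[ℝ] ℝ) (w : V) :
    FiniteDimensional ℝ (LinearMap.range (l.smulRight w)) := by
  refine Submodule.finiteDimensional_of_le (S₂ := Submodule.span ℝ {w}) ?_
  rintro _ ⟨x, rfl⟩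
  exact Submodule.smul_mem _ _ (Submodule.mem_span_singleton_self w)

/-- The trace of a pair whose first member is defined on the whole space and whose second member
extends to an endomorphism with values in its domain of definition. -/
theorem pairTrace_eq_finTrace {V₁ : Submodule ℝ V} [hV₁ : FiniteDimensional ℝ (V ⧸ V₁)]
    {φ₀ : Module.End ℝ (⊤ : Submodule ℝ V)} {φ₁ : Module.End ℝ V₁} (ψ₀ ψ₁ : V →ₗ[ℝ] V)
    (h₀ : ∀ v : (⊤ : Submodule ℝ V), ψ₀ v = φ₀ v) (h₁ : ∀ v : V₁, ψ₁ v = φ₁ v)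
    (hr : ∀ v, ψ₁ v ∈ V₁) (hfin : FiniteDimensional ℝ (LinearMap.range (ψ₁ - ψ₀))) :
    pairTrace φ₀ φ₁ = finTrace (ψ₁ - ψ₀) := by
  have hex : ∃ t, HasPairTrace φ₀ φ₁ t := by
    refine ⟨_, inferInstance, hV₁, ψ₀, ψ₁, 0, 0, h₀, h₁, fun v => Subsingleton.elim _ _,
      fun v => ?_, hfin, rfl⟩
    rw [LinearMap.zero_apply, eq_comm]
    exact (Submodule.Quotient.mk_eq_zero V₁).2 (hr v)
  rw [pairTrace, dif_pos hex]
  -- The chosen extension ψ₁' is unknown, but ψ₁' - ψ₁ kills `V₁` and so factors as `δ ∘ mkQ`. Its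
  -- trace is that of `mkQ ∘ δ`, which is χ₁ because ψ₁ dies in the quotient; the term -tr χ₁
  -- cancels it.
  generalize hex.choose = t, hex.choose_spec = ht
  obtain ⟨-, -, ψ₀', ψ₁', χ₀, χ₁, h₀', h₁', -, hχ₁, hfin', rfl⟩ := ht
  have e₀ : ψ₀' = ψ₀ := LinearMap.ext fun v =>
    (h₀' ⟨v, Submodule.mem_top⟩).trans (h₀ ⟨v, Submodule.mem_top⟩).symm
  subst e₀
  have eχ : χ₀ = 0 := LinearMap.ext fun v => Subsingleton.elim _ _
  have hδ : V₁ ≤ LinearMap.ker (ψ₁' - ψ₁) := fun v hv => by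
    rw [LinearMap.mem_ker, LinearMap.sub_apply, h₁ ⟨v, hv⟩, h₁' ⟨v, hv⟩, sub_self]
  let δ : (V ⧸ V₁) →ₗ[ℝ] V := V₁.liftQ (ψ₁' - ψ₁) hδ
  have e : ψ₁' - ψ₁ = δ ∘ₗ V₁.mkQ := (V₁.liftQ_mkQ _ hδ).symm
  have eδ : V₁.mkQ ∘ₗ δ = χ₁ := by
    refine Submodule.linearMap_qext V₁ (LinearMap.ext fun v => ?_)
    have : δ (V₁.mkQ v) = ψ₁' v - ψ₁ v := by
      rw [← LinearMap.comp_apply, ← e, LinearMap.sub_apply]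
    rw [LinearMap.comp_apply, LinearMap.comp_apply, LinearMap.comp_apply, this, map_sub, hχ₁,
      sub_eq_self]
    exact (Submodule.Quotient.mk_eq_zero V₁).2 (hr v)
  have hd : FiniteDimensional ℝ (LinearMap.range (ψ₁' - ψ₁)) := by
    rw [e]
    exact Submodule.finiteDimensional_of_le (LinearMap.range_comp_le_range V₁.mkQ δ)
  have es : ψ₁' - ψ₀' = (ψ₁' - ψ₁) + (ψ₁ - ψ₀') := by abel
  rw [eχ, map_zero, es, finTrace_add hd hfin, e, finTrace_comp, eδ]
  ring

end FinTrace

end PMGraph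
end

noncomputable section
namespace PMGraph

/-! ### The determinant of a perturbation of finite rank -/

/-! ### Derivations of determinants. -/

section Jacobi

variable {R A : Type*} [CommRing R] [CommRing A] [Algebra R A]

theorem derivation_prod {ι : Type*} [DecidableEq ι] (D : Derivation R A A) (s : Finset ι)
    (f : ι → A) : D (∏ i ∈ s, f i) = ∑ i ∈ s, (∏ j ∈ s.erase i, f j) * D (f i) := by
  induction s using Finset.induction_on with
  | empty => simp
  | insert a s ha ih =>
    rw [Finset.prod_insert ha, D.leibniz, ih, Finset.sum_insert ha, Finset.erase_insert ha,
      smul_eq_mul, smul_eq_mul, Finset.mul_sum, add_comm]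
    congr 1
    refine Finset.sum_congr rfl fun i hi => ?_
    have hne : a ≠ i := fun h => ha (h ▸ hi)
    rw [Finset.erase_insert_of_ne hne, Finset.prod_insert fun h => ha (Finset.mem_of_mem_erase h),
      mul_assoc]

/-- Jacobi's formula for the derivative of a determinant. -/
theorem derivation_det {n : Type*} [Fintype n] [DecidableEq n] (D : Derivation R A A)
    (M : Matrix n n A) : D M.det = (M.adjugate * M.map D).trace := by
  -- By Cramer's rule the i-th diagonal entry is the determinant of M with its i-th column
  -- differentiated.
  have h : ∀ i, (M.adjugate * M.map D) i i =
      ∑ σ : Equiv.Perm n, Equiv.Perm.sign σ •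
        ((∏ j ∈ Finset.univ.erase i, M (σ j) j) * D (M (σ i) i)) := by
    intro i
    have : (M.adjugate * M.map D) i i = (M.adjugate.mulVec fun k => D (M k i)) i := rfl
    rw [this, ← Matrix.cramer_eq_adjugate_mulVec, Matrix.cramer_apply, Matrix.det_apply]
    refine Finset.sum_congr rfl fun σ _ => ?_
    rw [← Finset.prod_erase_mul _ _ (Finset.mem_univ i), Matrix.updateCol_self]
    congr 2
    refine Finset.prod_congr rfl fun j hj => ?_
    rw [Matrix.updateCol_ne (Finset.ne_of_mem_erase hj)]
  rw [Matrix.trace, Matrix.det_apply, map_sum]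
  simp_rw [Matrix.diag_apply, h]
  rw [Finset.sum_comm]
  refine Finset.sum_congr rfl fun σ _ => ?_
  rw [← Finset.smul_sum, ← derivation_prod]
  rcases Int.units_eq_one_or (Equiv.Perm.sign σ) with h | h <;> simp [h]

end Jacobi

/-! ### Formal resolvents and the kneading matrix. -/

section FiniteRank

open PowerSeries

variable {V : Type*} [AddCommGroup V] [Module ℝ V]

/-- The series `∑ zⁿ θ(ψⁿ v)`. -/
def orbitSeries (ψ : Module.End ℝ V) (θ : V →ₗ[ℝ] ℝ) (v : V) : PowerSeries ℝ :=
  PowerSeries.mk fun n => θ ((ψ ^ n) v)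

@[simp]
theorem coeff_orbitSeries (ψ : Module.End ℝ V) (θ : V →ₗ[ℝ] ℝ) (v : V) (n : ℕ) :
    coeff n (orbitSeries ψ θ v) = θ ((ψ ^ n) v) := by
  simp [orbitSeries]

variable {J : Type*} [Fintype J] {ψ₀ ψ₁ : Module.End ℝ V} {l : J → V →ₗ[ℝ] ℝ} {w : J → V}

/-- The second resolvent identity R₁ = R₀ + z R₁ K R₀ for Rᵢ = ∑ zⁿψᵢⁿ and K = ψ₁ - ψ₀: the sum of
ψ₁ᵖ(ψ₁ - ψ₀)ψ₀^q over p + q = n telescopes to ψ₁ⁿ⁺¹ - ψ₀ⁿ⁺¹. -/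
theorem resolvent_sub (hK : ∀ v, ψ₁ v = ψ₀ v + ∑ j, l j v • w j) :
    (PowerSeries.mk fun n => ψ₁ ^ n) = (PowerSeries.mk fun n => ψ₀ ^ n) +
      X * ((PowerSeries.mk fun n => ψ₁ ^ n) * (C (∑ j, (l j).smulRight (w j)) *
        (PowerSeries.mk fun n => ψ₀ ^ n)) : PowerSeries (Module.End ℝ V)) := by
  have hK' : ∑ j, (l j).smulRight (w j) = ψ₁ - ψ₀ := by
    refine LinearMap.ext fun v => ?_
    rw [LinearMap.sub_apply, hK v]
    simp
  rw [hK']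
  ext n : 1
  cases n with
  | zero => simp
  | succ n =>
    rw [map_add, coeff_succ_X_mul, coeff_mul]
    simp only [coeff_mk, coeff_C_mul]
    have : ∀ p ∈ Finset.HasAntidiagonal.antidiagonal n, ψ₁ ^ p.1 * ((ψ₁ - ψ₀) * ψ₀ ^ p.2) =
        ψ₁ ^ (p.1 + 1) * ψ₀ ^ (n - p.1) - ψ₁ ^ p.1 * ψ₀ ^ (n + 1 - p.1) := by
      intro p hp
      have hp' := Finset.HasAntidiagonal.mem_antidiagonal.1 hp
      have e1 : n - p.1 = p.2 := by omega
      have e2 : n + 1 - p.1 = p.2 + 1 := by omega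
      rw [e1, e2, sub_mul, mul_sub, ← mul_assoc, ← pow_succ, ← pow_succ']
    rw [Finset.sum_congr rfl this, Finset.Nat.sum_antidiagonal_eq_sum_range_succ_mk]
    have := Finset.sum_range_sub (fun k => ψ₁ ^ k * ψ₀ ^ (n + 1 - k)) (n + 1)
    simp only [Nat.add_sub_add_right] at this
    simp [this]

/-- The same identity with ψ₀ and ψ₁ exchanged, the perturbation being -K. -/
theorem resolvent_sub' (hK : ∀ v, ψ₁ v = ψ₀ v + ∑ j, l j v • w j) :
    (PowerSeries.mk fun n => ψ₁ ^ n) = (PowerSeries.mk fun n => ψ₀ ^ n) +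
      X * ((PowerSeries.mk fun n => ψ₀ ^ n) * (C (∑ j, (l j).smulRight (w j)) *
        (PowerSeries.mk fun n => ψ₁ ^ n)) : PowerSeries (Module.End ℝ V)) := by
  have hK' : ∀ v, ψ₀ v = ψ₁ v + ∑ j, l j v • (-w j) := fun v => by
    rw [hK v]
    simp
  have h := resolvent_sub hK'
  have e : ∑ j, (l j).smulRight (-w j) = -∑ j, (l j).smulRight (w j) := by
    rw [← Finset.sum_neg_distrib]
    refine Finset.sum_congr rfl fun j _ => ?_
    ext v; simp
  rw [e, map_neg, neg_mul, mul_neg, mul_neg, ← sub_eq_add_neg, eq_sub_iff_add_eq] at h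
  exact h.symm

/-- Applying a functional and a vector to a product that passes through a map of finite rank. -/
theorem coeff_mul_finiteRank_mul (P Q : PowerSeries (Module.End ℝ V)) (θ : V →ₗ[ℝ] ℝ) (v : V)
    (n : ℕ) : θ (coeff n (P * (C (∑ j, (l j).smulRight (w j)) * Q)) v) =
      coeff n (∑ j, (PowerSeries.mk fun k => θ (coeff k P (w j))) *
        (PowerSeries.mk fun k => l j (coeff k Q v))) := by
  rw [coeff_mul]
  simp_rw [coeff_C_mul]
  simp only [coeff_mul, coeff_mk, LinearMap.sum_apply, map_sum, Module.End.mul_apply,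
    LinearMap.smulRight_apply, map_smul, smul_eq_mul]
  rw [Finset.sum_comm]
  refine Finset.sum_congr rfl fun _ _ => Finset.sum_congr rfl fun _ _ => mul_comm _ _

/-- The series `∑ zⁿ θ(ψ₁ⁿ v)` in terms of the orbits of `ψ₀`. -/
theorem orbitSeries_eq (hK : ∀ v, ψ₁ v = ψ₀ v + ∑ j, l j v • w j) (θ : V →ₗ[ℝ] ℝ) (v : V) :
    orbitSeries ψ₁ θ v = orbitSeries ψ₀ θ v +
      X * ∑ j, orbitSeries ψ₀ θ (w j) * orbitSeries ψ₁ (l j) v := by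
  ext n
  have h := congrArg (fun P : PowerSeries (Module.End ℝ V) => θ (coeff n P v)) (resolvent_sub' hK)
  simp only [coeff_mk, map_add, LinearMap.add_apply] at h
  rw [coeff_orbitSeries, h, map_add, coeff_orbitSeries]
  congr 1
  cases n with
  | zero => simp
  | succ n =>
    rw [coeff_succ_X_mul, coeff_succ_X_mul, coeff_mul_finiteRank_mul]
    simp [orbitSeries]

variable (ψ₀ ψ₁ l w) in
/-- The matrix of the product of the two resolvents. -/
def resolventMatrix : Matrix J J (PowerSeries ℝ) :=
  Matrix.of fun i j => PowerSeries.mk fun n =>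
    l i (coeff n ((PowerSeries.mk fun n => ψ₀ ^ n) * (PowerSeries.mk fun n => ψ₁ ^ n)) (w j))

/-- By `resolvent_sub`, ψ₁ⁿ⁺¹ - ψ₀ⁿ⁺¹ is a sum of rank-one maps v ↦ lⱼ(ψ₀^q v) ψ₁ᵖwⱼ with p + q = n.
Their traces lⱼ(ψ₀^q ψ₁ᵖ wⱼ) add up to the diagonal of the matrix of R₀R₁. -/
theorem trace_resolventMatrix (hK : ∀ v, ψ₁ v = ψ₀ v + ∑ j, l j v • w j) (n : ℕ) :
    coeff n (resolventMatrix ψ₀ ψ₁ l w).trace = finTrace (ψ₁ ^ (n + 1) - ψ₀ ^ (n + 1)) ∧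
      FiniteDimensional ℝ (LinearMap.range (ψ₁ ^ (n + 1) - ψ₀ ^ (n + 1))) := by
  have h := congrArg (coeff (n + 1)) (resolvent_sub hK)
  rw [map_add, coeff_mk, coeff_mk, coeff_succ_X_mul, ← sub_eq_iff_eq_add', coeff_mul] at h
  have e : ψ₁ ^ (n + 1) - ψ₀ ^ (n + 1) = ∑ p ∈ Finset.HasAntidiagonal.antidiagonal n, ∑ j,
      ((l j) ∘ₗ (ψ₀ ^ p.2)).smulRight ((ψ₁ ^ p.1) (w j)) := by
    rw [h]
    refine Finset.sum_congr rfl fun p _ => ?_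
    rw [coeff_C_mul, coeff_mk, coeff_mk, Finset.sum_mul, Finset.mul_sum]
    refine Finset.sum_congr rfl fun j _ => ?_
    ext v
    simp
  have hf : ∀ p ∈ Finset.HasAntidiagonal.antidiagonal n, FiniteDimensional ℝ (LinearMap.range (∑ j,
      ((l j) ∘ₗ (ψ₀ ^ p.2)).smulRight ((ψ₁ ^ p.1) (w j)))) := fun p _ =>
    finiteDimensional_range_sum _ fun j _ => finiteDimensional_range_smulRight _ _
  rw [e]
  refine ⟨?_, finiteDimensional_range_sum _ hf⟩
  rw [finTrace_sum _ hf, Matrix.trace, map_sum]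
  simp only [Matrix.diag_apply, resolventMatrix, Matrix.of_apply, coeff_mk, coeff_mul,
    LinearMap.sum_apply, map_sum, Module.End.mul_apply]
  rw [Finset.sum_comm, ← Finset.Nat.sum_antidiagonal_swap]
  refine Finset.sum_congr rfl fun p _ => ?_
  rw [finTrace_sum _ fun j _ => finiteDimensional_range_smulRight _ _]
  simp [finTrace_smulRight]

variable [DecidableEq J]

/-- The kneading matrix of a perturbation of finite rank. -/
def kneadingMatrix (ψ₀ : Module.End ℝ V) (l : J → V →ₗ[ℝ] ℝ) (w : J → V) :
    Matrix J J (PowerSeries ℝ) :=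
  1 - Matrix.of fun i j => X * orbitSeries ψ₀ (l i) (w j)

theorem kneadingMatrix_mulVec (hK : ∀ v, ψ₁ v = ψ₀ v + ∑ j, l j v • w j) (v : V) :
    (kneadingMatrix ψ₀ l w).mulVec (fun j => orbitSeries ψ₁ (l j) v) =
      fun j => orbitSeries ψ₀ (l j) v := by
  funext i
  rw [kneadingMatrix, Matrix.sub_mulVec, Matrix.one_mulVec, Pi.sub_apply]
  conv_lhs => rw [orbitSeries_eq hK]
  rw [Finset.mul_sum, sub_eq_iff_eq_add]
  simp only [Matrix.mulVec, dotProduct, Matrix.of_apply, mul_assoc]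

/-- Cramer's rule for `kneadingMatrix_mulVec`. The right side involves orbits of ψ₀ only, so the
determinant is a common denominator for all the ψ₁-series. -/
theorem det_kneadingMatrix_mul (hK : ∀ v, ψ₁ v = ψ₀ v + ∑ j, l j v • w j) (v : V) (i : J) :
    (kneadingMatrix ψ₀ l w).det * orbitSeries ψ₁ (l i) v =
      (kneadingMatrix ψ₀ l w).adjugate.mulVec (fun j => orbitSeries ψ₀ (l j) v) i := by
  rw [← kneadingMatrix_mulVec hK, Matrix.mulVec_mulVec, Matrix.adjugate_mul, Matrix.smul_mulVec,
    Matrix.one_mulVec]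
  rfl

theorem constantCoeff_det_kneadingMatrix : constantCoeff (kneadingMatrix ψ₀ l w).det = 1 := by
  rw [RingHom.map_det]
  have : (constantCoeff (R := ℝ)).mapMatrix (kneadingMatrix ψ₀ l w) = 1 := by
    ext i j
    simp [kneadingMatrix, Matrix.one_apply, apply_ite]
  rw [this, Matrix.det_one]

/-- The derivative of z R₀ = ∑ zⁿ⁺¹ψ₀ⁿ is R₀², and multiplying `resolvent_sub` by R₀ on the left
gives R₀² = R₀R₁ - z R₀R₁ K R₀. Read between `l i` and `w j`, this is the asserted matrix identity.
-/
theorem resolventMatrix_mul (hK : ∀ v, ψ₁ v = ψ₀ v + ∑ j, l j v • w j) :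
    resolventMatrix ψ₀ ψ₁ l w * kneadingMatrix ψ₀ l w =
      -(kneadingMatrix ψ₀ l w).map (d⁄dX ℝ) := by
  ext i j n
  have h := congrArg (fun P : PowerSeries (Module.End ℝ V) =>
    l i (coeff n ((PowerSeries.mk fun n => ψ₀ ^ n) * P) (w j)))
    (resolvent_sub hK)
  set P₀ : PowerSeries (Module.End ℝ V) := PowerSeries.mk fun n => ψ₀ ^ n with hP₀
  set P₁ : PowerSeries (Module.End ℝ V) := PowerSeries.mk fun n => ψ₁ ^ n with hP₁
  have hsq : coeff n (P₀ * P₀) = (n + 1 : ℝ) • ψ₀ ^ n := by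
    rw [coeff_mul, Finset.sum_congr rfl (g := fun _ => ψ₀ ^ n)]
    · rw [Finset.sum_const, Finset.Nat.card_antidiagonal, ← Nat.cast_smul_eq_nsmul ℝ]; push_cast; rfl
    · intro p hp
      rw [hP₀, coeff_mk, coeff_mk, ← pow_add, Finset.HasAntidiagonal.mem_antidiagonal.1 hp]
  have hX : P₀ * (X * (P₁ * (C (∑ j, (l j).smulRight (w j)) * P₀))) =
      X * ((P₀ * P₁) * (C (∑ j, (l j).smulRight (w j)) * P₀)) := by
    rw [← mul_assoc P₀ X, (commute_X P₀).eq, mul_assoc, mul_assoc P₀]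
  rw [mul_add, map_add, LinearMap.add_apply, map_add, hsq, hX] at h
  rw [kneadingMatrix, mul_sub, mul_one]
  simp only [Matrix.sub_apply, map_sub, Matrix.neg_apply, Matrix.map_apply, map_neg, Matrix.of_apply]
  have e1 : coeff n (resolventMatrix ψ₀ ψ₁ l w i j) = l i (coeff n (P₀ * P₁) (w j)) := by
    simp [resolventMatrix, hP₀, hP₁]
  have e2 : coeff n (d⁄dX ℝ ((1 : Matrix J J (PowerSeries ℝ)) i j)) = 0 := by
    rw [Matrix.one_apply]; split_ifs <;> simp
  rw [e1, h, e2, coeff_derivative, coeff_succ_X_mul, coeff_orbitSeries]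
  have e3 : (resolventMatrix ψ₀ ψ₁ l w *
      (Matrix.of fun i j => X * orbitSeries ψ₀ (l i) (w j) : Matrix J J (PowerSeries ℝ)) :
        Matrix J J (PowerSeries ℝ)) i j =
      X * ∑ k, resolventMatrix ψ₀ ψ₁ l w i k * orbitSeries ψ₀ (l k) (w j) := by
    rw [Matrix.mul_apply, Finset.mul_sum]
    refine Finset.sum_congr rfl fun k _ => ?_
    rw [Matrix.of_apply]; ring
  have e4 : l i ((coeff n (X * ((P₀ * P₁) * (C (∑ j, (l j).smulRight (w j)) * P₀)) :
      PowerSeries (Module.End ℝ V)) : Module.End ℝ V) (w j)) =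
      coeff n (X * ∑ k, resolventMatrix ψ₀ ψ₁ l w i k * orbitSeries ψ₀ (l k) (w j)) := by
    cases n with
    | zero => simp
    | succ n =>
      rw [coeff_succ_X_mul, coeff_succ_X_mul, coeff_mul_finiteRank_mul]
      simp [orbitSeries, resolventMatrix, hP₀, hP₁]
  rw [e3, e4]
  simp
  ring

/-- The equation y' = Ty determines (n+1) times the coefficient n+1 of y from the lower
coefficients. -/
theorem eq_of_derivative_eq_mul {f g T : PowerSeries ℝ} (hf : d⁄dX ℝ f = T * f)
    (hg : d⁄dX ℝ g = T * g) (h0 : constantCoeff f = constantCoeff g) : f = g := by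
  have key : ∀ n, ∀ m ≤ n, coeff m f = coeff m g := by
    intro n
    induction n with
    | zero => intro m hm; rw [Nat.le_zero.1 hm]; simpa using h0
    | succ n ih =>
      intro m hm
      rcases Nat.lt_or_ge m (n + 1) with hlt | hge
      · exact ih m (Nat.lt_succ_iff.1 hlt)
      · obtain rfl : m = n + 1 := le_antisymm hm hge
        have h1 := congrArg (coeff n) hf
        have h2 := congrArg (coeff n) hg
        rw [coeff_derivative, coeff_mul] at h1 h2
        have : ∑ p ∈ Finset.HasAntidiagonal.antidiagonal n, coeff p.1 T * coeff p.2 f =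
            ∑ p ∈ Finset.HasAntidiagonal.antidiagonal n, coeff p.1 T * coeff p.2 g :=
          Finset.sum_congr rfl fun p hp => by
            rw [ih p.2 (by have := Finset.HasAntidiagonal.mem_antidiagonal.1 hp; omega)]
        rw [this, ← h2] at h1
        exact mul_right_cancel₀ (by positivity) h1
  ext n
  exact key n n le_rfl

/-- Both sides have constant term 1 and satisfy y' = Ty, where -T is the trace of the resolvent
matrix: the exponential by the chain rule, the determinant by Jacobi's formula. -/
theorem exp_trace_eq_det (hK : ∀ v, ψ₁ v = ψ₀ v + ∑ j, l j v • w j) (t : ℕ → ℝ)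
    (ht : ∀ n, t (n + 1) = finTrace (ψ₁ ^ (n + 1) - ψ₀ ^ (n + 1))) :
    (PowerSeries.exp ℝ).subst (PowerSeries.mk fun n : ℕ => -(t n / (n : ℝ))) =
      (kneadingMatrix ψ₀ l w).det := by
  set g : PowerSeries ℝ := PowerSeries.mk fun n : ℕ => -(t n / (n : ℝ)) with hgdef
  -- Division by zero makes the coefficient vanish whatever `t 0` is.
  have hg0 : constantCoeff g = 0 := by simp [hgdef]
  have hg : HasSubst g := HasSubst.of_constantCoeff_zero' hg0
  have hT : d⁄dX ℝ g = -(resolventMatrix ψ₀ ψ₁ l w).trace := by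
    ext n
    rw [coeff_derivative, map_neg, (trace_resolventMatrix hK n).1, hgdef, coeff_mk, ht n]
    push_cast
    field_simp
  refine eq_of_derivative_eq_mul (T := -(resolventMatrix ψ₀ ψ₁ l w).trace) ?_ ?_ ?_
  · rw [derivative_subst hg, derivative_exp, hT, mul_comm]
  · rw [derivation_det]
    -- Multiplying by the adjugate turns the matrix identity into det · tr R = -tr(adj M · M').
    have h := congrArg (fun M => (M * (kneadingMatrix ψ₀ l w).adjugate).trace)
      (resolventMatrix_mul hK)
    rw [mul_assoc, Matrix.mul_adjugate, neg_mul, Matrix.trace_neg, Matrix.mul_smul, mul_one,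
      Matrix.trace_smul, smul_eq_mul, Matrix.trace_mul_comm] at h
    rw [← neg_eq_iff_eq_neg.2 h]
    ring
  · rw [constantCoeff_det_kneadingMatrix, ← coeff_zero_eq_constantCoeff_apply,
      coeff_subst' hg, finsum_eq_single _ 0]
    · simp
    · intro n hn
      simp [hg0, hn]

end FiniteRank

end PMGraph
end

noncomputable section
namespace PMGraph

/-! ### Absolutely convergent power series -/

section Convergence

open PowerSeries

/-- Absolute convergence of a real power series at radius `t`. -/
def ConvAt (t : ℝ) (P : PowerSeries ℝ) : Prop := Summable fun n => |coeff n P| * t ^ n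

/-- The value of a real power series at a real or complex point. -/
def evalAt {𝕜 : Type*} [RCLike 𝕜] (z : 𝕜) (P : PowerSeries ℝ) : 𝕜 :=
  ∑' n, ((coeff n P : ℝ) : 𝕜) * z ^ n

theorem ConvAt.mono {s t : ℝ} {P : PowerSeries ℝ} (hs : 0 ≤ s) (hst : s ≤ t) (h : ConvAt t P) :
    ConvAt s P :=
  Summable.of_nonneg_of_le (fun n => by positivity)
    (fun n => mul_le_mul_of_nonneg_left (pow_le_pow_left₀ hs hst n) (abs_nonneg _)) h

theorem ConvAt.summable_norm {𝕜 : Type*} [RCLike 𝕜] {z : 𝕜} {P : PowerSeries ℝ}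
    (h : ConvAt ‖z‖ P) : Summable fun n => ‖((coeff n P : ℝ) : 𝕜) * z ^ n‖ := by
  refine h.congr fun n => ?_
  rw [norm_mul, norm_pow, RCLike.norm_ofReal]

theorem ConvAt.hasSum {𝕜 : Type*} [RCLike 𝕜] {z : 𝕜} {P : PowerSeries ℝ} (h : ConvAt ‖z‖ P) :
    HasSum (fun n => ((coeff n P : ℝ) : 𝕜) * z ^ n) (evalAt z P) :=
  h.summable_norm.of_norm.hasSum

theorem convAt_of_abs_le {t : ℝ} {P : PowerSeries ℝ} {g : ℕ → ℝ} (ht : 0 ≤ t)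
    (h : ∀ n, |coeff n P| ≤ g n) (hg : Summable fun n => g n * t ^ n) : ConvAt t P :=
  Summable.of_nonneg_of_le (fun n => by positivity)
    (fun n => mul_le_mul_of_nonneg_right (h n) (by positivity)) hg

theorem ConvAt.add {t : ℝ} (ht : 0 ≤ t) {P Q : PowerSeries ℝ} (hP : ConvAt t P)
    (hQ : ConvAt t Q) : ConvAt t (P + Q) := by
  refine convAt_of_abs_le ht (fun n => ?_) ((Summable.add hP hQ).congr fun n =>
    (add_mul _ _ _).symm)
  rw [map_add]
  exact abs_add_le _ _

theorem ConvAt.mul {t : ℝ} (ht : 0 ≤ t) {P Q : PowerSeries ℝ} (hP : ConvAt t P)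
    (hQ : ConvAt t Q) : ConvAt t (P * Q) := by
  have h := (summable_norm_sum_mul_antidiagonal_of_summable_norm
    (f := fun n => |coeff n P| * t ^ n) (g := fun n => |coeff n Q| * t ^ n)
    (Summable.norm hP) (Summable.norm hQ)).of_norm
  refine convAt_of_abs_le ht (g := fun n => ∑ p ∈ Finset.HasAntidiagonal.antidiagonal n,
    |coeff p.1 P| * |coeff p.2 Q|) (fun n => ?_) (h.congr fun n => ?_)
  · rw [coeff_mul]
    refine (Finset.abs_sum_le_sum_abs _ _).trans_eq ?_
    exact Finset.sum_congr rfl fun p _ => abs_mul _ _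
  · rw [Finset.sum_mul]
    refine Finset.sum_congr rfl fun p hp => ?_
    rw [← Finset.HasAntidiagonal.mem_antidiagonal.1 hp, pow_add]
    ring

theorem evalAt_add {𝕜 : Type*} [RCLike 𝕜] {z : 𝕜} {P Q : PowerSeries ℝ} (hP : ConvAt ‖z‖ P)
    (hQ : ConvAt ‖z‖ Q) : evalAt z (P + Q) = evalAt z P + evalAt z Q := by
  refine (HasSum.tsum_eq ?_ : evalAt z (P + Q) = _)
  refine (hP.hasSum.add hQ.hasSum).congr_fun fun n => ?_
  rw [map_add, RCLike.ofReal_add, add_mul]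

theorem evalAt_mul {𝕜 : Type*} [RCLike 𝕜] {z : 𝕜} {P Q : PowerSeries ℝ} (hP : ConvAt ‖z‖ P)
    (hQ : ConvAt ‖z‖ Q) : evalAt z (P * Q) = evalAt z P * evalAt z Q := by
  rw [evalAt, evalAt, evalAt, tsum_mul_tsum_eq_tsum_sum_antidiagonal_of_summable_norm
    hP.summable_norm hQ.summable_norm]
  refine tsum_congr fun n => ?_
  rw [coeff_mul, RCLike.ofReal_sum, Finset.sum_mul]
  refine Finset.sum_congr rfl fun p hp => ?_
  rw [← Finset.HasAntidiagonal.mem_antidiagonal.1 hp, pow_add, RCLike.ofReal_mul]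
  ring

theorem evalAt_real (t : ℝ) (P : PowerSeries ℝ) : evalAt t P = ∑' n, coeff n P * t ^ n := rfl

theorem convAt_X (t : ℝ) : ConvAt t X := by
  refine summable_of_ne_finset_zero (s := {1}) fun n hn => ?_
  rw [coeff_X, if_neg (by simpa using hn), abs_zero, zero_mul]

theorem evalAt_X {𝕜 : Type*} [RCLike 𝕜] (z : 𝕜) : evalAt z X = z := by
  rw [evalAt, tsum_eq_single 1 fun n hn => by rw [coeff_X, if_neg hn]; simp]
  simp

theorem evalAt_zero {𝕜 : Type*} [RCLike 𝕜] (P : PowerSeries ℝ) :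
    evalAt (0 : 𝕜) P = ((constantCoeff P : ℝ) : 𝕜) := by
  rw [evalAt, tsum_eq_single 0 fun n hn => by rw [zero_pow hn, mul_zero]]
  simp

theorem ConvAt.sum {ι : Type*} {t : ℝ} (ht : 0 ≤ t) {s : Finset ι} {P : ι → PowerSeries ℝ}
    (h : ∀ i ∈ s, ConvAt t (P i)) : ConvAt t (∑ i ∈ s, P i) := by
  classical
  induction s using Finset.induction_on with
  | empty => simp [ConvAt]
  | insert a s ha ih =>
    rw [Finset.sum_insert ha]
    exact (h a (Finset.mem_insert_self a s)).add ht
      (ih fun i hi => h i (Finset.mem_insert_of_mem hi))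

theorem evalAt_sum {𝕜 ι : Type*} [RCLike 𝕜] {z : 𝕜} {s : Finset ι} {P : ι → PowerSeries ℝ}
    (h : ∀ i ∈ s, ConvAt ‖z‖ (P i)) : evalAt z (∑ i ∈ s, P i) = ∑ i ∈ s, evalAt z (P i) := by
  classical
  induction s using Finset.induction_on with
  | empty => simp [evalAt]
  | insert a s ha ih =>
    have h' := fun i (hi : i ∈ s) => h i (Finset.mem_insert_of_mem hi)
    rw [Finset.sum_insert ha, Finset.sum_insert ha,
      evalAt_add (h a (Finset.mem_insert_self a s)) (ConvAt.sum (norm_nonneg z) h'), ih h']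

theorem norm_evalAt_le {𝕜 : Type*} [RCLike 𝕜] {z : 𝕜} {P : PowerSeries ℝ} (h : ConvAt ‖z‖ P) :
    ‖evalAt z P‖ ≤ ∑' n, |coeff n P| * ‖z‖ ^ n := by
  refine (norm_tsum_le_tsum_norm h.summable_norm).trans_eq (tsum_congr fun n => ?_)
  rw [norm_mul, norm_pow, RCLike.norm_ofReal]

/-- The ring of power series that converge on the open unit disc. -/
def convDisc : Subring (PowerSeries ℝ) where
  carrier := {P | ∀ t, 0 ≤ t → t < 1 → ConvAt t P}
  mul_mem' hP hQ t h0 h1 := (hP t h0 h1).mul h0 (hQ t h0 h1)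
  add_mem' hP hQ t h0 h1 := (hP t h0 h1).add h0 (hQ t h0 h1)
  one_mem' t _ _ := by
    refine summable_of_ne_finset_zero (s := {0}) fun n hn => ?_
    rw [coeff_one, if_neg (by simpa using hn), abs_zero, zero_mul]
  zero_mem' t _ _ := by simp [ConvAt]
  neg_mem' {P} hP t h0 h1 := by simpa [ConvAt] using hP t h0 h1

theorem mem_convDisc_of_bounded {P : PowerSeries ℝ} {B : ℝ} (h : ∀ n, |coeff n P| ≤ B) :
    P ∈ convDisc := fun _ h0 h1 =>
  convAt_of_abs_le h0 h ((summable_geometric_of_lt_one h0 h1).mul_left B)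

/-- Determinants and adjugates are polynomial in the entries, so they may be formed over the
subring. -/
theorem det_mem_convDisc {J : Type*} [Fintype J] [DecidableEq J]
    {M : Matrix J J (PowerSeries ℝ)} (h : ∀ i j, M i j ∈ convDisc) :
    M.det ∈ convDisc ∧ ∀ i j, M.adjugate i j ∈ convDisc := by
  let M' : Matrix J J convDisc := Matrix.of fun i j => ⟨M i j, h i j⟩
  have e : M = convDisc.subtype.mapMatrix M' := by ext; rfl
  rw [e, ← RingHom.map_det, ← RingHom.map_adjugate]
  exact ⟨SetLike.coe_mem _, fun i j => SetLike.coe_mem _⟩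

theorem ConvAt.hasFPowerSeriesOnBall {ρ : ℝ} {P : PowerSeries ℝ} (hρ : 0 < ρ)
    (h : ∀ t, 0 ≤ t → t < ρ → ConvAt t P) :
    HasFPowerSeriesOnBall (fun z : ℂ => evalAt z P)
      (FormalMultilinearSeries.ofScalars ℂ fun n => ((coeff n P : ℝ) : ℂ)) 0 (ENNReal.ofReal ρ) := by
  refine ⟨?_, by simpa using hρ, ?_⟩
  · refine ENNReal.le_of_forall_nnreal_lt fun t ht => ?_
    refine FormalMultilinearSeries.le_radius_of_summable_norm _ ?_
    have h1 : (t : ℝ) < ρ := by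
      rwa [← ENNReal.ofReal_coe_nnreal, ENNReal.ofReal_lt_ofReal_iff hρ] at ht
    refine (h t t.2 h1).congr fun n => ?_
    rw [FormalMultilinearSeries.ofScalars_norm, Complex.norm_real, Real.norm_eq_abs]
  · intro y hy
    have hy' : ‖y‖ < ρ := by
      rw [Metric.eball_ofReal] at hy
      simpa using hy
    rw [zero_add]
    refine (h ‖y‖ (norm_nonneg y) hy').hasSum.congr_fun fun n => ?_
    rw [FormalMultilinearSeries.ofScalars_apply_eq, smul_eq_mul]
    rfl

/-- A power series with nonnegative coefficients that is a quotient of two series convergent in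
the unit disc and stays bounded up to a radius less than one converges beyond that radius. -/
theorem exists_convAt_of_bounded {Δ S : PowerSeries ℝ} (hΔ : Δ ∈ convDisc)
    (hH : Δ * S ∈ convDisc) (h0 : constantCoeff Δ = 1) (hS : ∀ n, 0 ≤ coeff n S) {ρ B : ℝ}
    (hρ0 : 0 < ρ) (hρ1 : ρ < 1) (hc : ∀ t, 0 ≤ t → t < ρ → ConvAt t S)
    (hB : ∀ t, 0 ≤ t → t < ρ → evalAt t S ≤ B) : ∃ t, ρ < t ∧ ConvAt t S := by
  have hdisc : ∀ {P : PowerSeries ℝ}, P ∈ convDisc → ∀ z ∈ Metric.ball (0 : ℂ) 1,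
      AnalyticAt ℂ (fun z : ℂ => evalAt z P) z := by
    intro P hP z hz
    refine (ConvAt.hasFPowerSeriesOnBall one_pos hP).analyticAt_of_mem ?_
    rwa [Metric.eball_ofReal]
  set U := Metric.ball (0 : ℂ) 1 with hU
  set M₀ : ℂ → ℂ := fun z => evalAt z (Δ * S) / evalAt z Δ with hM₀
  have hmer : MeromorphicOn M₀ U := fun z hz =>
    (hdisc hH z hz).meromorphicAt.div (hdisc hΔ z hz).meromorphicAt
  -- At zeros of the denominator the quotient `M₀` has the default value 0; the normal form repairs
  -- removable singularities.
  set M := toMeromorphicNFOn M₀ U with hM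
  have hB0 : 0 ≤ B := (tsum_nonneg fun n => mul_nonneg (hS n) (by positivity)).trans
    (hB 0 le_rfl hρ0)
  have hmulS : ∀ z ∈ Metric.ball (0 : ℂ) ρ, evalAt z (Δ * S) = evalAt z Δ * evalAt z S := by
    intro z hz
    have hz' : ‖z‖ < ρ := by simpa using hz
    exact evalAt_mul (hΔ _ (norm_nonneg z) (hz'.trans hρ1)) (hc _ (norm_nonneg z) hz')
  -- Nonnegative coefficients give |S(z)| ≤ S(|z|) ≤ B.
  have hbd : ∀ z ∈ Metric.ball (0 : ℂ) ρ, ‖M₀ z‖ ≤ B := by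
    intro z hz
    have hz' : ‖z‖ < ρ := by simpa using hz
    by_cases hd : evalAt z Δ = 0
    · simp [hM₀, hd, hB0]
    · simp only [hM₀]
      rw [hmulS z hz, mul_div_cancel_left₀ _ hd]
      refine (norm_evalAt_le (hc _ (norm_nonneg z) hz')).trans ?_
      refine le_trans (le_of_eq ?_) (hB ‖z‖ (norm_nonneg z) hz')
      rw [evalAt_real]
      exact tsum_congr fun n => by rw [abs_of_nonneg (hS n)]
  have hsub : Metric.closedBall (0 : ℂ) ρ ⊆ U := Metric.closedBall_subset_ball hρ1
  have han : ∀ ζ ∈ Metric.closedBall (0 : ℂ) ρ, AnalyticAt ℂ M ζ := by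
    intro ζ hζ
    have hNF : MeromorphicNFAt M ζ := meromorphicNFOn_toMeromorphicNFOn M₀ U (hsub hζ)
    rw [← hNF.meromorphicOrderAt_nonneg_iff_analyticAt,
      meromorphicOrderAt_toMeromorphicNFOn hmer (hsub hζ)]
    -- Near a pole |M₀| exceeds B on a punctured neighbourhood, which meets the open disc of radius
    -- ρ even if the pole lies on its boundary.
    by_contra! hneg
    have ht := tendsto_cobounded_of_meromorphicOrderAt_neg hneg
    have hev : ∀ᶠ z in 𝓝[≠] ζ, B < ‖M₀ z‖ :=
      (tendsto_norm_cobounded_atTop.comp ht).eventually_gt_atTop B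
    rw [eventually_nhdsWithin_iff] at hev
    have hcl : ζ ∈ closure (Metric.ball (0 : ℂ) ρ ∩ {ζ}ᶜ) := by
      have hd : Dense ({ζ}ᶜ : Set ℂ) := dense_compl_singleton ζ
      refine closure_minimal (hd.open_subset_closure_inter Metric.isOpen_ball) isClosed_closure ?_
      rwa [closure_ball _ hρ0.ne']
    obtain ⟨z, hz, hz2⟩ := ((mem_closure_iff_frequently.1 hcl).and_eventually hev).exists
    exact absurd (hbd z hz.1) (not_le.2 (hz2 hz.2))
  -- Analyticity is an open condition and the closed disc is compact, so M is analytic on a larger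
  -- disc.
  obtain ⟨δ, hδ, hsubδ⟩ := (isCompact_closedBall (0 : ℂ) ρ).exists_cthickening_subset_open
    (isOpen_analyticAt ℂ M) han
  rw [cthickening_closedBall hδ.le hρ0.le] at hsubδ
  let R : NNReal := ⟨δ + ρ, by positivity⟩
  have hdiff : DifferentiableOn ℂ M (Metric.closedBall 0 R) := fun z hz =>
    (hsubδ hz).differentiableAt.differentiableWithinAt
  have hR : 0 < R := by
    have : (0 : ℝ) < δ + ρ := by positivity
    exact this
  have hps := hdiff.hasFPowerSeriesOnBall hR
  have h0U : (0 : ℂ) ∈ U := by simp [hU]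
  have h0ρ : (0 : ℂ) ∈ Metric.closedBall (0 : ℂ) ρ := by simp [hρ0.le]
  have hΔ0 : evalAt (0 : ℂ) Δ ≠ 0 := by rw [evalAt_zero, h0]; simp
  have hSps := ConvAt.hasFPowerSeriesOnBall hρ0 hc
  have heq : M =ᶠ[𝓝 0] fun z => evalAt z S := by
    rw [← (han 0 h0ρ).continuousAt.eventuallyEq_nhds_iff_eventuallyEq_nhdsNE
      hSps.analyticAt.continuousAt]
    have h1 : M =ᶠ[𝓝[≠] 0] M₀ := hmer.toMeromorphicNFOn_eq_self_on_nhdsNE h0U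
    have h2 : ∀ᶠ z in 𝓝 (0 : ℂ), evalAt z Δ ≠ 0 :=
      (hdisc hΔ 0 h0U).continuousAt.eventually_ne hΔ0
    have h3 : ∀ᶠ z in 𝓝 (0 : ℂ), z ∈ Metric.ball (0 : ℂ) ρ := Metric.ball_mem_nhds 0 hρ0
    filter_upwards [h1, h2.filter_mono nhdsWithin_le_nhds, h3.filter_mono nhdsWithin_le_nhds]
      with z hz hz2 hz3
    rw [hz, hM₀]
    simp only
    rw [hmulS z hz3, mul_div_cancel_left₀ _ hz2]
  -- By uniqueness of expansions at 0, the Cauchy series of M on the larger disc has the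
  -- coefficients of S.
  have hcoef := (hps.hasFPowerSeriesAt.congr heq).eq_formalMultilinearSeries hSps.hasFPowerSeriesAt
  refine ⟨ρ + δ / 2, by linarith, ?_⟩
  let t : NNReal := ⟨ρ + δ / 2, by positivity⟩
  have htR : (t : ENNReal) < (cauchyPowerSeries M 0 R).radius := by
    refine lt_of_lt_of_le ?_ hps.r_le
    rw [ENNReal.coe_lt_coe, ← NNReal.coe_lt_coe]
    show ρ + δ / 2 < δ + ρ
    linarith
  have hsum := (cauchyPowerSeries M 0 R).summable_norm_mul_pow htR
  rw [hcoef] at hsum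
  refine hsum.congr fun n => ?_
  rw [FormalMultilinearSeries.ofScalars_norm, Complex.norm_real, Real.norm_eq_abs]
  rfl

end Convergence

end PMGraph
end

noncomputable section
namespace PMGraph

/-! ### The finite-rank difference of the two push-forwards -/

variable {Ω : IntervalUnion}

/-- The functional `x ↦ 1` if `t < x`, and `x ↦ 0` otherwise. -/
def rightStep (Ω : IntervalUnion) (t : ℝ) : S0 Ω →ₗ[ℝ] ℝ :=
  Finsupp.linearCombination ℝ fun x : Ω.carrier => if t < (x : ℝ) then (1 : ℝ) else 0

/-- The functional `x ↦ 1` if `t ≤ x`, and `x ↦ 0` otherwise. -/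
def leftStep (Ω : IntervalUnion) (t : ℝ) : S0 Ω →ₗ[ℝ] ℝ :=
  Finsupp.linearCombination ℝ fun x : Ω.carrier => if t ≤ (x : ℝ) then (1 : ℝ) else 0

@[simp]
theorem rightStep_pt (t : ℝ) (x : Ω.carrier) :
    rightStep Ω t (pt x) = if t < (x : ℝ) then 1 else 0 := by
  simp [rightStep, pt, Finsupp.linearCombination_single]

@[simp]
theorem leftStep_pt (t : ℝ) (x : Ω.carrier) :
    leftStep Ω t (pt x) = if t ≤ (x : ℝ) then 1 else 0 := by
  simp [leftStep, pt, Finsupp.linearCombination_single]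

theorem S0_hom_ext {M : Type*} [AddCommGroup M] [Module ℝ M] {φ ψ : S0 Ω →ₗ[ℝ] M}
    (h : ∀ x, φ (pt x) = ψ (pt x)) : φ = ψ :=
  Finsupp.lhom_ext' fun x => LinearMap.ext_ring (h x)

theorem S1_induction {p : S0 Ω → Prop} (F : PMMap Ω)
    (mem : ∀ x y, F.MonotoneBetween x y → p (pt y - pt x)) (zero : p 0)
    (add : ∀ v w, p v → p w → p (v + w)) (smul : ∀ (r : ℝ) v, p v → p (r • v)) {v : S0 Ω}
    (hv : v ∈ S1 Ω) : p v := by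
  rw [F.S1_eq_span] at hv
  induction hv using Submodule.span_induction with
  | mem v hv => obtain ⟨x, y, h, rfl⟩ := hv; exact mem x y h
  | zero => exact zero
  | add v w _ _ hv hw => exact add v w hv hw
  | smul r v _ hv => exact smul r v hv

theorem pt_sub_mem_S1 {x y : Ω.carrier} {i : Fin Ω.m} (hx : (x : ℝ) ∈ Icc (Ω.a i) (Ω.b i))
    (hy : (y : ℝ) ∈ Icc (Ω.a i) (Ω.b i)) : pt y - pt x ∈ S1 Ω :=
  Submodule.subset_span ⟨i, x, y, hx, hy, rfl⟩

/-- The left endpoint of a component, as a point of `Ω`. -/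
def IntervalUnion.left (Ω : IntervalUnion) (i : Fin Ω.m) : Ω.carrier :=
  ⟨Ω.a i, mem_iUnion.2 ⟨i, le_rfl, (Ω.lt i).le⟩⟩

/-- The right endpoint of a component, as a point of `Ω`. -/
def IntervalUnion.right (Ω : IntervalUnion) (i : Fin Ω.m) : Ω.carrier :=
  ⟨Ω.b i, mem_iUnion.2 ⟨i, (Ω.lt i).le, le_rfl⟩⟩

theorem IntervalUnion.left_mem (Ω : IntervalUnion) (i : Fin Ω.m) :
    (Ω.left i : ℝ) ∈ Icc (Ω.a i) (Ω.b i) := ⟨le_rfl, (Ω.lt i).le⟩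

theorem IntervalUnion.right_mem (Ω : IntervalUnion) (i : Fin Ω.m) :
    (Ω.right i : ℝ) ∈ Icc (Ω.a i) (Ω.b i) := ⟨(Ω.lt i).le, le_rfl⟩

theorem IntervalUnion.index_unique {i j : Fin Ω.m} {t : ℝ} (hi : t ∈ Icc (Ω.a i) (Ω.b i))
    (hj : t ∈ Icc (Ω.a j) (Ω.b j)) : i = j := by
  rcases lt_trichotomy i j with h | h | h
  · have := Ω.gap _ _ h; linarith [hi.2, hj.1]
  · exact h
  · have := Ω.gap _ _ h; linarith [hi.1, hj.2]

instance finiteDimensional_quotient_S1 : FiniteDimensional ℝ (S0 Ω ⧸ S1 Ω) := by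
  let φ : (Fin Ω.m → ℝ) →ₗ[ℝ] (S0 Ω ⧸ S1 Ω) :=
    (S1 Ω).mkQ ∘ₗ Fintype.linearCombination ℝ fun i => pt (Ω.left i)
  refine Module.Finite.of_surjective φ ?_
  rw [← LinearMap.range_eq_top, eq_top_iff]
  have : (⊤ : Submodule ℝ (S0 Ω ⧸ S1 Ω)) = Submodule.map (S1 Ω).mkQ ⊤ := by
    rw [Submodule.map_top, Submodule.range_mkQ]
  rw [this, Submodule.map_le_iff_le_comap]
  rintro v -
  induction v using Finsupp.induction_linear with
  | zero => exact Submodule.zero_mem _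
  | add f g hf hg => exact Submodule.add_mem _ hf hg
  | single x r =>
    obtain ⟨i, hi⟩ := mem_iUnion.1 x.2
    refine ⟨Pi.single i r, ?_⟩
    simp only [φ, LinearMap.comp_apply, Fintype.linearCombination_apply_single]
    rw [eq_comm, ← sub_eq_zero, ← map_sub]
    have e : Finsupp.single x r - r • pt (Ω.left i) = r • (pt x - pt (Ω.left i)) := by
      rw [smul_sub]; simp [pt]
    rw [e]
    exact (Submodule.Quotient.mk_eq_zero _).2
      (Submodule.smul_mem _ _ (pt_sub_mem_S1 (Ω.left_mem i) hi))

/-! ### The two sides of each cut point, and the extension of `εF_{#1}`. -/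

namespace PMMap

variable (F : PMMap Ω)

/-- The index set of the kneading matrix: the two sides of each point of `C_F`. -/
abbrev Side : Type := {c // c ∈ F.finite_C.toFinset} ⊕ {c // c ∈ F.finite_C.toFinset}

/-- A point of `C_F` as a point of `Ω`. -/
def cutPt (c : {c // c ∈ F.finite_C.toFinset}) : Ω.carrier :=
  ⟨c, F.C_subset (F.finite_C.mem_toFinset.1 c.2)⟩

/-- The functional attached to a side. -/
def sideFun : F.Side → S0 Ω →ₗ[ℝ] ℝ :=
  Sum.elim (fun c => leftStep Ω c) (fun c => rightStep Ω c)

/-- The value attached to a side. -/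
def sideVal : F.Side → S0 Ω :=
  Sum.elim (fun c => F.leftVal (F.cutPt c)) (fun c => -F.rightVal (F.cutPt c))

/-- The extension of `εF_{#1}` to `S₀(Ω;ℝ)` that is given by a primitive. -/
def push1Ext : Module.End ℝ (S0 Ω) := Finsupp.linearCombination ℝ F.primitive

@[simp]
theorem push1Ext_pt (x : Ω.carrier) : F.push1Ext (pt x) = F.primitive x := by
  simp [push1Ext, pt, Finsupp.linearCombination_single]

theorem signedPush0_pt (x : Ω.carrier) : F.signedPush0 (pt x) = F.sign x • F.push0Pt x := by
  simp [signedPush0, pt, Finsupp.linearCombination_single]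

theorem leftVal_of_notMem {x : Ω.carrier} (hx : (x : ℝ) ∉ F.C) :
    F.leftVal x = F.signedPush0 (pt x) := by
  obtain ⟨⟨w, hw⟩, ⟨y, hy⟩⟩ := F.exists_sides hx
  have hI : Ioo (w : ℝ) y ⊆ Ω.carrier \ F.C := by
    intro t ht
    rcases lt_trichotomy t (x : ℝ) with h | h | h
    · exact hw.2 ⟨ht.1, h⟩
    · rw [h]; exact ⟨x.2, hx⟩
    · exact hy.2 ⟨h, ht.2⟩
  have hwx : (w : ℝ) < x := hw.1
  have hxy : (x : ℝ) < y := hy.1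
  have hn : Ioo (w : ℝ) y ∈ 𝓝 (x : ℝ) := Ioo_mem_nhds hwx hxy
  have hc : ContinuousAt F.toFun x := (F.ioo_props hI).1.continuousAt hn
  let q : Ω.carrier := ⟨F.toFun x, F.mapsTo ⟨x.2, hx⟩⟩
  rw [F.leftVal_eq ⟨w, q, hw, hc.tendsto.mono_left nhdsWithin_le_nhds, rfl⟩, signedPush0_pt,
    push0Pt, dif_neg hx, sign, if_neg hx]
  congr 1
  rw [F.signBetween_eq_of_subset hwx hI (Ioo_subset_Ioo_right hxy.le), signBetween]
  by_cases hm : StrictMonoOn F.toFun (Ioo w y)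
  · rw [if_pos hm, if_pos ⟨_, hn, hm⟩]
  · rw [if_neg hm, if_neg]
    rintro ⟨U, hU, hU'⟩
    have ha := (F.ioo_props hI).2.resolve_left hm
    obtain ⟨l, u, hlu, hsub⟩ := mem_nhds_iff_exists_Ioo_subset.1 (inter_mem hU hn)
    obtain ⟨s, hs⟩ := exists_between hlu.1
    obtain ⟨hs1, hs2⟩ := hsub ⟨hs.1, hs.2.trans hlu.2⟩
    obtain ⟨hx1, hx2⟩ := hsub hlu
    exact lt_asymm (hU' hs1 hx1 hs.2) (ha hs2 hx2 hs.2)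

theorem signedPush0_of_mem {x : Ω.carrier} (hx : (x : ℝ) ∈ F.C) : F.signedPush0 (pt x) = 0 := by
  rw [signedPush0_pt, push0Pt, dif_pos hx, smul_zero]

/-- `εF_{#1}` and `εF_{#0}` differ by a map of finite rank. -/
theorem push1Ext_eq (v : S0 Ω) :
    F.push1Ext v = F.signedPush0 v + ∑ j, F.sideFun j v • F.sideVal j := by
  classical
  have key : F.push1Ext = F.signedPush0 + ∑ j, (F.sideFun j).smulRight (F.sideVal j) := by
    refine S0_hom_ext fun x => ?_
    rw [push1Ext_pt, LinearMap.add_apply, LinearMap.sum_apply, Fintype.sum_sum_type, primitive,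
      ← Finset.sum_coe_sort F.finite_C.toFinset]
    simp only [LinearMap.smulRight_apply, sideFun, sideVal, Sum.elim_inl, Sum.elim_inr,
      leftStep_pt, rightStep_pt, ite_smul, one_smul, zero_smul]
    -- The jumps at c < x are split into a left part counted for c ≤ x and a right part counted for
    -- c < x; the surplus at c = x is `leftVal x`.
    have h1 : ∀ c : {c // c ∈ F.finite_C.toFinset},
        (if h : (c : ℝ) ∈ F.C ∧ (c : ℝ) < (x : ℝ) then
          F.leftVal ⟨c, F.C_subset h.1⟩ - F.rightVal ⟨c, F.C_subset h.1⟩ else 0) =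
        ((if (c : ℝ) ≤ (x : ℝ) then F.leftVal (F.cutPt c) else 0) +
          (if (c : ℝ) < (x : ℝ) then -F.rightVal (F.cutPt c) else 0)) -
        (if (c : ℝ) = (x : ℝ) then F.leftVal x else 0) := by
      intro c
      have hc := F.finite_C.mem_toFinset.1 c.2
      rcases lt_trichotomy (c : ℝ) (x : ℝ) with h | h | h
      · rw [dif_pos ⟨hc, h⟩, if_pos h.le, if_pos h, if_neg h.ne]
        simp only [cutPt]; abel
      · have hcx : F.cutPt c = x := Subtype.ext h
        rw [dif_neg (fun hh => hh.2.ne h), if_pos h.le, if_neg h.not_lt, if_pos h, hcx]; abel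
      · rw [dif_neg (fun hh => hh.2.not_gt h), if_neg h.not_ge, if_neg h.not_gt, if_neg h.ne']
        abel
    rw [Finset.sum_congr rfl fun c _ => h1 c, Finset.sum_sub_distrib, Finset.sum_add_distrib]
    -- For x in C_F the surplus cancels `leftVal x`, in agreement with ψ₀(x) = 0; otherwise there is
    -- no surplus, and the left value is ψ₀(x) by continuity.
    have h2 : F.leftVal x - ∑ c : {c // c ∈ F.finite_C.toFinset},
        (if (c : ℝ) = (x : ℝ) then F.leftVal x else 0) = F.signedPush0 (pt x) := by
      rw [Finset.sum_coe_sort F.finite_C.toFinset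
        (fun c => if c = (x : ℝ) then F.leftVal x else 0), Finset.sum_ite_eq']
      split_ifs with h
      · rw [sub_self, F.signedPush0_of_mem (F.finite_C.mem_toFinset.1 h)]
      · rw [sub_zero, F.leftVal_of_notMem fun hh => h (F.finite_C.mem_toFinset.2 hh)]
    rw [← h2]
    abel
  rw [key]
  simp

/-- The generators of `S₁(Ω;ℝ)` are mapped to oriented differences. -/
theorem push1Ext_sub {x y p q : Ω.carrier} (h : F.MonotoneBetween x y)
    (hp : Tendsto F.toFun (𝓝[>] (x : ℝ)) (𝓝 (p : ℝ)))
    (hq : Tendsto F.toFun (𝓝[<] (y : ℝ)) (𝓝 (q : ℝ))) :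
    F.push1Ext (pt y - pt x) = F.signBetween x y • (pt q - pt p) := by
  rw [map_sub, push1Ext_pt, push1Ext_pt, F.primitive_sub_eq h hp hq]

theorem push1Ext_mem_of_mem {v : S0 Ω} (hv : v ∈ S1 Ω) : F.push1Ext v ∈ S1 Ω := by
  refine S1_induction F (p := fun v => F.push1Ext v ∈ S1 Ω) (fun x y h => ?_) ?_
    (fun v w hv hw => ?_) (fun r v hv => ?_) hv
  · obtain ⟨j, p, q, hpj, hqj, hp, hq⟩ := F.exists_limits h
    rw [F.push1Ext_sub h hp hq]
    exact Submodule.smul_mem _ _ (pt_sub_mem_S1 hpj hqj)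
  · rw [map_zero]; exact Submodule.zero_mem _
  · rw [map_add]; exact Submodule.add_mem _ hv hw
  · rw [map_smul]; exact Submodule.smul_mem _ _ hv

theorem leftVal_left (i : Fin Ω.m) : F.leftVal (Ω.left i) = 0 := by
  rw [leftVal, dif_neg]
  rintro ⟨-, x, -, h, -⟩
  obtain ⟨j, hx, hy⟩ := F.same_component h
  obtain rfl := IntervalUnion.index_unique hy (Ω.left_mem i)
  exact absurd (show (x : ℝ) < Ω.a j from h.1) (not_lt.2 hx.1)

theorem rightVal_right (i : Fin Ω.m) : F.rightVal (Ω.right i) = 0 := by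
  rw [rightVal, dif_neg]
  rintro ⟨-, y, -, h, -⟩
  obtain ⟨j, hx, hy⟩ := F.same_component h
  obtain rfl := IntervalUnion.index_unique hx (Ω.right_mem i)
  exact absurd (show Ω.b j < (y : ℝ) from h.1) (not_lt.2 hy.2)

theorem boundary_right (i : Fin Ω.m) : Ω.b i ∈ F.C := F.boundary_subset (Or.inr ⟨i, rfl⟩)

theorem primitive_sub_mem {i : Fin Ω.m} {x y : Ω.carrier} (hx : (x : ℝ) ∈ Icc (Ω.a i) (Ω.b i))
    (hy : (y : ℝ) ∈ Icc (Ω.a i) (Ω.b i)) : F.primitive y - F.primitive x ∈ S1 Ω := by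
  rw [← push1Ext_pt, ← push1Ext_pt, ← map_sub]
  exact F.push1Ext_mem_of_mem (pt_sub_mem_S1 hx hy)

/-- The primitive is 0 at the first left endpoint and takes equal values at bₖ and aₖ₊₁: C_F has no
point strictly between them, and the right value at bₖ and the left value at aₖ₊₁ are 0 by
convention. Along a component it changes by elements of S₁. -/
theorem primitive_left_mem (k : ℕ) (hk : k < Ω.m) : F.primitive (Ω.left ⟨k, hk⟩) ∈ S1 Ω := by
  classical
  induction k with
  | zero =>
    have h : F.primitive (Ω.left ⟨0, hk⟩) = 0 := by
      rw [primitive, leftVal_left, zero_add]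
      refine Finset.sum_eq_zero fun c hc => dif_neg fun hh => ?_
      obtain ⟨j, hj⟩ := mem_iUnion.1 (F.C_subset hh.1)
      have h1 : Ω.a ⟨0, hk⟩ ≤ Ω.a j := by
        rcases Nat.eq_zero_or_pos j.1 with h0 | h0
        · have : j = ⟨0, hk⟩ := Fin.ext h0
          rw [this]
        · exact ((Ω.lt _).trans (Ω.gap ⟨0, hk⟩ j h0)).le
      exact absurd (show c < Ω.a ⟨0, hk⟩ from hh.2) (not_lt.2 (h1.trans hj.1))
    rw [h]
    exact Submodule.zero_mem _
  | succ k ih =>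
    have hk' : k < Ω.m := (Nat.lt_succ_self k).trans hk
    have hlt : Ω.b ⟨k, hk'⟩ < Ω.a ⟨k + 1, hk⟩ := Ω.gap _ _ (Nat.lt_succ_self k)
    have e : F.primitive (Ω.left ⟨k + 1, hk⟩) = F.primitive (Ω.right ⟨k, hk'⟩) := by
      rw [primitive, primitive, leftVal_left, zero_add]
      have h1 : ∀ c ∈ F.finite_C.toFinset,
          (if h : c ∈ F.C ∧ c < (Ω.left ⟨k + 1, hk⟩ : ℝ) then
            F.leftVal ⟨c, F.C_subset h.1⟩ - F.rightVal ⟨c, F.C_subset h.1⟩ else 0) =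
          (if c = Ω.b ⟨k, hk'⟩ then F.leftVal (Ω.right ⟨k, hk'⟩) else 0) +
          (if h : c ∈ F.C ∧ c < (Ω.right ⟨k, hk'⟩ : ℝ) then
            F.leftVal ⟨c, F.C_subset h.1⟩ - F.rightVal ⟨c, F.C_subset h.1⟩ else 0) := by
        intro c hc
        have hcC := F.finite_C.mem_toFinset.1 hc
        rcases lt_trichotomy c (Ω.b ⟨k, hk'⟩) with h | h | h
        · rw [dif_pos ⟨hcC, h.trans hlt⟩, if_neg h.ne, dif_pos ⟨hcC, h⟩, zero_add]
        · subst h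
          rw [dif_pos ⟨hcC, hlt⟩, if_pos rfl, dif_neg (fun hh => lt_irrefl _ hh.2), add_zero]
          have := F.rightVal_right ⟨k, hk'⟩
          rw [IntervalUnion.right] at this
          rw [this, sub_zero]
          rfl
        · rw [dif_neg, if_neg h.ne', dif_neg (fun hh => hh.2.not_gt h), zero_add]
          rintro ⟨-, hh⟩
          obtain ⟨j, hj⟩ := mem_iUnion.1 (F.C_subset hcC)
          have hh' : c < Ω.a ⟨k + 1, hk⟩ := hh
          rcases lt_trichotomy j.1 (k + 1) with h' | h' | h'
          · rcases (Nat.lt_succ_iff.1 h').lt_or_eq with h'' | h''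
            · have := Ω.gap j ⟨k, hk'⟩ h''
              linarith [hj.2, Ω.lt ⟨k, hk'⟩]
            · have : j = ⟨k, hk'⟩ := Fin.ext h''
              rw [this] at hj
              linarith [hj.2]
          · have : j = ⟨k + 1, hk⟩ := Fin.ext h'
            rw [this] at hj
            linarith [hj.1]
          · have := Ω.gap ⟨k + 1, hk⟩ j h'
            linarith [hj.1, Ω.lt ⟨k + 1, hk⟩]
      rw [Finset.sum_congr rfl h1, Finset.sum_add_distrib, Finset.sum_ite_eq',
        if_pos (F.finite_C.mem_toFinset.2 (F.boundary_right _))]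
    rw [e, ← sub_add_cancel (F.primitive (Ω.right ⟨k, hk'⟩)) (F.primitive (Ω.left ⟨k, hk'⟩))]
    exact Submodule.add_mem _ (F.primitive_sub_mem (Ω.left_mem _) (Ω.right_mem _)) (ih hk')

/-- All values lie in S₁, not only those on S₁. This is what makes `pairTrace_eq_finTrace`
applicable. -/
theorem push1Ext_mem (v : S0 Ω) : F.push1Ext v ∈ S1 Ω := by
  induction v using Finsupp.induction_linear with
  | zero => rw [map_zero]; exact Submodule.zero_mem _
  | add f g hf hg => rw [map_add]; exact Submodule.add_mem _ hf hg
  | single x r =>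
    have e : Finsupp.single x r = r • pt x := by simp [pt]
    obtain ⟨i, hi⟩ := mem_iUnion.1 x.2
    rw [e, map_smul, push1Ext_pt,
      ← sub_add_cancel (F.primitive x) (F.primitive (Ω.left i))]
    exact Submodule.smul_mem _ _ (Submodule.add_mem _ (F.primitive_sub_mem (Ω.left_mem i) hi)
      (F.primitive_left_mem i.1 i.2))

theorem coe_signedPush1 (v : S1 Ω) : (F.signedPush1 v : S0 Ω) = F.push1Ext v := by
  have h : F.IsSignedPush1 (F.push1Ext.restrict fun v _ => F.push1Ext_mem v) := by
    intro x y p q h hp hq v hv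
    rw [LinearMap.coe_restrict_apply, hv, F.push1Ext_sub h hp hq]
  have := F.existsUnique_signedPush1.unique F.existsUnique_signedPush1.choose_spec.1 h
  rw [signedPush1, this]
  rfl

theorem coe_signedPush1_pow (n : ℕ) (v : S1 Ω) :
    ((F.signedPush1 ^ n : Module.End ℝ (S1 Ω)) v : S0 Ω) = (F.push1Ext ^ n) v := by
  induction n with
  | zero => rfl
  | succ n ih => rw [pow_succ', pow_succ', Module.End.mul_apply, Module.End.mul_apply,
      coe_signedPush1, ih]

theorem coe_signedPush0_pow (n : ℕ) (v : (⊤ : Submodule ℝ (S0 Ω))) :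
    (((F.signedPush0.restrict fun _ _ => Submodule.mem_top : Module.End ℝ
      (⊤ : Submodule ℝ (S0 Ω))) ^ n) v : S0 Ω) = ((F.signedPush0 : Module.End ℝ (S0 Ω)) ^ n) v := by
  induction n with
  | zero => rfl
  | succ n ih => rw [pow_succ', pow_succ', Module.End.mul_apply, Module.End.mul_apply,
      LinearMap.coe_restrict_apply, ih]

/-- The kneading determinant is the determinant of the kneading matrix. -/
theorem kneadingDet_eq_det :
    F.kneadingDet = (kneadingMatrix F.signedPush0 F.sideFun F.sideVal).det := by
  refine exp_trace_eq_det F.push1Ext_eq _ fun n => ?_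
  refine pairTrace_eq_finTrace _ _ (fun v => (F.coe_signedPush0_pow (n + 1) v).symm)
    (fun v => (F.coe_signedPush1_pow (n + 1) v).symm) (fun v => ?_)
    (trace_resolventMatrix F.push1Ext_eq n).2
  rw [pow_succ', Module.End.mul_apply]
  exact F.push1Ext_mem _

end PMMap

end PMGraph
end

noncomputable section
namespace PMGraph

/-! ### Gaps of finite subsets -/

namespace IntervalUnion

variable {Ω : IntervalUnion}

theorem exists_component {s : Set ℝ} (hs : IsPreconnected s) (hsub : s ⊆ Ω.carrier)
    (hne : s.Nonempty) : ∃ j, s ⊆ Icc (Ω.a j) (Ω.b j) := by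
  obtain ⟨m, hm⟩ := hne
  obtain ⟨j, hj⟩ := mem_iUnion.1 (hsub hm)
  refine ⟨j, ?_⟩
  have hcl : IsClosed (⋃ k ∈ {k : Fin Ω.m | k ≠ j}, Icc (Ω.a k) (Ω.b k)) :=
    (toFinite _).isClosed_biUnion fun _ _ => isClosed_Icc
  rcases isPreconnected_iff_subset_of_disjoint_closed.1 hs _ _ (isClosed_Icc) hcl
    (by
      intro t ht
      obtain ⟨k, hk⟩ := mem_iUnion.1 (hsub ht)
      by_cases hkj : k = j
      · subst hkj; exact Or.inl hk
      · exact Or.inr (mem_biUnion (show k ∈ {k : Fin Ω.m | k ≠ j} from hkj) hk))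
    (by
      rw [eq_empty_iff_forall_notMem]
      rintro t ⟨-, ht, ht'⟩
      obtain ⟨k, hk, hk'⟩ := mem_iUnion₂.1 ht'
      exact hk (index_unique hk' ht)) with h | h
  · exact h
  · obtain ⟨k, hk, hk'⟩ := mem_iUnion₂.1 (h hm)
    exact (hk (index_unique hk' hj)).elim

/-- The maximal intervals `[c,d]` in `Ω` without points of `E` in their interior. -/
def gaps (Ω : IntervalUnion) (E : Set ℝ) : Set (ℝ × ℝ) :=
  {I | I.1 < I.2 ∧ Icc I.1 I.2 ⊆ Ω.carrier ∧ Icc I.1 I.2 ∩ E = {I.1, I.2}}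

variable {E : Set ℝ}

theorem gaps_fst_mem {I : ℝ × ℝ} (hI : I ∈ Ω.gaps E) : I.1 ∈ E :=
  (hI.2.2.symm.subset (Or.inl rfl)).2

theorem gaps_snd_mem {I : ℝ × ℝ} (hI : I ∈ Ω.gaps E) : I.2 ∈ E :=
  (hI.2.2.symm.subset (Or.inr rfl)).2

theorem gaps_Ioo {I : ℝ × ℝ} (hI : I ∈ Ω.gaps E) {t : ℝ} (ht : t ∈ Ioo I.1 I.2) :
    t ∈ Ω.carrier ∧ t ∉ E := by
  refine ⟨hI.2.1 (Ioo_subset_Icc_self ht), fun h => ?_⟩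
  rcases hI.2.2.subset ⟨Ioo_subset_Icc_self ht, h⟩ with h | h
  · exact ht.1.ne' h
  · exact ht.2.ne h

theorem gaps_component {I : ℝ × ℝ} (hI : I ∈ Ω.gaps E) :
    ∃ j, I.1 ∈ Icc (Ω.a j) (Ω.b j) ∧ I.2 ∈ Icc (Ω.a j) (Ω.b j) := by
  obtain ⟨j, hj⟩ := exists_component isPreconnected_Icc hI.2.1 (nonempty_Icc.2 hI.1.le)
  exact ⟨j, hj (left_mem_Icc.2 hI.1.le), hj (right_mem_Icc.2 hI.1.le)⟩

theorem gaps_finite (hE : E.Finite) : (Ω.gaps E).Finite :=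
  (hE.prod hE).subset fun _ hI => ⟨gaps_fst_mem hI, gaps_snd_mem hI⟩

theorem gaps_injOn_fst : InjOn Prod.fst (Ω.gaps E) := by
  have key : ∀ I ∈ Ω.gaps E, ∀ J ∈ Ω.gaps E, I.1 = J.1 → ¬ I.2 < J.2 := by
    intro I hI J hJ h hlt
    rcases hJ.2.2.subset ⟨⟨h ▸ hI.1.le, hlt.le⟩, gaps_snd_mem hI⟩ with h' | h'
    · exact hI.1.ne (h.trans h'.symm)
    · exact hlt.ne h'
  intro I hI J hJ h
  exact Prod.ext h (le_antisymm (not_lt.1 (key J hJ I hI h.symm)) (not_lt.1 (key I hI J hJ h)))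

theorem gaps_injOn_snd : InjOn Prod.snd (Ω.gaps E) := by
  have key : ∀ I ∈ Ω.gaps E, ∀ J ∈ Ω.gaps E, I.2 = J.2 → ¬ I.1 < J.1 := by
    intro I hI J hJ h hlt
    rcases hI.2.2.subset ⟨⟨hlt.le, h ▸ hJ.1.le⟩, gaps_fst_mem hJ⟩ with h' | h'
    · exact hlt.ne' h'
    · exact hJ.1.ne (h'.trans h)
  intro I hI J hJ h
  exact Prod.ext (le_antisymm (not_lt.1 (key J hJ I hI h.symm)) (not_lt.1 (key I hI J hJ h))) h

theorem exists_pred (hE : E.Finite) (hb : Ω.boundary ⊆ E) {i : Fin Ω.m} {x : ℝ}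
    (hx : x ∈ Icc (Ω.a i) (Ω.b i)) (hxa : x ≠ Ω.a i) :
    ∃ c ∈ E, Ω.a i ≤ c ∧ c < x ∧ Ioo c x ∩ E = ∅ := by
  have hfin : (E ∩ Ico (Ω.a i) x).Finite := hE.inter_of_left _
  have hne : (E ∩ Ico (Ω.a i) x).Nonempty :=
    ⟨Ω.a i, hb (Or.inl ⟨i, rfl⟩), le_rfl, lt_of_le_of_ne hx.1 hxa.symm⟩
  obtain ⟨c, ⟨hcE, hca, hcx⟩, hmax⟩ := hfin.exists_maximal hne
  refine ⟨c, hcE, hca, hcx, ?_⟩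
  rw [eq_empty_iff_forall_notMem]
  rintro t ⟨ht, htE⟩
  exact absurd (hmax ⟨htE, hca.trans ht.1.le, ht.2⟩ ht.1.le) (not_le.2 ht.1)

theorem exists_succ (hE : E.Finite) (hb : Ω.boundary ⊆ E) {i : Fin Ω.m} {x : ℝ}
    (hx : x ∈ Icc (Ω.a i) (Ω.b i)) (hxb : x ≠ Ω.b i) :
    ∃ d ∈ E, d ≤ Ω.b i ∧ x < d ∧ Ioo x d ∩ E = ∅ := by
  have hfin : (E ∩ Ioc x (Ω.b i)).Finite := hE.inter_of_left _
  have hne : (E ∩ Ioc x (Ω.b i)).Nonempty :=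
    ⟨Ω.b i, hb (Or.inr ⟨i, rfl⟩), lt_of_le_of_ne hx.2 hxb, le_rfl⟩
  obtain ⟨d, ⟨hdE, hdx, hdb⟩, hmin⟩ := hfin.exists_minimal hne
  refine ⟨d, hdE, hdb, hdx, ?_⟩
  rw [eq_empty_iff_forall_notMem]
  rintro t ⟨ht, htE⟩
  exact absurd (hmin ⟨htE, ht.1, ht.2.le.trans hdb⟩ ht.2.le) (not_le.2 ht.2)

theorem mem_gaps {i : Fin Ω.m} {c d : ℝ} (hcd : c < d) (hc : Ω.a i ≤ c) (hd : d ≤ Ω.b i)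
    (hcE : c ∈ E) (hdE : d ∈ E) (h : Ioo c d ∩ E = ∅) : (c, d) ∈ Ω.gaps E := by
  refine ⟨hcd, fun t ht => mem_iUnion.2 ⟨i, hc.trans ht.1, ht.2.trans hd⟩, ?_⟩
  ext t
  constructor
  · rintro ⟨ht, htE⟩
    by_contra hn
    have hn' : t ≠ c ∧ t ≠ d := by simpa using hn
    exact (h.subset ⟨⟨lt_of_le_of_ne ht.1 hn'.1.symm, lt_of_le_of_ne ht.2 hn'.2⟩, htE⟩ : t ∈ ∅)
  · rintro (rfl | rfl)
    · exact ⟨left_mem_Icc.2 hcd.le, hcE⟩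
    · exact ⟨right_mem_Icc.2 hcd.le, hdE⟩

theorem exists_gap (hE : E.Finite) (hb : Ω.boundary ⊆ E) {x : ℝ} (hx : x ∈ Ω.carrier)
    (hxE : x ∉ E) : ∃ I ∈ Ω.gaps E, x ∈ Ioo I.1 I.2 := by
  obtain ⟨i, hi⟩ := mem_iUnion.1 hx
  obtain ⟨c, hcE, hca, hcx, hc⟩ := exists_pred hE hb hi fun h => hxE (h ▸ hb (Or.inl ⟨i, rfl⟩))
  obtain ⟨d, hdE, hdb, hdx, hd⟩ := exists_succ hE hb hi fun h => hxE (h ▸ hb (Or.inr ⟨i, rfl⟩))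
  refine ⟨(c, d), mem_gaps (hcx.trans hdx) hca hdb hcE hdE ?_, hcx, hdx⟩
  rw [eq_empty_iff_forall_notMem]
  rintro t ⟨ht, htE⟩
  rcases lt_trichotomy t x with h | h | h
  · exact (hc.subset ⟨⟨ht.1, h⟩, htE⟩ : t ∈ ∅)
  · exact hxE (h ▸ htE)
  · exact (hd.subset ⟨⟨h, ht.2⟩, htE⟩ : t ∈ ∅)

theorem snd_image_gaps (hE : E.Finite) (hb : Ω.boundary ⊆ E) (hEΩ : E ⊆ Ω.carrier) :
    Prod.snd '' Ω.gaps E = E \ range Ω.a := by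
  ext d
  constructor
  · rintro ⟨I, hI, rfl⟩
    refine ⟨gaps_snd_mem hI, ?_⟩
    rintro ⟨i, hi⟩
    obtain ⟨j, h1, h2⟩ := gaps_component hI
    have h3 : I.2 ∈ Icc (Ω.a i) (Ω.b i) := hi ▸ Ω.left_mem i
    obtain rfl := index_unique h2 h3
    exact absurd hI.1 (not_lt.2 (hi ▸ h1.1))
  · rintro ⟨hdE, hda⟩
    obtain ⟨i, hi⟩ := mem_iUnion.1 (hEΩ hdE)
    obtain ⟨c, hcE, hca, hcd, hc⟩ := exists_pred hE hb hi fun h => hda ⟨i, h.symm⟩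
    exact ⟨(c, d), mem_gaps hcd hca hi.2 hcE hdE hc, rfl⟩

theorem fst_image_gaps (hE : E.Finite) (hb : Ω.boundary ⊆ E) (hEΩ : E ⊆ Ω.carrier) :
    Prod.fst '' Ω.gaps E = E \ range Ω.b := by
  ext c
  constructor
  · rintro ⟨I, hI, rfl⟩
    refine ⟨gaps_fst_mem hI, ?_⟩
    rintro ⟨i, hi⟩
    obtain ⟨j, h1, h2⟩ := gaps_component hI
    have h3 : I.1 ∈ Icc (Ω.a i) (Ω.b i) := hi ▸ Ω.right_mem i
    obtain rfl := index_unique h1 h3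
    exact absurd hI.1 (not_lt.2 (hi ▸ h2.2))
  · rintro ⟨hcE, hcb⟩
    obtain ⟨i, hi⟩ := mem_iUnion.1 (hEΩ hcE)
    obtain ⟨d, hdE, hdb, hcd, hd⟩ := exists_succ hE hb hi fun h => hcb ⟨i, h.symm⟩
    exact ⟨(c, d), mem_gaps hcd hi.1 hdb hcE hdE hd, rfl⟩

theorem injective_a : Function.Injective Ω.a := fun i j h =>
  index_unique (t := Ω.a i) (Ω.left_mem i) (h.symm ▸ ⟨le_rfl, (Ω.lt j).le⟩)

theorem injective_b : Function.Injective Ω.b := fun i j h =>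
  index_unique (t := Ω.b i) (Ω.right_mem i) (h.symm ▸ ⟨(Ω.lt j).le, le_rfl⟩)

/-- The increments over all gaps add up to the increments over the components. -/
theorem sum_gaps {M : Type*} [AddCommGroup M] (hE : E.Finite) (hb : Ω.boundary ⊆ E)
    (hEΩ : E ⊆ Ω.carrier) (g : ℝ → M) :
    ∑ I ∈ (gaps_finite (Ω := Ω) hE).toFinset, (g I.2 - g I.1) =
      ∑ i, (g (Ω.b i) - g (Ω.a i)) := by
  classical
  -- Right ends of gaps run once through E without the aᵢ, left ends once through E without the bᵢ,
  -- so in the difference only boundary terms remain.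
  have h2 : ∑ I ∈ (gaps_finite (Ω := Ω) hE).toFinset, g I.2 =
      ∑ d ∈ hE.toFinset \ Finset.univ.image Ω.a, g d := by
    rw [← Finset.sum_image (s := (gaps_finite (Ω := Ω) hE).toFinset) (g := Prod.snd) (f := g)
      (by simpa using gaps_injOn_snd)]
    congr 1
    rw [← Finset.coe_inj]
    simpa using snd_image_gaps hE hb hEΩ
  have h1 : ∑ I ∈ (gaps_finite (Ω := Ω) hE).toFinset, g I.1 =
      ∑ d ∈ hE.toFinset \ Finset.univ.image Ω.b, g d := by
    rw [← Finset.sum_image (s := (gaps_finite (Ω := Ω) hE).toFinset) (g := Prod.fst) (f := g)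
      (by simpa using gaps_injOn_fst)]
    congr 1
    rw [← Finset.coe_inj]
    simpa using fst_image_gaps hE hb hEΩ
  have ha : Finset.univ.image Ω.a ⊆ hE.toFinset := by
    intro t ht
    obtain ⟨i, -, rfl⟩ := Finset.mem_image.1 ht
    exact hE.mem_toFinset.2 (hb (Or.inl ⟨i, rfl⟩))
  have hb' : Finset.univ.image Ω.b ⊆ hE.toFinset := by
    intro t ht
    obtain ⟨i, -, rfl⟩ := Finset.mem_image.1 ht
    exact hE.mem_toFinset.2 (hb (Or.inr ⟨i, rfl⟩))
  have e1 := Finset.sum_sdiff (f := g) ha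
  have e2 := Finset.sum_sdiff (f := g) hb'
  rw [Finset.sum_image injective_a.injOn] at e1
  rw [Finset.sum_image injective_b.injOn] at e2
  rw [Finset.sum_sub_distrib, Finset.sum_sub_distrib, h2, h1, sub_eq_sub_iff_add_eq_add, e1,
    add_comm, e2]

/-- Induction over the intervals between consecutive points of a finite set. -/
theorem interval_induction (hE : E.Finite) {p : S0 Ω → Prop} (zero : p 0)
    (add : ∀ v w, p v → p w → p (v + w))
    (mem : ∀ x y : Ω.carrier, x < y → Ioo (x : ℝ) y ⊆ Ω.carrier \ E → p (pt y - pt x))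
    (hEΩ : E ⊆ Ω.carrier) {i : Fin Ω.m} {x y : Ω.carrier} (hx : (x : ℝ) ∈ Icc (Ω.a i) (Ω.b i))
    (hy : (y : ℝ) ∈ Icc (Ω.a i) (Ω.b i)) (hxy : x ≤ y) : p (pt y - pt x) := by
  have key : ∀ (n : ℕ) (x y : Ω.carrier), (x : ℝ) ∈ Icc (Ω.a i) (Ω.b i) →
      (y : ℝ) ∈ Icc (Ω.a i) (Ω.b i) → x < y → (E ∩ Ioo (x : ℝ) y).ncard ≤ n →
      p (pt y - pt x) := by
    intro n
    induction n with
    | zero =>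
      intro x y hx hy hxy hn
      have he := (ncard_eq_zero (hE.inter_of_left (Ioo (x : ℝ) y))).1 (Nat.le_zero.1 hn)
      refine mem x y hxy fun t ht => ⟨?_, fun hC => ?_⟩
      · exact mem_iUnion.2 ⟨i, hx.1.trans ht.1.le, ht.2.le.trans hy.2⟩
      · exact (he.subset ⟨hC, ht⟩ : t ∈ (∅ : Set ℝ))
    | succ n ih =>
      intro x y hx hy hxy hn
      have hfin : (E ∩ Ioo (x : ℝ) y).Finite := hE.inter_of_left _
      rcases (E ∩ Ioo (x : ℝ) y).eq_empty_or_nonempty with he | ⟨c, hc, hcI⟩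
      · exact ih x y hx hy hxy (by rw [he]; simp)
      · let c' : Ω.carrier := ⟨c, hEΩ hc⟩
        have hci : (c' : ℝ) ∈ Icc (Ω.a i) (Ω.b i) :=
          ⟨hx.1.trans hcI.1.le, hcI.2.le.trans hy.2⟩
        have e : pt y - pt x = (pt y - pt c') + (pt c' - pt x) := by abel
        rw [e]
        refine add _ _ (ih c' y hci hy hcI.2 ?_) (ih x c' hx hci hcI.1 ?_)
        · refine Nat.lt_succ_iff.1 (lt_of_lt_of_le (ncard_lt_ncard ?_ hfin) hn)
          refine ⟨fun t ht => ⟨ht.1, hcI.1.trans ht.2.1, ht.2.2⟩, fun hsub => ?_⟩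
          exact lt_irrefl _ (hsub ⟨hc, hcI⟩).2.1
        · refine Nat.lt_succ_iff.1 (lt_of_lt_of_le (ncard_lt_ncard ?_ hfin) hn)
          refine ⟨fun t ht => ⟨ht.1, ht.2.1, ht.2.2.trans hcI.2⟩, fun hsub => ?_⟩
          exact lt_irrefl _ (hsub ⟨hc, hcI⟩).2.2
  rcases hxy.eq_or_lt with rfl | h
  · rw [sub_self]; exact zero
  · exact key _ x y hx hy h le_rfl

end IntervalUnion

/-! ### The cone of positive chains -/

variable {Ω : IntervalUnion}

/-- The cone spanned by the vectors `y - x` with `x ≤ y` in the same component of `Ω`. -/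
def posCone (Ω : IntervalUnion) : AddSubmonoid (S0 Ω) :=
  AddSubmonoid.closure {v | ∃ (r : ℝ) (i : Fin Ω.m) (x y : Ω.carrier), 0 ≤ r ∧
    (x : ℝ) ∈ Icc (Ω.a i) (Ω.b i) ∧ (y : ℝ) ∈ Icc (Ω.a i) (Ω.b i) ∧ x ≤ y ∧
    v = r • (pt y - pt x)}

theorem smul_sub_mem_posCone {r : ℝ} (hr : 0 ≤ r) {i : Fin Ω.m} {x y : Ω.carrier}
    (hx : (x : ℝ) ∈ Icc (Ω.a i) (Ω.b i)) (hy : (y : ℝ) ∈ Icc (Ω.a i) (Ω.b i)) (hxy : x ≤ y) :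
    r • (pt y - pt x) ∈ posCone Ω :=
  AddSubmonoid.subset_closure ⟨r, i, x, y, hr, hx, hy, hxy, rfl⟩

theorem sub_mem_posCone {i : Fin Ω.m} {x y : Ω.carrier} (hx : (x : ℝ) ∈ Icc (Ω.a i) (Ω.b i))
    (hy : (y : ℝ) ∈ Icc (Ω.a i) (Ω.b i)) (hxy : x ≤ y) : pt y - pt x ∈ posCone Ω := by
  simpa using smul_sub_mem_posCone zero_le_one hx hy hxy

theorem posCone_le_S1 {v : S0 Ω} (hv : v ∈ posCone Ω) : v ∈ S1 Ω := by
  induction hv using AddSubmonoid.closure_induction with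
  | mem v hv =>
    obtain ⟨r, i, x, y, -, hx, hy, -, rfl⟩ := hv
    exact Submodule.smul_mem _ _ (pt_sub_mem_S1 hx hy)
  | zero => exact Submodule.zero_mem _
  | add v w _ _ hv hw => exact Submodule.add_mem _ hv hw

theorem smul_mem_posCone {r : ℝ} (hr : 0 ≤ r) {v : S0 Ω} (hv : v ∈ posCone Ω) :
    r • v ∈ posCone Ω := by
  induction hv using AddSubmonoid.closure_induction with
  | mem v hv =>
    obtain ⟨s, i, x, y, hs, hx, hy, hxy, rfl⟩ := hv
    rw [smul_smul]
    exact smul_sub_mem_posCone (mul_nonneg hr hs) hx hy hxy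
  | zero => rw [smul_zero]; exact AddSubmonoid.zero_mem _
  | add v w _ _ hv hw => rw [smul_add]; exact AddSubmonoid.add_mem _ hv hw

/-- A functional that is monotone along `Ω` is nonnegative on the cone. -/
theorem nonneg_of_mem_posCone (θ : S0 Ω →ₗ[ℝ] ℝ) (hθ : ∀ x y, x ≤ y → θ (pt x) ≤ θ (pt y))
    {v : S0 Ω} (hv : v ∈ posCone Ω) : 0 ≤ θ v := by
  induction hv using AddSubmonoid.closure_induction with
  | mem v hv =>
    obtain ⟨s, i, x, y, hs, hx, hy, hxy, rfl⟩ := hv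
    rw [map_smul, map_sub, smul_eq_mul]
    exact mul_nonneg hs (sub_nonneg.2 (hθ x y hxy))
  | zero => rw [map_zero]
  | add v w _ _ hv hw => rw [map_add]; exact add_nonneg hv hw

theorem rightStep_mono (t : ℝ) {x y : Ω.carrier} (h : x ≤ y) :
    rightStep Ω t (pt x) ≤ rightStep Ω t (pt y) := by
  have h' : (x : ℝ) ≤ y := h
  rw [rightStep_pt, rightStep_pt]
  split_ifs with h1 h2
  · exact le_rfl
  · exact absurd (h1.trans_le h') h2
  · exact zero_le_one
  · exact le_rfl

theorem leftStep_mono (t : ℝ) {x y : Ω.carrier} (h : x ≤ y) :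
    leftStep Ω t (pt x) ≤ leftStep Ω t (pt y) := by
  have h' : (x : ℝ) ≤ y := h
  rw [leftStep_pt, leftStep_pt]
  split_ifs with h1 h2
  · exact le_rfl
  · exact absurd (h1.trans h') h2
  · exact zero_le_one
  · exact le_rfl

/-- The functional `x ↦ x`, whose value at `y - x` is the length of `[x,y]`. -/
def lengthFun (Ω : IntervalUnion) : S0 Ω →ₗ[ℝ] ℝ :=
  Finsupp.linearCombination ℝ fun x : Ω.carrier => (x : ℝ)

@[simp]
theorem lengthFun_pt (x : Ω.carrier) : lengthFun Ω (pt x) = x := by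
  simp [lengthFun, pt, Finsupp.linearCombination_single]

open Classical in
/-- The sum of the coefficients at the points of a component. -/
def componentSum (Ω : IntervalUnion) (i : Fin Ω.m) : S0 Ω →ₗ[ℝ] ℝ :=
  Finsupp.linearCombination ℝ fun x : Ω.carrier =>
    if (x : ℝ) ∈ Icc (Ω.a i) (Ω.b i) then (1 : ℝ) else 0

theorem componentSum_eq_zero (i : Fin Ω.m) {v : S0 Ω} (hv : v ∈ S1 Ω) :
    componentSum Ω i v = 0 := by
  have hpt : ∀ (j : Fin Ω.m) (x : Ω.carrier), (x : ℝ) ∈ Icc (Ω.a j) (Ω.b j) →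
      componentSum Ω i (pt x) = if i = j then 1 else 0 := by
    intro j x hx
    have e : componentSum Ω i (pt x) = if (x : ℝ) ∈ Icc (Ω.a i) (Ω.b i) then 1 else 0 := by
      simp [componentSum, pt, Finsupp.linearCombination_single]
    rw [e]
    refine if_congr ⟨fun h => IntervalUnion.index_unique h hx, ?_⟩ rfl rfl
    rintro rfl
    exact hx
  have : S1 Ω ≤ LinearMap.ker (componentSum Ω i) := by
    refine Submodule.span_le.2 ?_
    rintro _ ⟨j, x, y, hx, hy, rfl⟩
    rw [SetLike.mem_coe, LinearMap.mem_ker, map_sub, hpt j x hx, hpt j y hy, sub_self]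
  exact this hv

/-- A vector of `S₁` that is nonnegative at each `rightStep` lies in the cone. -/
theorem mem_posCone_of_rightStep_nonneg {v : S0 Ω} (hv : v ∈ S1 Ω)
    (h : ∀ t ∈ Ω.carrier, 0 ≤ rightStep Ω t v) : v ∈ posCone Ω := by
  classical
  have key : ∀ (n : ℕ) (v : S0 Ω), v ∈ S1 Ω → (∀ t ∈ Ω.carrier, 0 ≤ rightStep Ω t v) →
      v.support.card ≤ n → v ∈ posCone Ω := by
    intro n
    induction n with
    | zero =>
      intro v _ _ hn
      rw [Finsupp.card_support_eq_zero.1 (Nat.le_zero.1 hn)]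
      exact AddSubmonoid.zero_mem _
    | succ n ih =>
      intro v hv hpos hn
      rcases v.support.eq_empty_or_nonempty with he | hne
      · rw [Finsupp.support_eq_empty.1 he]; exact AddSubmonoid.zero_mem _
      -- The greatest support point x is peeled off. The coefficients on its component add up to 0,
      -- so the component has another support point; let y be the greatest one below x. The step
      -- value on [y,x[ is `v x`, hence nonnegative, and subtracting `v x • (pt x - pt y)` removes x
      -- from the support.
      obtain ⟨x, hx, hmax⟩ := v.support.exists_max_image (fun x => (x : ℝ)) hne
      obtain ⟨i, hi⟩ := mem_iUnion.1 x.2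
      have hvx : v x ≠ 0 := Finsupp.mem_support_iff.1 hx
      have hex : ∃ y ∈ v.support, y < x ∧ (y : ℝ) ∈ Icc (Ω.a i) (Ω.b i) := by
        by_contra! hno
        have h0 := componentSum_eq_zero i hv
        rw [componentSum, Finsupp.linearCombination_apply, Finsupp.sum,
          Finset.sum_eq_single_of_mem x hx] at h0
        · rw [if_pos hi] at h0
          exact hvx (by simpa using h0)
        · intro y hy hyx
          rw [if_neg (hno y hy (lt_of_le_of_ne (hmax y hy) hyx)), smul_zero]
      have hfil : (v.support.filter fun y => y < x ∧ (y : ℝ) ∈ Icc (Ω.a i) (Ω.b i)).Nonempty := by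
        obtain ⟨y, hy, hy'⟩ := hex
        exact ⟨y, Finset.mem_filter.2 ⟨hy, hy'⟩⟩
      obtain ⟨y, hy, hymax⟩ := Finset.exists_max_image _ (fun x : Ω.carrier => (x : ℝ)) hfil
      obtain ⟨hys, hyx, hyi⟩ := Finset.mem_filter.1 hy
      have hyx' : (y : ℝ) < x := hyx
      have hstep : ∀ t : ℝ, (y : ℝ) ≤ t → t < x → rightStep Ω t v = v x := by
        intro t h1 h2
        rw [rightStep, Finsupp.linearCombination_apply, Finsupp.sum,
          Finset.sum_eq_single_of_mem x hx, if_pos h2, smul_eq_mul, mul_one]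
        intro z hz hzx
        rw [if_neg, smul_zero]
        intro htz
        have hzx' : z < x := lt_of_le_of_ne (hmax z hz) hzx
        have hzx'' : (z : ℝ) < x := hzx'
        have hz2 := hymax z (Finset.mem_filter.2 ⟨hz, hzx',
          hyi.1.trans (h1.trans htz.le), hzx''.le.trans hi.2⟩)
        exact absurd (h1.trans_lt htz) (not_lt.2 hz2)
      have hvpos : 0 ≤ v x := hstep y le_rfl hyx' ▸ hpos y y.2
      have hcone := smul_sub_mem_posCone hvpos hyi hi hyx.le
      have hmem : v - v x • (pt x - pt y) ∈ posCone Ω := by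
        refine ih _ (Submodule.sub_mem _ hv (posCone_le_S1 hcone)) (fun t ht => ?_) ?_
        · rw [map_sub, map_smul, map_sub, rightStep_pt, rightStep_pt, smul_eq_mul]
          by_cases h1 : t < (x : ℝ)
          · by_cases h2 : t < (y : ℝ)
            · rw [if_pos h1, if_pos h2, sub_self, mul_zero, sub_zero]; exact hpos t ht
            · rw [if_pos h1, if_neg h2, sub_zero, mul_one, hstep t (not_lt.1 h2) h1, sub_self]
          · rw [if_neg h1, if_neg fun h2 => h1 (h2.trans hyx'), sub_self, mul_zero, sub_zero]
            exact hpos t ht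
        · refine Nat.lt_succ_iff.1 (lt_of_lt_of_le (Finset.card_lt_card ?_) hn)
          refine Finset.ssubset_iff_subset_ne.2 ⟨fun z hz => ?_, fun he => ?_⟩
          · by_contra hzv
            have hzx : z ≠ x := fun h => hzv (h ▸ hx)
            have hzy : z ≠ y := fun h => hzv (h ▸ hys)
            refine Finsupp.mem_support_iff.1 hz ?_
            rw [Finsupp.sub_apply, Finsupp.notMem_support_iff.1 hzv, Finsupp.smul_apply,
              Finsupp.sub_apply, pt, pt, Finsupp.single_eq_of_ne hzx,
              Finsupp.single_eq_of_ne hzy, sub_zero, smul_zero, sub_zero]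
          · have : x ∈ (v - v x • (pt x - pt y)).support := he ▸ hx
            refine Finsupp.mem_support_iff.1 this ?_
            rw [Finsupp.sub_apply, Finsupp.smul_apply, Finsupp.sub_apply, pt, pt,
              Finsupp.single_eq_same, Finsupp.single_eq_of_ne hyx.ne', sub_zero, smul_eq_mul,
              mul_one, sub_self]
      have := AddSubmonoid.add_mem _ hmem hcone
      rwa [sub_add_cancel] at this
  exact key _ v hv h le_rfl

/-- The sum of all components, as a chain. -/
def fundamental (Ω : IntervalUnion) : S0 Ω := ∑ i, (pt (Ω.right i) - pt (Ω.left i))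

theorem fundamental_mem : fundamental Ω ∈ posCone Ω :=
  AddSubmonoid.sum_mem _ fun i _ =>
    sub_mem_posCone (Ω.left_mem i) (Ω.right_mem i) (Ω.lt i).le

theorem rightStep_eq_zero_of_right (i : Fin Ω.m) {v : S0 Ω} (hv : v ∈ S1 Ω) :
    rightStep Ω (Ω.b i) v = 0 := by
  have : S1 Ω ≤ LinearMap.ker (rightStep Ω (Ω.b i)) := by
    refine Submodule.span_le.2 ?_
    rintro _ ⟨j, x, y, hx, hy, rfl⟩
    rw [SetLike.mem_coe, LinearMap.mem_ker, map_sub, rightStep_pt, rightStep_pt, sub_eq_zero]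
    rcases lt_or_ge i j with h | h
    · have := Ω.gap _ _ h
      rw [if_pos (this.trans_le hx.1), if_pos (this.trans_le hy.1)]
    · have hb : Ω.b j ≤ Ω.b i := by
        rcases h.eq_or_lt with rfl | h
        · exact le_rfl
        · exact ((Ω.gap _ _ h).trans (Ω.lt i)).le
      rw [if_neg (not_lt.2 (hx.2.trans hb)), if_neg (not_lt.2 (hy.2.trans hb))]
  exact this hv

theorem leftStep_eq_zero_of_left (i : Fin Ω.m) {v : S0 Ω} (hv : v ∈ S1 Ω) :
    leftStep Ω (Ω.a i) v = 0 := by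
  have : S1 Ω ≤ LinearMap.ker (leftStep Ω (Ω.a i)) := by
    refine Submodule.span_le.2 ?_
    rintro _ ⟨j, x, y, hx, hy, rfl⟩
    rw [SetLike.mem_coe, LinearMap.mem_ker, map_sub, leftStep_pt, leftStep_pt, sub_eq_zero]
    rcases lt_or_ge j i with h | h
    · have := Ω.gap _ _ h
      rw [if_neg (not_le.2 (hx.2.trans_lt this)), if_neg (not_le.2 (hy.2.trans_lt this))]
    · have hb : Ω.a i ≤ Ω.a j := by
        rcases h.eq_or_lt with rfl | h
        · exact le_rfl
        · exact ((Ω.lt i).trans (Ω.gap _ _ h)).le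
      rw [if_pos (hb.trans hx.1), if_pos (hb.trans hy.1)]
  exact this hv

theorem rightStep_fundamental {i : Fin Ω.m} {t : ℝ} (ht : t ∈ Ico (Ω.a i) (Ω.b i)) :
    rightStep Ω t (fundamental Ω) = 1 := by
  rw [fundamental, map_sum, Finset.sum_eq_single_of_mem i (Finset.mem_univ i)]
  · rw [map_sub, rightStep_pt, rightStep_pt, if_pos (show t < (Ω.right i : ℝ) from ht.2),
      if_neg (show ¬ t < (Ω.left i : ℝ) from not_lt.2 ht.1), sub_zero]
  · intro j _ hj
    rw [map_sub, rightStep_pt, rightStep_pt, sub_eq_zero]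
    rcases lt_or_gt_of_ne hj with h | h
    · have h1 := Ω.gap _ _ h
      have h2 : ¬ t < (Ω.right j : ℝ) := not_lt.2 (h1.le.trans ht.1)
      rw [if_neg h2, if_neg fun h3 => h2 (h3.trans (Ω.lt j))]
    · have h1 := Ω.gap _ _ h
      have h2 : t < (Ω.left j : ℝ) := ht.2.trans h1
      rw [if_pos h2, if_pos (show t < (Ω.right j : ℝ) from h2.trans (Ω.lt j))]

end PMGraph
end

noncomputable section
namespace PMGraph

/-! ### Laps of the iterates -/

section Monotone

variable {f : ℝ → ℝ} {x y p q : ℝ}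

theorem strictMonoOn_Ioo_image (hxy : x < y) (hc : ContinuousOn f (Ioo x y))
    (hm : StrictMonoOn f (Ioo x y)) (hl : Tendsto f (𝓝[>] x) (𝓝 p))
    (hr : Tendsto f (𝓝[<] y) (𝓝 q)) :
    p < q ∧ MapsTo f (Ioo x y) (Ioo p q) ∧ SurjOn f (Ioo x y) (Ioo p q) := by
  have hmaps : MapsTo f (Ioo x y) (Ioo p q) := by
    intro t ht
    constructor
    · obtain ⟨s, hs⟩ := exists_between ht.1
      have hsI : s ∈ Ioo x y := ⟨hs.1, hs.2.trans ht.2⟩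
      refine lt_of_le_of_lt (le_of_tendsto hl ?_) (hm hsI ht hs.2)
      filter_upwards [Ioo_mem_nhdsGT hs.1] with r hr
      exact (hm ⟨hr.1, hr.2.trans hsI.2⟩ hsI hr.2).le
    · obtain ⟨s, hs⟩ := exists_between ht.2
      have hsI : s ∈ Ioo x y := ⟨ht.1.trans hs.1, hs.2⟩
      refine lt_of_lt_of_le (hm ht hsI hs.1) (ge_of_tendsto hr ?_)
      filter_upwards [Ioo_mem_nhdsLT hs.2] with r hr
      exact (hm hsI ⟨hsI.1.trans hr.1, hr.2⟩ hr.1).le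
  obtain ⟨m, hm'⟩ := exists_between hxy
  refine ⟨(hmaps hm').1.trans (hmaps hm').2, hmaps, fun v hv => ?_⟩
  obtain ⟨s, hs, hsI⟩ := ((hl.eventually_lt_const hv.1).and (Ioo_mem_nhdsGT hxy)).exists
  obtain ⟨s', hs', hsI'⟩ := ((hr.eventually_const_lt hv.2).and (Ioo_mem_nhdsLT hxy)).exists
  exact isPreconnected_Ioo.intermediate_value hsI hsI' hc ⟨hs.le, hs'.le⟩

theorem strictAntiOn_Ioo_image (hxy : x < y) (hc : ContinuousOn f (Ioo x y))
    (hm : StrictAntiOn f (Ioo x y)) (hl : Tendsto f (𝓝[>] x) (𝓝 p))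
    (hr : Tendsto f (𝓝[<] y) (𝓝 q)) :
    q < p ∧ MapsTo f (Ioo x y) (Ioo q p) ∧ SurjOn f (Ioo x y) (Ioo q p) := by
  obtain ⟨h1, h2, h3⟩ := strictMonoOn_Ioo_image hxy hc.neg hm.neg hl.neg hr.neg
  refine ⟨neg_lt_neg_iff.1 h1, fun t ht => ?_, fun v hv => ?_⟩
  · have := h2 ht
    exact ⟨neg_lt_neg_iff.1 this.2, neg_lt_neg_iff.1 this.1⟩
  · obtain ⟨t, ht, htv⟩ := h3 (show -v ∈ Ioo (-p) (-q) from ⟨neg_lt_neg hv.2, neg_lt_neg hv.1⟩)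
    exact ⟨t, ht, neg_injective htv⟩

end Monotone

namespace PMMap

variable {Ω : IntervalUnion} (F : PMMap Ω)

/-- `Fⁿ` is defined on `]x,y[`, with limits `p` at `x+` and `q` at `y-`. -/
structure IsLap (n : ℕ) (x y p q : Ω.carrier) : Prop where
  lt : (x : ℝ) < y
  cont : ContinuousOn F.toFun^[n] (Ioo (x : ℝ) y)
  left : Tendsto F.toFun^[n] (𝓝[>] (x : ℝ)) (𝓝 (p : ℝ))
  right : Tendsto F.toFun^[n] (𝓝[<] (y : ℝ)) (𝓝 (q : ℝ))
  component : ∃ j, (p : ℝ) ∈ Icc (Ω.a j) (Ω.b j) ∧ (q : ℝ) ∈ Icc (Ω.a j) (Ω.b j)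
  dir : (StrictMonoOn F.toFun^[n] (Ioo (x : ℝ) y) ∧
      (F.push1Ext ^ n) (pt y - pt x) = pt q - pt p) ∨
    (StrictAntiOn F.toFun^[n] (Ioo (x : ℝ) y) ∧ (F.push1Ext ^ n) (pt y - pt x) = pt p - pt q)

variable {F}

theorem IsLap.dir' {n : ℕ} {x y p q : Ω.carrier} (h : F.IsLap n x y p q) :
    ((p : ℝ) < q ∧ MapsTo F.toFun^[n] (Ioo (x : ℝ) y) (Ioo (p : ℝ) q) ∧
        SurjOn F.toFun^[n] (Ioo (x : ℝ) y) (Ioo (p : ℝ) q) ∧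
        StrictMonoOn F.toFun^[n] (Ioo (x : ℝ) y) ∧
        (F.push1Ext ^ n) (pt y - pt x) = pt q - pt p) ∨
      ((q : ℝ) < p ∧ MapsTo F.toFun^[n] (Ioo (x : ℝ) y) (Ioo (q : ℝ) p) ∧
        SurjOn F.toFun^[n] (Ioo (x : ℝ) y) (Ioo (q : ℝ) p) ∧
        StrictAntiOn F.toFun^[n] (Ioo (x : ℝ) y) ∧
        (F.push1Ext ^ n) (pt y - pt x) = pt p - pt q) := by
  rcases h.dir with ⟨hm, he⟩ | ⟨hm, he⟩
  · obtain ⟨h1, h2, h3⟩ := strictMonoOn_Ioo_image h.lt h.cont hm h.left h.right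
    exact Or.inl ⟨h1, h2, h3, hm, he⟩
  · obtain ⟨h1, h2, h3⟩ := strictAntiOn_Ioo_image h.lt h.cont hm h.left h.right
    exact Or.inr ⟨h1, h2, h3, hm, he⟩

theorem IsLap.mem_posCone {n : ℕ} {x y p q : Ω.carrier} (h : F.IsLap n x y p q) :
    (F.push1Ext ^ n) (pt y - pt x) ∈ posCone Ω := by
  obtain ⟨j, hp, hq⟩ := h.component
  rcases h.dir' with ⟨h1, -, -, -, he⟩ | ⟨h1, -, -, -, he⟩
  · rw [he]; exact sub_mem_posCone hp hq h1.le
  · rw [he]; exact sub_mem_posCone hq hp h1.le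

theorem IsLap.lengthFun_eq {n : ℕ} {x y p q : Ω.carrier} (h : F.IsLap n x y p q) :
    lengthFun Ω ((F.push1Ext ^ n) (pt y - pt x)) = |(q : ℝ) - p| := by
  rcases h.dir' with ⟨h1, -, -, -, he⟩ | ⟨h1, -, -, -, he⟩
  · rw [he, map_sub, lengthFun_pt, lengthFun_pt, abs_of_pos (sub_pos.2 h1)]
  · rw [he, map_sub, lengthFun_pt, lengthFun_pt, abs_of_neg (sub_neg.2 h1), neg_sub]

theorem IsLap.injOn {n : ℕ} {x y p q : Ω.carrier} (h : F.IsLap n x y p q) :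
    InjOn F.toFun^[n] (Ioo (x : ℝ) y) :=
  h.dir.elim (fun h => h.1.injOn) fun h => h.1.injOn

/-- The image chain of a lap is positively oriented whatever the direction of Fⁿ. This is how step
functionals count preimages. -/
theorem IsLap.rightStep_eq_one {n : ℕ} {x y p q : Ω.carrier} (h : F.IsLap n x y p q) {t : ℝ}
    (ht : t ∈ Ioo (x : ℝ) y) :
    rightStep Ω (F.toFun^[n] t) ((F.push1Ext ^ n) (pt y - pt x)) = 1 := by
  rcases h.dir' with ⟨-, h2, -, -, he⟩ | ⟨-, h2, -, -, he⟩
  · rw [he, map_sub, rightStep_pt, rightStep_pt, if_pos (h2 ht).2, if_neg (h2 ht).1.not_gt,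
      sub_zero]
  · rw [he, map_sub, rightStep_pt, rightStep_pt, if_pos (h2 ht).2, if_neg (h2 ht).1.not_gt,
      sub_zero]

theorem isLap_one {x y : Ω.carrier} (h : F.MonotoneBetween x y) : ∃ p q, F.IsLap 1 x y p q := by
  obtain ⟨j, p, q, hpj, hqj, hp, hq⟩ := F.exists_limits h
  refine ⟨p, q, h.1, (F.ioo_props h.2).1, hp, hq, ⟨j, hpj, hqj⟩, ?_⟩
  rw [pow_one, F.push1Ext_sub h hp hq, signBetween]
  by_cases hm : StrictMonoOn F.toFun (Ioo x y)
  · rw [if_pos hm, one_smul]; exact Or.inl ⟨hm, rfl⟩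
  · rw [if_neg hm, neg_smul, one_smul, neg_sub]
    exact Or.inr ⟨(F.ioo_props h.2).2.resolve_left hm, rfl⟩

/-- Fⁿ maps ]x,y[ onto the open interval between p and q. That interval misses C_F, so F is monotone
on it and the one-step lap there can be composed with Fⁿ. -/
theorem IsLap.succ {n : ℕ} {x y p q : Ω.carrier} (h : F.IsLap n x y p q)
    (hC : ∀ t ∈ Ioo (x : ℝ) y, F.toFun^[n] t ∉ F.C) : ∃ p' q', F.IsLap (n + 1) x y p' q' := by
  have hit : F.toFun^[n + 1] = F.toFun ∘ F.toFun^[n] := Function.iterate_succ' _ _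
  obtain ⟨j, hpj, hqj⟩ := h.component
  have hpow : (F.push1Ext ^ (n + 1)) (pt y - pt x) =
      F.push1Ext ((F.push1Ext ^ n) (pt y - pt x)) := by rw [pow_succ', Module.End.mul_apply]
  have hxI : Ioo (x : ℝ) y ∈ 𝓝[>] (x : ℝ) := Ioo_mem_nhdsGT h.lt
  have hyI : Ioo (x : ℝ) y ∈ 𝓝[<] (y : ℝ) := Ioo_mem_nhdsLT h.lt
  rcases h.dir' with ⟨h1, h2, h3, hm, he⟩ | ⟨h1, h2, h3, hm, he⟩
  · have hM : F.MonotoneBetween p q := ⟨h1, fun v hv => by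
      obtain ⟨t, ht, rfl⟩ := h3 hv
      exact ⟨mem_iUnion.2 ⟨j, hpj.1.trans hv.1.le, hv.2.le.trans hqj.2⟩, hC t ht⟩⟩
    obtain ⟨p', q', h'⟩ := isLap_one hM
    have hc' : ContinuousOn F.toFun (Ioo (p : ℝ) q) := h'.cont
    have hl' : Tendsto F.toFun (𝓝[>] (p : ℝ)) (𝓝 p') := h'.left
    have hr' : Tendsto F.toFun (𝓝[<] (q : ℝ)) (𝓝 q') := h'.right
    refine ⟨p', q', h.lt, ?_, ?_, ?_, h'.component, ?_⟩
    · rw [hit]; exact hc'.comp h.cont h2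
    · rw [hit]
      refine hl'.comp (tendsto_nhdsWithin_iff.2 ⟨h.left, ?_⟩)
      filter_upwards [hxI] with t ht using (h2 ht).1
    · rw [hit]
      refine hr'.comp (tendsto_nhdsWithin_iff.2 ⟨h.right, ?_⟩)
      filter_upwards [hyI] with t ht using (h2 ht).2
    · rw [hpow, hit, he]
      rcases h'.dir with ⟨hm', he'⟩ | ⟨hm', he'⟩
      · exact Or.inl ⟨fun s hs t ht hst => hm' (h2 hs) (h2 ht) (hm hs ht hst), by simpa using he'⟩
      · exact Or.inr ⟨fun s hs t ht hst => hm' (h2 hs) (h2 ht) (hm hs ht hst), by simpa using he'⟩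
  -- On a decreasing lap the image is ]q,p[, so the one-sided limits of F at its ends are exchanged.
  · have hM : F.MonotoneBetween q p := ⟨h1, fun v hv => by
      obtain ⟨t, ht, rfl⟩ := h3 hv
      exact ⟨mem_iUnion.2 ⟨j, hqj.1.trans hv.1.le, hv.2.le.trans hpj.2⟩, hC t ht⟩⟩
    obtain ⟨p', q', h'⟩ := isLap_one hM
    have hc' : ContinuousOn F.toFun (Ioo (q : ℝ) p) := h'.cont
    have hl' : Tendsto F.toFun (𝓝[>] (q : ℝ)) (𝓝 p') := h'.left
    have hr' : Tendsto F.toFun (𝓝[<] (p : ℝ)) (𝓝 q') := h'.right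
    obtain ⟨k, hk1, hk2⟩ := h'.component
    refine ⟨q', p', h.lt, ?_, ?_, ?_, ⟨k, hk2, hk1⟩, ?_⟩
    · rw [hit]; exact hc'.comp h.cont h2
    · rw [hit]
      refine hr'.comp (tendsto_nhdsWithin_iff.2 ⟨h.left, ?_⟩)
      filter_upwards [hxI] with t ht using (h2 ht).2
    · rw [hit]
      refine hl'.comp (tendsto_nhdsWithin_iff.2 ⟨h.right, ?_⟩)
      filter_upwards [hyI] with t ht using (h2 ht).1
    · rw [hpow, hit, he]
      rcases h'.dir with ⟨hm', he'⟩ | ⟨hm', he'⟩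
      · exact Or.inr ⟨fun s hs t ht hst => hm' (h2 ht) (h2 hs) (hm hs ht hst), by simpa using he'⟩
      · exact Or.inl ⟨fun s hs t ht hst => hm' (h2 ht) (h2 hs) (hm hs ht hst), by simpa using he'⟩

variable (F)

theorem cutIter_mono {m n : ℕ} (h : m ≤ n) : F.cutIter m ⊆ F.cutIter n := by
  rintro x ⟨hx, k, hk, hkC⟩
  exact ⟨hx, k, hk.trans_le h, hkC⟩

theorem cutIter_subset (n : ℕ) : F.cutIter n ⊆ Ω.carrier := fun _ h => h.1

theorem C_subset_cutIter {n : ℕ} (hn : 0 < n) : F.C ⊆ F.cutIter n :=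
  fun _ hx => ⟨F.C_subset hx, 0, hn, hx⟩

theorem boundary_subset_cutIter {n : ℕ} (hn : 0 < n) : Ω.boundary ⊆ F.cutIter n :=
  F.boundary_subset.trans (F.C_subset_cutIter hn)

theorem exists_isLap {x y : Ω.carrier} (hxy : x < y) (n : ℕ)
    (h : Ioo (x : ℝ) y ⊆ Ω.carrier \ F.cutIter n)
    (hcomp : ∃ j, (x : ℝ) ∈ Icc (Ω.a j) (Ω.b j) ∧ (y : ℝ) ∈ Icc (Ω.a j) (Ω.b j)) :
    ∃ p q, F.IsLap n x y p q := by
  have hxy' : (x : ℝ) < y := hxy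
  induction n with
  | zero =>
    exact ⟨x, y, hxy', continuousOn_id, tendsto_id.mono_left nhdsWithin_le_nhds,
      tendsto_id.mono_left nhdsWithin_le_nhds, hcomp,
      Or.inl ⟨strictMono_id.strictMonoOn _, rfl⟩⟩
  | succ n ih =>
    obtain ⟨p, q, hpq⟩ := ih fun t ht =>
      ⟨(h ht).1, fun hn => (h ht).2 (F.cutIter_mono (Nat.le_succ n) hn)⟩
    exact hpq.succ fun t ht hC => (h ht).2 ⟨(h ht).1, n, Nat.lt_succ_self n, hC⟩

theorem exists_isLap_of_mem_gaps {n : ℕ} {I : ℝ × ℝ} (hI : I ∈ Ω.gaps (F.cutIter n)) :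
    ∃ x y p q : Ω.carrier, (x : ℝ) = I.1 ∧ (y : ℝ) = I.2 ∧ F.IsLap n x y p q := by
  let x : Ω.carrier := ⟨I.1, hI.2.1 (left_mem_Icc.2 hI.1.le)⟩
  let y : Ω.carrier := ⟨I.2, hI.2.1 (right_mem_Icc.2 hI.1.le)⟩
  obtain ⟨p, q, h⟩ := F.exists_isLap (show x < y from hI.1) n
    (fun t ht => IntervalUnion.gaps_Ioo hI ht) (IntervalUnion.gaps_component hI)
  exact ⟨x, y, p, q, rfl, rfl, h⟩

/-- Cut at C_F, an interval becomes a sum of intervals of monotonicity, and the sign orients the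
image of each of them positively. -/
theorem push1Ext_mem_posCone {v : S0 Ω} (hv : v ∈ posCone Ω) : F.push1Ext v ∈ posCone Ω := by
  induction hv using AddSubmonoid.closure_induction with
  | mem v hv =>
    obtain ⟨r, i, x, y, hr, hx, hy, hxy, rfl⟩ := hv
    rw [map_smul]
    refine smul_mem_posCone hr ?_
    refine IntervalUnion.interval_induction F.finite_C (p := fun v => F.push1Ext v ∈ posCone Ω)
      ?_ (fun v w hv hw => ?_) (fun x y hxy h => ?_) F.C_subset hx hy hxy
    · rw [map_zero]; exact AddSubmonoid.zero_mem _
    · rw [map_add]; exact AddSubmonoid.add_mem _ hv hw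
    · obtain ⟨p, q, hpq⟩ := isLap_one (F := F) ⟨hxy, h⟩
      simpa using hpq.mem_posCone
  | zero => rw [map_zero]; exact AddSubmonoid.zero_mem _
  | add v w _ _ hv hw => rw [map_add]; exact AddSubmonoid.add_mem _ hv hw

theorem push1Ext_pow_mem_posCone (n : ℕ) {v : S0 Ω} (hv : v ∈ posCone Ω) :
    (F.push1Ext ^ n) v ∈ posCone Ω := by
  induction n with
  | zero => exact hv
  | succ n ih => rw [pow_succ', Module.End.mul_apply]; exact F.push1Ext_mem_posCone ih

/-- A point of `Ω` as a vector, extended by zero. -/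
def ptExt (Ω : IntervalUnion) (t : ℝ) : S0 Ω :=
  open Classical in if h : t ∈ Ω.carrier then pt ⟨t, h⟩ else 0

theorem ptExt_coe (x : Ω.carrier) : ptExt Ω x = pt x := dif_pos x.2

theorem sum_gaps_ptExt {E : Set ℝ} (hE : E.Finite) (hb : Ω.boundary ⊆ E)
    (hEΩ : E ⊆ Ω.carrier) :
    ∑ I ∈ (IntervalUnion.gaps_finite (Ω := Ω) hE).toFinset, (ptExt Ω I.2 - ptExt Ω I.1) =
      fundamental Ω := by
  rw [IntervalUnion.sum_gaps hE hb hEΩ, fundamental]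
  refine Finset.sum_congr rfl fun i _ => ?_
  rw [← ptExt_coe, ← ptExt_coe]
  rfl

/-- The points where `Fⁿ` is defined and takes the value `t`. -/
def preimages (n : ℕ) (t : ℝ) : Set ℝ := {x ∈ Ω.carrier | x ∉ F.cutIter n ∧ F.toFun^[n] x = t}

/-- The chain u is the sum of the laps of Fⁿ. Each lap contains at most one preimage of t and then
contributes 1 to the right side; the others contribute nonnegatively. Finiteness of the cut set is
assumed because `cutIter_finite` is proved by induction through this bound. -/
theorem ncard_preimages_le {n : ℕ} (hn : 0 < n) (hfin : (F.cutIter n).Finite) (t : ℝ) :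
    (F.preimages n t).Finite ∧
      ((F.preimages n t).ncard : ℝ) ≤ rightStep Ω t ((F.push1Ext ^ n) (fundamental Ω)) := by
  classical
  have hb := F.boundary_subset_cutIter hn
  have hgap : ∀ x ∈ F.preimages n t, ∃ I ∈ Ω.gaps (F.cutIter n), x ∈ Ioo I.1 I.2 := fun x hx =>
    IntervalUnion.exists_gap hfin hb hx.1 hx.2.1
  choose! g hg hxg using hgap
  have hinj : InjOn g (F.preimages n t) := by
    intro x hx x' hx' h
    obtain ⟨c, d, p, q, hc, hd, hL⟩ := F.exists_isLap_of_mem_gaps (hg x hx)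
    refine hL.injOn ?_ ?_ (hx.2.2.trans hx'.2.2.symm)
    · rw [hc, hd]; exact hxg x hx
    · rw [hc, hd, h]; exact hxg x' hx'
  have hGfin := IntervalUnion.gaps_finite (Ω := Ω) hfin
  have hPfin : (F.preimages n t).Finite :=
    Finite.of_finite_image (hGfin.subset (image_subset_iff.2 hg)) hinj
  refine ⟨hPfin, ?_⟩
  rw [← sum_gaps_ptExt hfin hb (F.cutIter_subset n), map_sum, map_sum]
  have himg : hPfin.toFinset.image g ⊆ hGfin.toFinset := by
    intro I hI
    obtain ⟨x, hx, rfl⟩ := Finset.mem_image.1 hI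
    exact hGfin.mem_toFinset.2 (hg x (hPfin.mem_toFinset.1 hx))
  refine le_trans (le_of_eq ?_) (Finset.sum_le_sum_of_subset_of_nonneg himg fun I hI _ => ?_)
  · rw [Finset.sum_image (by simpa using hinj), Finset.sum_congr rfl (g := fun _ => (1 : ℝ))]
    · rw [ncard_eq_toFinset_card _ hPfin]; simp
    · intro x hx
      have hx' := hPfin.mem_toFinset.1 hx
      obtain ⟨c, d, p, q, hc, hd, hL⟩ := F.exists_isLap_of_mem_gaps (hg x hx')
      rw [← hx'.2.2, ← hc, ← hd, ptExt_coe, ptExt_coe]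
      refine hL.rightStep_eq_one ?_
      rw [hc, hd]; exact hxg x hx'
  · obtain ⟨c, d, p, q, hc, hd, hL⟩ := F.exists_isLap_of_mem_gaps (hGfin.mem_toFinset.1 hI)
    rw [← hc, ← hd, ptExt_coe, ptExt_coe]
    exact nonneg_of_mem_posCone _ (fun _ _ => rightStep_mono t) hL.mem_posCone

theorem cutIter_succ (n : ℕ) :
    F.cutIter (n + 1) = F.cutIter n ∪ ⋃ c ∈ F.finite_C.toFinset, F.preimages n c := by
  ext x
  constructor
  · rintro ⟨hx, k, hk, hkC⟩
    by_cases h : x ∈ F.cutIter n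
    · exact Or.inl h
    · refine Or.inr (mem_iUnion₂.2 ⟨F.toFun^[n] x, ?_, hx, h, rfl⟩)
      rcases (Nat.lt_succ_iff.1 hk).lt_or_eq with h' | rfl
      · exact absurd ⟨hx, k, h', hkC⟩ h
      · exact F.finite_C.mem_toFinset.2 hkC
  · rintro (h | h)
    · exact F.cutIter_mono (Nat.le_succ n) h
    · obtain ⟨c, hc, hx, hxn, rfl⟩ := mem_iUnion₂.1 h
      exact ⟨hx, n, Nat.lt_succ_self n, F.finite_C.mem_toFinset.1 hc⟩

theorem preimages_zero_finite (t : ℝ) : (F.preimages 0 t).Finite :=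
  (finite_singleton t).subset fun _ hx => hx.2.2

theorem cutIter_finite (n : ℕ) : (F.cutIter n).Finite := by
  induction n with
  | zero =>
    refine finite_empty.subset ?_
    rintro x ⟨-, k, hk, -⟩
    exact absurd hk (Nat.not_lt_zero k)
  | succ n ih =>
    rw [cutIter_succ]
    refine ih.union (Finset.finite_toSet _ |>.biUnion fun c _ => ?_)
    rcases Nat.eq_zero_or_pos n with rfl | hn
    · exact F.preimages_zero_finite c
    · exact (F.ncard_preimages_le hn ih c).1

/-- The length of the image chain of a lap is the absolute increment of Fⁿ over it. For n = 0 there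
are no laps, since the cut set is empty. -/
theorem variation_eq {n : ℕ} (hn : 0 < n) :
    F.variation n = lengthFun Ω ((F.push1Ext ^ n) (fundamental Ω)) := by
  have hfin := F.cutIter_finite n
  have hGfin := IntervalUnion.gaps_finite (Ω := Ω) hfin
  have hlaps : F.laps n = Ω.gaps (F.cutIter n) := rfl
  rw [variation, hlaps, finsum_mem_eq_finite_toFinset_sum _ hGfin,
    ← sum_gaps_ptExt hfin (F.boundary_subset_cutIter hn) (F.cutIter_subset n), map_sum, map_sum]
  refine Finset.sum_congr rfl fun I hI => ?_
  obtain ⟨c, d, p, q, hc, hd, hL⟩ := F.exists_isLap_of_mem_gaps (hGfin.mem_toFinset.1 hI)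
  rw [← hc, ← hd, ptExt_coe, ptExt_coe, hL.lengthFun_eq,
    leftLim_eq_of_tendsto hL.right,
    rightLim_eq_of_tendsto hL.left]

end PMMap

end PMGraph
end

noncomputable section
namespace PMGraph

/-! ### Bounded functionals -/

variable {Ω : IntervalUnion}

/-- The `ℓ¹`-norm on `S₀`. -/
def norm1 (v : S0 Ω) : ℝ := ∑ x ∈ v.support, |v x|

theorem norm1_nonneg (v : S0 Ω) : 0 ≤ norm1 v := Finset.sum_nonneg fun _ _ => abs_nonneg _

/-- The functional is bounded by `b` at all points. -/
def IsBddFun (θ : S0 Ω →ₗ[ℝ] ℝ) (b : ℝ) : Prop := ∀ x, |θ (pt x)| ≤ b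

theorem eq_sum_pt (v : S0 Ω) : v = ∑ x ∈ v.support, v x • pt x := by
  conv_lhs => rw [← Finsupp.sum_single v]
  refine Finset.sum_congr rfl fun x _ => ?_
  simp [pt]

theorem IsBddFun.abs_le {θ : S0 Ω →ₗ[ℝ] ℝ} {b : ℝ} (h : IsBddFun θ b) (v : S0 Ω) :
    |θ v| ≤ b * norm1 v := by
  conv_lhs => rw [eq_sum_pt v, map_sum]
  refine (Finset.abs_sum_le_sum_abs _ _).trans ?_
  rw [norm1, Finset.mul_sum]
  refine Finset.sum_le_sum fun x _ => ?_
  rw [map_smul, smul_eq_mul, abs_mul, mul_comm]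
  exact mul_le_mul_of_nonneg_right (h x) (abs_nonneg _)

theorem eq_zero_of_forall_mem_support {θ : S0 Ω →ₗ[ℝ] ℝ} {v : S0 Ω}
    (h : ∀ x ∈ v.support, θ (pt x) = 0) : θ v = 0 := by
  rw [eq_sum_pt v, map_sum]
  refine Finset.sum_eq_zero fun x hx => ?_
  rw [map_smul, h x hx, smul_zero]

theorem rightStep_bdd (t : ℝ) : IsBddFun (rightStep Ω t) 1 := fun x => by
  rw [rightStep_pt]; split_ifs <;> simp

theorem leftStep_bdd (t : ℝ) : IsBddFun (leftStep Ω t) 1 := fun x => by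
  rw [leftStep_pt]; split_ifs <;> simp

theorem lengthFun_bdd : ∃ b, 0 ≤ b ∧ IsBddFun (lengthFun Ω) b := by
  have hc : IsCompact Ω.carrier := isCompact_iUnion fun _ => isCompact_Icc
  obtain ⟨b, hb⟩ := hc.isBounded.exists_norm_le
  exact ⟨max b 0, le_max_right _ _, fun x => by
    rw [lengthFun_pt]; exact (hb x x.2).trans (le_max_left _ _)⟩

namespace PMMap

open PowerSeries

variable (F : PMMap Ω)

theorem abs_sign_le (x : ℝ) : |F.sign x| ≤ 1 := by
  unfold sign
  split_ifs <;> simp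

theorem isBddFun_comp_signedPush0 {θ : S0 Ω →ₗ[ℝ] ℝ} {b : ℝ} (hb : 0 ≤ b) (h : IsBddFun θ b) :
    IsBddFun (θ ∘ₗ F.signedPush0) b := by
  intro x
  rw [LinearMap.comp_apply, signedPush0_pt, map_smul, smul_eq_mul, abs_mul]
  have h2 : |θ (F.push0Pt x)| ≤ b := by
    unfold push0Pt
    split_ifs
    · rw [map_zero, abs_zero]; exact hb
    · exact h _
  exact (mul_le_mul (F.abs_sign_le x) h2 (abs_nonneg _) zero_le_one).trans_eq (one_mul b)

/-- Composition with ψ₀ preserves the bound of a functional, as ψ₀ sends a point to plus or minus a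
point or to 0. So there is no growth in n. -/
theorem abs_apply_signedPush0_pow_le {b : ℝ} (hb : 0 ≤ b) (n : ℕ) (v : S0 Ω) :
    ∀ {θ : S0 Ω →ₗ[ℝ] ℝ}, IsBddFun θ b →
      |θ (((F.signedPush0 : Module.End ℝ (S0 Ω)) ^ n) v)| ≤ b * norm1 v := by
  induction n with
  | zero => intro θ h; exact h.abs_le v
  | succ n ih =>
    intro θ h
    rw [pow_succ', Module.End.mul_apply]
    exact ih (F.isBddFun_comp_signedPush0 hb h)

theorem orbitSeries_signedPush0_mem {θ : S0 Ω →ₗ[ℝ] ℝ} {b : ℝ} (hb : 0 ≤ b) (h : IsBddFun θ b)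
    (v : S0 Ω) : orbitSeries F.signedPush0 θ v ∈ convDisc :=
  mem_convDisc_of_bounded (B := b * norm1 v) fun n => by
    rw [coeff_orbitSeries]; exact F.abs_apply_signedPush0_pow_le hb n v h

/-- A functional vanishing on the first N iterates sees only a geometric tail. This is the
contraction behind `IsRadius.exists_lower`. -/
theorem abs_evalAt_orbitSeries_signedPush0_le {θ : S0 Ω →ₗ[ℝ] ℝ} {b : ℝ} (hb : 0 ≤ b)
    (h : IsBddFun θ b) {v : S0 Ω} {N : ℕ}
    (hN : ∀ n < N, θ (((F.signedPush0 : Module.End ℝ (S0 Ω)) ^ n) v) = 0) {t : ℝ} (ht0 : 0 ≤ t)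
    (ht1 : t < 1) :
    |evalAt t (orbitSeries F.signedPush0 θ v)| ≤ b * norm1 v * (t ^ N / (1 - t)) := by
  have hc : ConvAt t (orbitSeries F.signedPush0 θ v) :=
    F.orbitSeries_signedPush0_mem hb h v t ht0 ht1
  have ht : ‖t‖ = t := Real.norm_of_nonneg ht0
  have hle := norm_evalAt_le (z := t) (P := orbitSeries F.signedPush0 θ v) (by rwa [ht])
  rw [ht, Real.norm_eq_abs] at hle
  refine hle.trans ?_
  rw [← hc.sum_add_tsum_nat_add N, Finset.sum_eq_zero, zero_add]
  · have hgeo := (hasSum_geometric_of_lt_one ht0 ht1).mul_left (b * norm1 v * t ^ N)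
    refine (Summable.tsum_le_tsum (fun n => ?_) ((summable_nat_add_iff N).2 hc)
      hgeo.summable).trans_eq ?_
    · rw [coeff_orbitSeries, pow_add t, mul_comm (t ^ n), ← mul_assoc]
      refine mul_le_mul_of_nonneg_right ?_ (by positivity)
      exact mul_le_mul_of_nonneg_right (F.abs_apply_signedPush0_pow_le hb _ v h) (by positivity)
    · rw [hgeo.tsum_eq, div_eq_mul_inv]; ring
  · intro n hn
    rw [coeff_orbitSeries, hN n (Finset.mem_range.1 hn), abs_zero, zero_mul]

theorem sideFun_bdd (j : F.Side) : IsBddFun (F.sideFun j) 1 := by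
  rcases j with c | c
  · exact leftStep_bdd c
  · exact rightStep_bdd c

theorem sideFun_mono (j : F.Side) {x y : Ω.carrier} (h : x ≤ y) :
    F.sideFun j (pt x) ≤ F.sideFun j (pt y) := by
  rcases j with c | c
  · exact leftStep_mono c h
  · exact rightStep_mono c h

/-- The series `∑ zⁿ θ((εF_{#1})ⁿ u)`, where `u` is the sum of all components. -/
def fundSeries (θ : S0 Ω →ₗ[ℝ] ℝ) : PowerSeries ℝ := orbitSeries F.push1Ext θ (fundamental Ω)

theorem fundSeries_eq (θ : S0 Ω →ₗ[ℝ] ℝ) :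
    F.fundSeries θ = orbitSeries F.signedPush0 θ (fundamental Ω) +
      X * ∑ j, orbitSeries F.signedPush0 θ (F.sideVal j) * F.fundSeries (F.sideFun j) :=
  orbitSeries_eq F.push1Ext_eq θ _

/-- The sum of the series attached to all sides of points of `C_F`. -/
def totalSeries : PowerSeries ℝ := ∑ j, F.fundSeries (F.sideFun j)

theorem coeff_fundSeries_nonneg {θ : S0 Ω →ₗ[ℝ] ℝ} (hθ : ∀ x y, x ≤ y → θ (pt x) ≤ θ (pt y))
    (n : ℕ) : 0 ≤ coeff n (F.fundSeries θ) := by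
  rw [fundSeries, coeff_orbitSeries]
  exact nonneg_of_mem_posCone θ hθ (F.push1Ext_pow_mem_posCone n fundamental_mem)

theorem coeff_side_nonneg (j : F.Side) (n : ℕ) : 0 ≤ coeff n (F.fundSeries (F.sideFun j)) :=
  F.coeff_fundSeries_nonneg (fun _ _ => F.sideFun_mono j) n

theorem coeff_totalSeries_nonneg (n : ℕ) : 0 ≤ coeff n F.totalSeries := by
  rw [totalSeries, map_sum]
  exact Finset.sum_nonneg fun j _ => F.coeff_side_nonneg j n

theorem coeff_side_le (j : F.Side) (n : ℕ) :
    coeff n (F.fundSeries (F.sideFun j)) ≤ coeff n F.totalSeries := by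
  rw [totalSeries, map_sum]
  exact Finset.single_le_sum (f := fun j => coeff n (F.fundSeries (F.sideFun j)))
    (fun j _ => F.coeff_side_nonneg j n) (Finset.mem_univ j)

theorem convAt_side {t : ℝ} (ht : 0 ≤ t) (h : ConvAt t F.totalSeries) (j : F.Side) :
    ConvAt t (F.fundSeries (F.sideFun j)) :=
  convAt_of_abs_le ht (fun n => by
    rw [abs_of_nonneg (F.coeff_side_nonneg j n)]
    exact (F.coeff_side_le j n).trans (le_abs_self _)) h

/-- Entries of the kneading matrix and the ψ₀-series have bounded coefficients; Cramer's rule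
expresses the product through them. -/
theorem kneadingDet_mem : F.kneadingDet ∈ convDisc ∧ F.kneadingDet * F.totalSeries ∈ convDisc ∧
    constantCoeff F.kneadingDet = 1 := by
  classical
  rw [kneadingDet_eq_det]
  have hM : ∀ i j, kneadingMatrix F.signedPush0 F.sideFun F.sideVal i j ∈ convDisc := by
    intro i j
    have hX : X ∈ convDisc := fun t _ _ => convAt_X t
    refine Subring.sub_mem _ ?_ (Subring.mul_mem _ hX
      (F.orbitSeries_signedPush0_mem zero_le_one (F.sideFun_bdd i) _))
    rw [Matrix.one_apply]
    split_ifs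
    · exact Subring.one_mem _
    · exact Subring.zero_mem _
  obtain ⟨h1, h2⟩ := det_mem_convDisc hM
  refine ⟨h1, ?_, constantCoeff_det_kneadingMatrix⟩
  rw [totalSeries, Finset.mul_sum]
  refine Subring.sum_mem _ fun i _ => ?_
  rw [fundSeries, det_kneadingMatrix_mul F.push1Ext_eq]
  exact Subring.sum_mem _ fun j _ => Subring.mul_mem _ (h2 i j)
    (F.orbitSeries_signedPush0_mem zero_le_one (F.sideFun_bdd j) _)

/-- A series that dominates all series `fundSeries θ`. -/
def dominant : PowerSeries ℝ :=
  (PowerSeries.mk fun _ => norm1 (fundamental Ω)) +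
    X * ∑ j, (PowerSeries.mk fun _ => norm1 (F.sideVal j)) * F.fundSeries (F.sideFun j)

theorem abs_coeff_fundSeries_le {θ : S0 Ω →ₗ[ℝ] ℝ} {b : ℝ} (hb : 0 ≤ b) (h : IsBddFun θ b)
    (n : ℕ) : |coeff n (F.fundSeries θ)| ≤ b * coeff n F.dominant := by
  have h0 : ∀ (v : S0 Ω) n, |coeff n (orbitSeries F.signedPush0 θ v)| ≤ b * norm1 v := fun v n => by
    rw [coeff_orbitSeries]; exact F.abs_apply_signedPush0_pow_le hb n v h
  rw [fundSeries, orbitSeries_eq F.push1Ext_eq, dominant, map_add, map_add, mul_add]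
  refine (abs_add_le _ _).trans (add_le_add ((h0 _ n).trans_eq (by rw [coeff_mk])) ?_)
  cases n with
  | zero => simp
  | succ n =>
    rw [coeff_succ_X_mul, coeff_succ_X_mul, map_sum, map_sum, Finset.mul_sum]
    refine (Finset.abs_sum_le_sum_abs _ _).trans (Finset.sum_le_sum fun j _ => ?_)
    rw [coeff_mul, coeff_mul, Finset.mul_sum]
    refine (Finset.abs_sum_le_sum_abs _ _).trans (Finset.sum_le_sum fun p _ => ?_)
    rw [abs_mul, coeff_mk, ← mul_assoc]
    refine mul_le_mul (h0 _ _) (le_of_eq (abs_of_nonneg (F.coeff_side_nonneg j _)))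
      (abs_nonneg _) (mul_nonneg hb (norm1_nonneg _))

theorem mk_const_mem (a : ℝ) : (PowerSeries.mk fun _ => a) ∈ convDisc :=
  mem_convDisc_of_bounded (B := |a|) fun n => by rw [coeff_mk]

theorem convAt_dominant {t : ℝ} (ht0 : 0 ≤ t) (ht1 : t < 1) (h : ConvAt t F.totalSeries) :
    ConvAt t F.dominant :=
  (mk_const_mem _ t ht0 ht1).add ht0 ((convAt_X t).mul ht0 (ConvAt.sum ht0 fun j _ =>
    (mk_const_mem _ t ht0 ht1).mul ht0 (F.convAt_side ht0 h j)))

theorem dominant_nonneg (n : ℕ) : 0 ≤ coeff n F.dominant := by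
  have h := F.abs_coeff_fundSeries_le (θ := 0) zero_le_one (fun x => by simp) n
  rw [one_mul] at h
  exact (abs_nonneg _).trans h

theorem convAt_fundSeries {θ : S0 Ω →ₗ[ℝ] ℝ} {b : ℝ} (hb : 0 ≤ b) (h : IsBddFun θ b) {t : ℝ}
    (ht0 : 0 ≤ t) (ht1 : t < 1) (hc : ConvAt t F.totalSeries) : ConvAt t (F.fundSeries θ) :=
  convAt_of_abs_le ht0 (F.abs_coeff_fundSeries_le hb h)
    (((F.convAt_dominant ht0 ht1 hc).mul_left b).congr fun n => by
      rw [abs_of_nonneg (F.dominant_nonneg n), mul_assoc])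

/-- The total norm of the data of the finite-rank perturbation. -/
def dataNorm : ℝ := norm1 (fundamental Ω) + ∑ j, norm1 (F.sideVal j)

/-- In `fundSeries_eq` every ψ₀-series is at most a norm times tᴺ/(1 - t), and every side series is
at most σ = S(t). The assumption σ ≥ 1 absorbs the term without a side series. -/
theorem abs_evalAt_fundSeries_le {θ : S0 Ω →ₗ[ℝ] ℝ} (h : IsBddFun θ 1) {N : ℕ}
    (hN : ∀ n < N, θ (((F.signedPush0 : Module.End ℝ (S0 Ω)) ^ n) (fundamental Ω)) = 0)
    (hN' : ∀ j, ∀ n < N, θ (((F.signedPush0 : Module.End ℝ (S0 Ω)) ^ n) (F.sideVal j)) = 0) {t : ℝ}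
    (ht0 : 0 ≤ t) (ht1 : t < 1) (hc : ConvAt t F.totalSeries) (h1 : 1 ≤ evalAt t F.totalSeries) :
    |evalAt t (F.fundSeries θ)| ≤ F.dataNorm * (t ^ N / (1 - t)) * evalAt t F.totalSeries := by
  have ht : ‖t‖ = t := Real.norm_of_nonneg ht0
  have c0 : ∀ v, ConvAt ‖t‖ (orbitSeries F.signedPush0 θ v) := fun v =>
    F.orbitSeries_signedPush0_mem zero_le_one h v _ (norm_nonneg t) (by rwa [ht])
  have cj : ∀ j, ConvAt ‖t‖ (F.fundSeries (F.sideFun j)) := fun j => by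
    rw [ht]; exact F.convAt_side ht0 hc j
  have cX : ConvAt ‖t‖ X := convAt_X _
  have cs : ConvAt ‖t‖ (∑ j, orbitSeries F.signedPush0 θ (F.sideVal j) *
      F.fundSeries (F.sideFun j)) :=
    ConvAt.sum (norm_nonneg t) fun j _ => (c0 _).mul (norm_nonneg t) (cj j)
  have e : evalAt t (F.fundSeries θ) = evalAt t (orbitSeries F.signedPush0 θ (fundamental Ω)) +
      t * ∑ j, evalAt t (orbitSeries F.signedPush0 θ (F.sideVal j)) *
        evalAt t (F.fundSeries (F.sideFun j)) := by
    rw [F.fundSeries_eq, evalAt_add (c0 _) (cX.mul (norm_nonneg t) cs), evalAt_mul cX cs, evalAt_X,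
      evalAt_sum fun j _ => (c0 _).mul (norm_nonneg t) (cj j)]
    congr 2
    exact Finset.sum_congr rfl fun j _ => evalAt_mul (c0 _) (cj j)
  have hd : 0 ≤ t ^ N / (1 - t) := div_nonneg (pow_nonneg ht0 N) (by linarith)
  have hS0 : 0 ≤ evalAt t F.totalSeries := by linarith
  have hj : ∀ j, 0 ≤ evalAt t (F.fundSeries (F.sideFun j)) ∧
      evalAt t (F.fundSeries (F.sideFun j)) ≤ evalAt t F.totalSeries := by
    intro j
    have hpos : ∀ j, 0 ≤ evalAt t (F.fundSeries (F.sideFun j)) := fun j =>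
      tsum_nonneg fun n => mul_nonneg (F.coeff_side_nonneg j n) (pow_nonneg ht0 n)
    refine ⟨hpos j, ?_⟩
    rw [totalSeries, evalAt_sum fun j _ => cj j]
    exact Finset.single_le_sum (f := fun j => evalAt t (F.fundSeries (F.sideFun j)))
      (fun j _ => hpos j) (Finset.mem_univ j)
  have b0 := F.abs_evalAt_orbitSeries_signedPush0_le zero_le_one h hN ht0 ht1
  rw [e, dataNorm, add_mul, add_mul]
  refine (abs_add_le _ _).trans (add_le_add ?_ ?_)
  · rw [one_mul] at b0
    exact b0.trans (le_mul_of_one_le_right (mul_nonneg (norm1_nonneg _) hd) h1)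
  · rw [abs_mul, abs_of_nonneg ht0, Finset.sum_mul, Finset.sum_mul]
    refine (mul_le_of_le_one_left (abs_nonneg _) ht1.le).trans
      ((Finset.abs_sum_le_sum_abs _ _).trans (Finset.sum_le_sum fun j _ => ?_))
    have bj := F.abs_evalAt_orbitSeries_signedPush0_le zero_le_one h (hN' j) ht0 ht1
    rw [one_mul] at bj
    rw [abs_mul, abs_of_nonneg (hj j).1]
    exact mul_le_mul bj (hj j).2 (hj j).1 (mul_nonneg (norm1_nonneg _) hd)

/-- The step functional of a side is, on a finite set, a step functional of each point of an
interval. -/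
theorem exists_interval_of_side {j : F.Side} (hj : ∃ v ∈ S1 Ω, F.sideFun j v ≠ 0)
    (Z : Finset Ω.carrier) : ∃ (i : Fin Ω.m) (x y : Ω.carrier),
      (x : ℝ) ∈ Icc (Ω.a i) (Ω.b i) ∧ (y : ℝ) ∈ Icc (Ω.a i) (Ω.b i) ∧ (x : ℝ) < y ∧
      ∀ t ∈ Ico (x : ℝ) y, ∀ z ∈ Z, rightStep Ω t (pt z) = F.sideFun j (pt z) := by
  classical
  let E : Set ℝ := Ω.boundary ∪ (fun z : Ω.carrier => (z : ℝ)) '' (Z : Set Ω.carrier)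
  have hE : E.Finite := ((finite_range _).union (finite_range _)).union
    (Z.finite_toSet.image _)
  have hb : Ω.boundary ⊆ E := subset_union_left
  have hZ : ∀ z ∈ Z, (z : ℝ) ∈ E := fun z hz => Or.inr ⟨z, hz, rfl⟩
  obtain ⟨v, hv, hjv⟩ := hj
  rcases j with c | c
  · obtain ⟨i, hi⟩ := mem_iUnion.1 (F.cutPt c).2
    -- At a left endpoint the left step vanishes on S₁, which `hj` excludes; so there is room to the
    -- left of c, up to the previous point of E.
    have hca : (F.cutPt c : ℝ) ≠ Ω.a i := by
      intro h
      refine hjv ?_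
      have h' : (c : ℝ) = Ω.a i := h
      have := leftStep_eq_zero_of_left i hv
      rw [← h'] at this
      exact this
    obtain ⟨x, hxE, hxa, hxc, hx⟩ := IntervalUnion.exists_pred hE hb hi hca
    have hxi : x ∈ Icc (Ω.a i) (Ω.b i) := ⟨hxa, hxc.le.trans hi.2⟩
    refine ⟨i, ⟨x, mem_iUnion.2 ⟨i, hxi⟩⟩, F.cutPt c, hxi, hi, hxc, fun t ht z hz => ?_⟩
    rw [sideFun, Sum.elim_inl, rightStep_pt, leftStep_pt]
    refine if_congr ⟨fun h => ?_, fun h => ht.2.trans_le h⟩ rfl rfl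
    by_contra! hlt
    exact (hx.subset ⟨⟨lt_of_le_of_lt ht.1 h, hlt⟩, hZ z hz⟩ : (z : ℝ) ∈ (∅ : Set ℝ))
  · obtain ⟨i, hi⟩ := mem_iUnion.1 (F.cutPt c).2
    have hcb : (F.cutPt c : ℝ) ≠ Ω.b i := by
      intro h
      refine hjv ?_
      have h' : (c : ℝ) = Ω.b i := h
      have := rightStep_eq_zero_of_right i hv
      rw [← h'] at this
      exact this
    obtain ⟨y, hyE, hyb, hcy, hy⟩ := IntervalUnion.exists_succ hE hb hi hcb
    have hyi : y ∈ Icc (Ω.a i) (Ω.b i) := ⟨hi.1.trans hcy.le, hyb⟩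
    refine ⟨i, F.cutPt c, ⟨y, mem_iUnion.2 ⟨i, hyi⟩⟩, hi, hyi, hcy, fun t ht z hz => ?_⟩
    rw [sideFun, Sum.elim_inr, rightStep_pt, rightStep_pt]
    refine if_congr ⟨fun h => lt_of_le_of_lt ht.1 h, fun h => ?_⟩ rfl rfl
    by_contra! hle
    exact (hy.subset ⟨⟨h, lt_of_le_of_lt hle ht.2⟩, hZ z hz⟩ : (z : ℝ) ∈ (∅ : Set ℝ))

end PMMap

end PMGraph
end

noncomputable section
namespace PMGraph

/-! ### Growth of the variation -/

variable {Ω : IntervalUnion}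

namespace PMMap

open PowerSeries

variable (F : PMMap Ω)

theorem evalAt_totalSeries_mono {s t : ℝ} (hs : 0 ≤ s) (hst : s ≤ t)
    (ht : ConvAt t F.totalSeries) : evalAt s F.totalSeries ≤ evalAt t F.totalSeries := by
  have h : ∀ {x : ℝ}, 0 ≤ x → ConvAt x F.totalSeries →
      Summable fun n => coeff n F.totalSeries * x ^ n := fun {x} _ hx =>
    hx.congr fun n => by rw [abs_of_nonneg (F.coeff_totalSeries_nonneg n)]
  refine Summable.tsum_le_tsum (fun n => ?_) (h hs (ht.mono hs hst)) (h (hs.trans hst) ht)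
  exact mul_le_mul_of_nonneg_left (pow_le_pow_left₀ hs hst n) (F.coeff_totalSeries_nonneg n)

/-- `r < 1` is the radius of convergence of the total series of `F`. -/
structure IsRadius (r : ℝ) : Prop where
  pos : 0 < r
  lt_one : r < 1
  conv : ∀ t, 0 ≤ t → t < r → ConvAt t F.totalSeries
  not_conv : ∀ t, r < t → ¬ ConvAt t F.totalSeries

variable {F} {r : ℝ}

/-- S(t) → ∞ as t ↑ r. Otherwise monotonicity bounds S on [0,r[, and `exists_convAt_of_bounded`
yields convergence beyond r. -/
theorem IsRadius.exists_le_evalAt (hr : F.IsRadius r) (Q : ℝ) :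
    ∃ t₀, 0 ≤ t₀ ∧ t₀ < r ∧ ∀ t, t₀ ≤ t → t < r → Q ≤ evalAt t F.totalSeries := by
  by_contra! hno
  obtain ⟨h1, h2, h3⟩ := F.kneadingDet_mem
  obtain ⟨t, ht, htc⟩ := exists_convAt_of_bounded h1 h2 h3 F.coeff_totalSeries_nonneg hr.pos
    hr.lt_one hr.conv (B := Q) fun t ht0 htr => by
      obtain ⟨s, hs, hsr, hsQ⟩ := hno t ht0 htr
      exact (F.evalAt_totalSeries_mono ht0 hs (hr.conv s (ht0.trans hs) hsr)).trans hsQ.le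
  exact hr.not_conv t ht htc

theorem continuousOn_evalAt {P : PowerSeries ℝ} {r : ℝ} (hP : ConvAt r P) :
    ContinuousOn (fun t : ℝ => evalAt t P) (Icc 0 r) := by
  refine continuousOn_tsum (fun n => by fun_prop) hP fun n t ht => ?_
  rw [norm_mul, norm_pow, Real.norm_of_nonneg ht.1]
  exact mul_le_mul_of_nonneg_left (pow_le_pow_left₀ ht.1 ht.2 n) (abs_nonneg _)

/-- The kneading determinant vanishes at the radius of convergence of the total series. -/
theorem IsRadius.evalAt_kneadingDet (hr : F.IsRadius r) : evalAt r F.kneadingDet = 0 := by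
  obtain ⟨h1, h2, -⟩ := F.kneadingDet_mem
  have hc1 := h1 r hr.pos.le hr.lt_one
  have hc2 := h2 r hr.pos.le hr.lt_one
  have hcont := continuousOn_evalAt hc1 r (right_mem_Icc.2 hr.pos.le)
  have hlim : Tendsto (fun t : ℝ => evalAt t F.kneadingDet) (𝓝[<] r)
      (𝓝 (evalAt r F.kneadingDet)) := by
    have hmem : Icc 0 r ∈ 𝓝[<] r := by
      filter_upwards [Ioo_mem_nhdsLT hr.pos] with t ht using ⟨ht.1.le, ht.2.le⟩
    exact (ContinuousWithinAt.mono_of_mem_nhdsWithin hcont hmem).tendsto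
  -- |DS| ≤ B on [0,r[ because DS converges absolutely at r < 1; dividing by S → ∞ forces D → 0.
  set B := ∑' n, |coeff n (F.kneadingDet * F.totalSeries)| * r ^ n with hB
  have hB0 : 0 ≤ B := tsum_nonneg fun n => mul_nonneg (abs_nonneg _) (pow_nonneg hr.pos.le n)
  have hev : ∀ ε > 0, ∀ᶠ t in 𝓝[<] r, |evalAt t F.kneadingDet| ≤ ε := by
    intro ε hε
    obtain ⟨t₀, ht₀, ht₀r, hQ⟩ := hr.exists_le_evalAt (B / ε + 1)
    filter_upwards [Ioo_mem_nhdsLT ht₀r] with t ht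
    have ht0 : 0 ≤ t := ht₀.trans ht.1.le
    have ht1 : t < 1 := ht.2.trans hr.lt_one
    have hn : ‖t‖ = t := Real.norm_of_nonneg ht0
    have hS := hQ t ht.1.le ht.2
    have hmul := evalAt_mul (z := t) (P := F.kneadingDet) (Q := F.totalSeries)
      (by rw [hn]; exact h1 t ht0 ht1) (by rw [hn]; exact hr.conv t ht0 ht.2)
    have hle : |evalAt t (F.kneadingDet * F.totalSeries)| ≤ B := by
      refine (norm_evalAt_le (by rw [hn]; exact h2 t ht0 ht1)).trans ?_
      rw [hn]
      refine Summable.tsum_le_tsum (fun n => ?_) (h2 t ht0 ht1) hc2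
      exact mul_le_mul_of_nonneg_left (pow_le_pow_left₀ ht0 ht.2.le n) (abs_nonneg _)
    have hS1 : 0 < evalAt t F.totalSeries := lt_of_lt_of_le (by positivity) hS
    rw [hmul, abs_mul, abs_of_pos hS1] at hle
    by_contra! hlt
    have : B < |evalAt t F.kneadingDet| * evalAt t F.totalSeries := by
      calc B = ε * (B / ε) := by field_simp
        _ < ε * (B / ε + 1) := by nlinarith
        _ ≤ _ := mul_le_mul hlt.le hS (by positivity) (abs_nonneg _)
    linarith
  have h0 : Tendsto (fun t : ℝ => evalAt t F.kneadingDet) (𝓝[<] r) (𝓝 0) := by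
    rw [Metric.tendsto_nhds]
    intro ε hε
    filter_upwards [hev (ε / 2) (by positivity)] with t ht
    rw [dist_zero_right, Real.norm_eq_abs]
    linarith
  exact tendsto_nhds_unique hlim h0

theorem fundSeries_add (θ η : S0 Ω →ₗ[ℝ] ℝ) :
    F.fundSeries (θ + η) = F.fundSeries θ + F.fundSeries η := by
  ext n
  simp [fundSeries]

theorem abs_step_sub_le (y : ℝ) (j : F.Side) : IsBddFun (rightStep Ω y - F.sideFun j) 1 := by
  intro x
  rw [LinearMap.sub_apply, rightStep_pt]
  rcases j with c | c
  · rw [sideFun, Sum.elim_inl, leftStep_pt]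
    split_ifs <;> norm_num
  · rw [sideFun, Sum.elim_inr, rightStep_pt]
    split_ifs <;> norm_num

variable (F) in
/-- The truncated resolvent applied to the sum of all components. -/
def truncated (t : ℝ) (M : ℕ) : S0 Ω :=
  ∑ n ∈ Finset.range M, t ^ n • (F.push1Ext ^ n) (fundamental Ω)

theorem truncated_mem {t : ℝ} (ht : 0 ≤ t) (M : ℕ) : F.truncated t M ∈ posCone Ω :=
  AddSubmonoid.sum_mem _ fun n _ =>
    smul_mem_posCone (pow_nonneg ht n) (F.push1Ext_pow_mem_posCone n fundamental_mem)

theorem apply_truncated (θ : S0 Ω →ₗ[ℝ] ℝ) (t : ℝ) (M : ℕ) :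
    θ (F.truncated t M) = ∑ n ∈ Finset.range M, coeff n (F.fundSeries θ) * t ^ n := by
  rw [truncated, map_sum]
  refine Finset.sum_congr rfl fun n _ => ?_
  rw [map_smul, smul_eq_mul, fundSeries, coeff_orbitSeries, mul_comm]

/-- Pigeonhole: one and the same side carries at least the average share of S(t) for parameters with
S(t) arbitrarily large. -/
theorem IsRadius.exists_side (hr : F.IsRadius r) : ∃ j : F.Side, ∀ Q : ℝ, ∃ t, 0 ≤ t ∧ t < r ∧
    Q ≤ evalAt t F.totalSeries ∧
    evalAt t F.totalSeries ≤ Fintype.card F.Side * evalAt t (F.fundSeries (F.sideFun j)) := by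
  by_contra! hno
  choose Q hQ using hno
  -- One t beats all thresholds `Q j` at once; the summand 1 makes S(t) positive even if there are
  -- no sides.
  obtain ⟨t, ht0, htr, hle⟩ := hr.exists_le_evalAt (1 + ∑ j, |Q j|)
  have hSt := hle t le_rfl htr
  have hn : ‖t‖ = t := Real.norm_of_nonneg ht0
  have hsum : evalAt t F.totalSeries = ∑ j, evalAt t (F.fundSeries (F.sideFun j)) := by
    rw [totalSeries, evalAt_sum fun j _ => ?_]
    rw [hn]; exact F.convAt_side ht0 (hr.conv t ht0 htr) j
  have hlt : ∀ j, Fintype.card F.Side * evalAt t (F.fundSeries (F.sideFun j)) <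
      evalAt t F.totalSeries := fun j => by
    refine hQ j t ht0 htr (le_trans ?_ hSt)
    have := Finset.single_le_sum (f := fun j => |Q j|) (fun j _ => abs_nonneg _)
      (Finset.mem_univ j)
    have := le_abs_self (Q j)
    linarith
  have hpos : 0 ≤ ∑ j, |Q j| := Finset.sum_nonneg fun j _ => abs_nonneg _
  rcases isEmpty_or_nonempty F.Side with he | hne
  · have h0 : evalAt t F.totalSeries = 0 := by
      rw [hsum, Finset.univ_eq_empty, Finset.sum_empty]
    linarith
  · have h1 := Finset.sum_lt_sum_of_nonempty (Finset.univ_nonempty (α := F.Side))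
      fun j _ => hlt j
    rw [← Finset.mul_sum, ← hsum, Finset.sum_const, Finset.card_univ, nsmul_eq_mul] at h1
    exact lt_irrefl _ h1

theorem dataNorm_nonneg : 0 ≤ F.dataNorm :=
  add_nonneg (norm1_nonneg _) (Finset.sum_nonneg fun _ _ => norm1_nonneg _)

/-- One truncation serves all functionals bounded by 1, because `dominant` controls all tails at
once. It is applied to all steps in an interval. -/
theorem truncated_sub_le {t : ℝ} (ht0 : 0 ≤ t) (hc : ConvAt t F.dominant) {ε : ℝ} (hε : 0 < ε) :
    ∃ M, ∀ θ : S0 Ω →ₗ[ℝ] ℝ, IsBddFun θ 1 →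
      evalAt t (F.fundSeries θ) - ε ≤ θ (F.truncated t M) := by
  have hlim := tendsto_sum_nat_add fun n => |coeff n F.dominant| * t ^ n
  obtain ⟨M, hM⟩ := (hlim.eventually_lt_const hε).exists
  refine ⟨M, fun θ hθ => ?_⟩
  have hb : ∀ n, |coeff n (F.fundSeries θ) * t ^ n| ≤ |coeff n F.dominant| * t ^ n := fun n => by
    have h := F.abs_coeff_fundSeries_le zero_le_one hθ n
    rw [one_mul] at h
    rw [abs_mul, abs_of_nonneg (pow_nonneg ht0 n)]
    exact mul_le_mul_of_nonneg_right (h.trans (le_abs_self _)) (pow_nonneg ht0 n)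
  have hs : Summable fun n => coeff n (F.fundSeries θ) * t ^ n := Summable.of_norm_bounded hc hb
  have hs' := (summable_nat_add_iff M).2 hs
  have hc' := (summable_nat_add_iff M).2 hc
  rw [evalAt_real, ← hs.sum_add_tsum_nat_add M, ← apply_truncated]
  have : ∑' n, coeff (n + M) (F.fundSeries θ) * t ^ (n + M) ≤
      ∑' n, |coeff (n + M) F.dominant| * t ^ (n + M) :=
    Summable.tsum_le_tsum (fun n => (le_abs_self _).trans (hb _)) hs' hc'
  linarith

/-- Some side has series at least σ/m, with m the number of sides. Steps at points of a fixed
interval next to that cut point agree with its functional on the first N iterates of ψ₀, so their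
series differ from it by O(rᴺ)σ. Hence the truncated chain covers that interval with multiplicity
proportional to σ. -/
theorem IsRadius.exists_lower (hr : F.IsRadius r) : ∃ κ > 0, ∀ Q : ℝ, ∃ t, 0 ≤ t ∧ t < r ∧
    Q ≤ evalAt t F.totalSeries ∧
    ∃ M, κ * evalAt t F.totalSeries ≤ lengthFun Ω (F.truncated t M) := by
  classical
  obtain ⟨j, hj⟩ := hr.exists_side
  have hcard : (0 : ℝ) < Fintype.card F.Side := by
    have : 0 < Fintype.card F.Side := Fintype.card_pos_iff.2 ⟨j⟩
    exact_mod_cast this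
  set m : ℝ := ((Fintype.card F.Side : ℕ) : ℝ) with hm
  have hj1 : ∃ v ∈ S1 Ω, F.sideFun j v ≠ 0 := by
    by_contra! hno
    obtain ⟨t, ht0, htr, h1, h2⟩ := hj 1
    have : evalAt t (F.fundSeries (F.sideFun j)) = 0 := by
      have h0 : F.fundSeries (F.sideFun j) = 0 := by
        ext n
        rw [fundSeries, coeff_orbitSeries, map_zero]
        exact hno _ (posCone_le_S1 (F.push1Ext_pow_mem_posCone n fundamental_mem))
      rw [h0, evalAt_real]; simp
    rw [this] at h2
    linarith
  have hr1 : 0 < 1 - r := by linarith [hr.lt_one]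
  obtain ⟨N, hN⟩ : ∃ N : ℕ, F.dataNorm * (r ^ N / (1 - r)) ≤ 1 / (2 * m) := by
    have hd : 0 < F.dataNorm + 1 := by linarith [dataNorm_nonneg (F := F)]
    obtain ⟨N, hN⟩ := exists_pow_lt_of_lt_one
      (show 0 < 1 / (2 * m) * (1 - r) / (F.dataNorm + 1) by positivity) hr.lt_one
    refine ⟨N, ?_⟩
    rw [lt_div_iff₀ hd] at hN
    rw [← mul_div_assoc, div_le_iff₀ hr1]
    have := pow_nonneg hr.pos.le N
    nlinarith
  let Z : Finset Ω.carrier := (Finset.range N).biUnion fun n =>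
    (((F.signedPush0 : Module.End ℝ (S0 Ω)) ^ n) (fundamental Ω)).support ∪
      Finset.univ.biUnion fun j =>
        (((F.signedPush0 : Module.End ℝ (S0 Ω)) ^ n) (F.sideVal j)).support
  -- `N` and `Z` do not depend on t, hence neither does the interval. The constant is what remains
  -- of 1/m after losing 1/(2m) to the change of functional and 1/(4m) to truncation.
  obtain ⟨i, x, y, hxi, hyi, hxy, hZ⟩ := F.exists_interval_of_side hj1 Z
  refine ⟨1 / (4 * m) * (y - x), mul_pos (by positivity) (sub_pos.2 hxy), fun Q => ?_⟩
  obtain ⟨t, ht0, htr, hQ, hside⟩ := hj (max Q 1)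
  have h1 : 1 ≤ evalAt t F.totalSeries := (le_max_right _ _).trans hQ
  refine ⟨t, ht0, htr, (le_max_left _ _).trans hQ, ?_⟩
  set σ := evalAt t F.totalSeries with hσ
  have ht1 : t < 1 := htr.trans hr.lt_one
  have hn : ‖t‖ = t := Real.norm_of_nonneg ht0
  have hc := hr.conv t ht0 htr
  have hW : ∀ s ∈ Ico (x : ℝ) y, 1 / (2 * m) * σ ≤ evalAt t (F.fundSeries (rightStep Ω s)) := by
    intro s hs
    have hbdd := F.abs_step_sub_le s j
    have hvan : ∀ v : S0 Ω, v.support ⊆ Z → (rightStep Ω s - F.sideFun j) v = 0 := fun v hv =>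
      eq_zero_of_forall_mem_support fun z hz => by
        rw [LinearMap.sub_apply, hZ s hs z (hv hz), sub_self]
    have hle := F.abs_evalAt_fundSeries_le hbdd (N := N)
      (fun n hn => hvan _ fun z hz => Finset.mem_biUnion.2
        ⟨n, Finset.mem_range.2 hn, Finset.mem_union_left _ hz⟩)
      (fun k n hn => hvan _ fun z hz => Finset.mem_biUnion.2
        ⟨n, Finset.mem_range.2 hn, Finset.mem_union_right _
          (Finset.mem_biUnion.2 ⟨k, Finset.mem_univ k, hz⟩)⟩) ht0 ht1 hc h1
    have e : F.fundSeries (rightStep Ω s) =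
        F.fundSeries (rightStep Ω s - F.sideFun j) + F.fundSeries (F.sideFun j) := by
      rw [← fundSeries_add, sub_add_cancel]
    rw [e, evalAt_add (by rw [hn]; exact F.convAt_fundSeries zero_le_one hbdd ht0 ht1 hc)
      (by rw [hn]; exact F.convAt_side ht0 hc j)]
    have hpow : t ^ N / (1 - t) ≤ r ^ N / (1 - r) :=
      div_le_div₀ (pow_nonneg hr.pos.le N) (pow_le_pow_left₀ ht0 htr.le N) hr1 (by linarith)
    have h2 : F.dataNorm * (t ^ N / (1 - t)) * σ ≤ 1 / (2 * m) * σ :=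
      mul_le_mul_of_nonneg_right ((mul_le_mul_of_nonneg_left hpow dataNorm_nonneg).trans hN)
        (by linarith)
    have h3 : 1 / m * σ ≤ evalAt t (F.fundSeries (F.sideFun j)) := by
      rw [one_div, inv_mul_le_iff₀ hcard]; exact hside
    have h4 : 1 / m * σ = 1 / (2 * m) * σ + 1 / (2 * m) * σ := by field_simp; ring
    have h5 := (abs_le.1 (hle.trans h2)).1
    linarith
  have hσ0 : 0 < 1 / (4 * m) * σ := mul_pos (by positivity) (by linarith)
  obtain ⟨M, hM⟩ := F.truncated_sub_le ht0 (F.convAt_dominant ht0 ht1 hc) hσ0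
  refine ⟨M, ?_⟩
  have hmem : F.truncated t M - (1 / (4 * m) * σ) • (pt y - pt x) ∈ posCone Ω := by
    have hv := truncated_mem (F := F) ht0 M
    refine mem_posCone_of_rightStep_nonneg (Submodule.sub_mem _ (posCone_le_S1 hv)
      (Submodule.smul_mem _ _ (pt_sub_mem_S1 hxi hyi))) fun s _ => ?_
    have hpos : 0 ≤ rightStep Ω s (F.truncated t M) :=
      nonneg_of_mem_posCone _ (fun _ _ => rightStep_mono s) hv
    rw [map_sub, map_smul, map_sub, rightStep_pt, rightStep_pt, smul_eq_mul]
    by_cases hsy : s < (y : ℝ)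
    · by_cases hsx : s < (x : ℝ)
      · rw [if_pos hsy, if_pos hsx, sub_self, mul_zero, sub_zero]; exact hpos
      · rw [if_pos hsy, if_neg hsx, sub_zero, mul_one]
        have h2 := hM _ (rightStep_bdd s)
        have h3 := hW s ⟨not_lt.1 hsx, hsy⟩
        have h4 : 1 / (2 * m) * σ = 1 / (4 * m) * σ + 1 / (4 * m) * σ := by field_simp; ring
        linarith
    · rw [if_neg hsy, if_neg fun h => hsy (h.trans hxy), sub_self, mul_zero, sub_zero]
      exact hpos
  have hlen := nonneg_of_mem_posCone (lengthFun Ω) (fun a b hab => by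
    rw [lengthFun_pt, lengthFun_pt]; exact hab) hmem
  rw [map_sub, map_smul, map_sub, lengthFun_pt, lengthFun_pt, smul_eq_mul] at hlen
  linarith

variable (F) in
/-- The length of the chain `(εF_{#1})ⁿ u`; for `n ≥ 1` it is the variation of `Fⁿ`. -/
def chainLength (n : ℕ) : ℝ := lengthFun Ω ((F.push1Ext ^ n) (fundamental Ω))

theorem lengthFun_nonneg {v : S0 Ω} (hv : v ∈ posCone Ω) : 0 ≤ lengthFun Ω v :=
  nonneg_of_mem_posCone (lengthFun Ω) (fun a b hab => by
    rw [lengthFun_pt, lengthFun_pt]; exact hab) hv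

theorem chainLength_nonneg (n : ℕ) : 0 ≤ F.chainLength n :=
  lengthFun_nonneg (F.push1Ext_pow_mem_posCone n fundamental_mem)

/-- The case N = 0 of `abs_evalAt_fundSeries_le` bounds every step functional by Bσ, and u has step
value 1 everywhere except at right endpoints, where all of S₁ has value 0. -/
theorem IsRadius.truncated_le (hr : F.IsRadius r) {t : ℝ} (ht0 : 0 ≤ t) (htr : t < r)
    (h1 : 1 ≤ evalAt t F.totalSeries) (M : ℕ) :
    (F.dataNorm * (1 / (1 - r)) * evalAt t F.totalSeries) • fundamental Ω - F.truncated t M ∈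
      posCone Ω := by
  have ht1 : t < 1 := htr.trans hr.lt_one
  have hr1 : 0 < 1 - r := by linarith [hr.lt_one]
  have hc := hr.conv t ht0 htr
  have hn : ‖t‖ = t := Real.norm_of_nonneg ht0
  have hS1 : (F.dataNorm * (1 / (1 - r)) * evalAt t F.totalSeries) • fundamental Ω -
      F.truncated t M ∈ S1 Ω :=
    Submodule.sub_mem _ (Submodule.smul_mem _ _ (posCone_le_S1 fundamental_mem))
      (posCone_le_S1 (truncated_mem ht0 M))
  refine mem_posCone_of_rightStep_nonneg hS1 fun s hs => ?_
  obtain ⟨i, hi⟩ := mem_iUnion.1 hs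
  rcases hi.2.eq_or_lt with h | h
  · rw [h, rightStep_eq_zero_of_right i hS1]
  · rw [map_sub, map_smul, rightStep_fundamental ⟨hi.1, h⟩, smul_eq_mul, mul_one, sub_nonneg,
      apply_truncated]
    have hbdd := rightStep_bdd (Ω := Ω) s
    have hle := F.abs_evalAt_fundSeries_le hbdd (N := 0) (fun n hn => absurd hn (Nat.not_lt_zero n))
      (fun _ n hn => absurd hn (Nat.not_lt_zero n)) ht0 ht1 hc h1
    have hcs : ConvAt ‖t‖ (F.fundSeries (rightStep Ω s)) := by
      rw [hn]; exact F.convAt_fundSeries zero_le_one hbdd ht0 ht1 hc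
    have hsum : ∑ n ∈ Finset.range M, coeff n (F.fundSeries (rightStep Ω s)) * t ^ n ≤
        evalAt t (F.fundSeries (rightStep Ω s)) :=
      Summable.sum_le_tsum (f := fun n => coeff n (F.fundSeries (rightStep Ω s)) * t ^ n) _
        (fun n _ => mul_nonneg (F.coeff_fundSeries_nonneg (fun _ _ => rightStep_mono s) n)
          (pow_nonneg ht0 n)) hcs.hasSum.summable
    refine hsum.trans ((le_abs_self _).trans (hle.trans ?_))
    refine mul_le_mul_of_nonneg_right (mul_le_mul_of_nonneg_left ?_ dataNorm_nonneg)
      (by linarith)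
    rw [pow_zero]
    exact one_div_le_one_div_of_le hr1 (by linarith)

/-- The variation grows at least like `r⁻ⁿ`. -/
theorem IsRadius.le_chainLength (hr : F.IsRadius r) : ∃ c > 0, ∀ n, c ≤ F.chainLength n * r ^ n := by
  obtain ⟨κ, hκ, hlow⟩ := hr.exists_lower
  have hr1 : 0 < 1 - r := by linarith [hr.lt_one]
  set B := F.dataNorm * (1 / (1 - r)) with hB
  have hB0 : 0 ≤ B := mul_nonneg dataNorm_nonneg (by positivity)
  -- Adding 1 avoids a separate proof that B is nonzero.
  refine ⟨κ / (B + 1), by positivity, fun m => ?_⟩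
  have hL := chainLength_nonneg (F := F) m
  suffices h : κ ≤ B * (F.chainLength m * r ^ m) by
    rw [div_le_iff₀ (by positivity)]
    have : 0 ≤ F.chainLength m * r ^ m := mul_nonneg hL (pow_nonneg hr.pos.le m)
    linarith
  -- The first m terms of the length series are bounded by the fixed number A, which is at most εσ
  -- once σ is large.
  refine le_of_forall_pos_le_add fun ε hε => ?_
  set A := ∑ k ∈ Finset.range m, F.chainLength k with hA
  have hA0 : 0 ≤ A := Finset.sum_nonneg fun k _ => chainLength_nonneg k
  obtain ⟨t, ht0, htr, hQ, M, hM⟩ := hlow (max 1 (A / ε))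
  set σ := evalAt t F.totalSeries with hσ
  have h1 : 1 ≤ σ := (le_max_left _ _).trans hQ
  have hAσ : A ≤ ε * σ := by
    have := (le_max_right _ _).trans hQ
    rwa [div_le_iff₀ hε, mul_comm] at this
  have ht1 : t < 1 := htr.trans hr.lt_one
  -- Applying ψ₁ᵐ to Bσu - v shifts the length series of v by m and bounds it by BσL(m).
  have hcone := F.push1Ext_pow_mem_posCone m (hr.truncated_le ht0 htr h1 M)
  have hlen := lengthFun_nonneg hcone
  have hmap : lengthFun Ω ((F.push1Ext ^ m) (F.truncated t M)) =
      ∑ n ∈ Finset.range M, F.chainLength (m + n) * t ^ n := by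
    rw [truncated, map_sum, map_sum]
    refine Finset.sum_congr rfl fun n _ => ?_
    rw [map_smul, map_smul, ← Module.End.mul_apply, ← pow_add, smul_eq_mul, mul_comm]
    rfl
  rw [map_sub, map_sub, map_smul, map_smul, hmap, smul_eq_mul, sub_nonneg] at hlen
  have htr' : lengthFun Ω (F.truncated t M) ≤
      A + t ^ m * ∑ n ∈ Finset.range M, F.chainLength (m + n) * t ^ n := by
    have e1 : lengthFun Ω (F.truncated t M) =
        ∑ n ∈ Finset.range M, F.chainLength n * t ^ n := by
      rw [apply_truncated]
      refine Finset.sum_congr rfl fun n _ => ?_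
      rw [fundSeries, coeff_orbitSeries]; rfl
    have e2 : ∑ n ∈ Finset.range M, F.chainLength n * t ^ n ≤
        ∑ n ∈ Finset.range (m + M), F.chainLength n * t ^ n :=
      Finset.sum_le_sum_of_subset_of_nonneg (Finset.range_subset_range.2 (Nat.le_add_left M m))
        fun n _ _ => mul_nonneg (chainLength_nonneg n) (pow_nonneg ht0 n)
    rw [e1]
    refine e2.trans ?_
    rw [Finset.sum_range_add, Finset.mul_sum]
    refine add_le_add (Finset.sum_le_sum fun k _ => ?_) (le_of_eq (Finset.sum_congr rfl fun n _ => ?_))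
    · exact mul_le_of_le_one_right (chainLength_nonneg k) (pow_le_one₀ ht0 ht1.le)
    · rw [pow_add]; ring
  have hfin : κ * σ ≤ (B * (F.chainLength m * r ^ m) + ε) * σ := by
    have hp : t ^ m ≤ r ^ m := pow_le_pow_left₀ ht0 htr.le m
    have h3 : t ^ m * ∑ n ∈ Finset.range M, F.chainLength (m + n) * t ^ n ≤
        r ^ m * (B * σ * F.chainLength m) :=
      mul_le_mul hp hlen (Finset.sum_nonneg fun n _ =>
        mul_nonneg (chainLength_nonneg _) (pow_nonneg ht0 n)) (pow_nonneg hr.pos.le m)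
    calc κ * σ ≤ A + t ^ m * ∑ n ∈ Finset.range M, F.chainLength (m + n) * t ^ n := hM.trans htr'
      _ ≤ ε * σ + r ^ m * (B * σ * F.chainLength m) := add_le_add hAσ h3
      _ = _ := by ring
  exact le_of_mul_le_mul_right hfin (by linarith)

/-- The length functional is bounded, so its series converges below r and has bounded terms. -/
theorem IsRadius.chainLength_le (hr : F.IsRadius r) {t : ℝ} (ht0 : 0 < t) (htr : t < r) :
    ∃ C > 0, ∀ n, F.chainLength n * t ^ n ≤ C := by
  obtain ⟨b, hb0, hb⟩ := lengthFun_bdd (Ω := Ω)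
  have hc := F.convAt_fundSeries hb0 hb ht0.le (htr.trans hr.lt_one) (hr.conv t ht0.le htr)
  refine ⟨(∑' n, |coeff n (F.fundSeries (lengthFun Ω))| * t ^ n) + 1, ?_, fun n => ?_⟩
  · have : 0 ≤ ∑' n, |coeff n (F.fundSeries (lengthFun Ω))| * t ^ n :=
      tsum_nonneg fun n => mul_nonneg (abs_nonneg _) (pow_nonneg ht0.le n)
    linarith
  · have h := hc.le_tsum n fun k _ => mul_nonneg (abs_nonneg _) (pow_nonneg ht0.le k)
    have e : coeff n (F.fundSeries (lengthFun Ω)) = F.chainLength n := by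
      rw [fundSeries, coeff_orbitSeries]; rfl
    rw [e, abs_of_nonneg (chainLength_nonneg n)] at h
    linarith

/-- The growth rate of the variation. -/
theorem IsRadius.tendsto_variation (hr : F.IsRadius r) :
    Tendsto (fun n : ℕ => F.variation n ^ (-(1 / (n : ℝ)))) atTop (𝓝 r) := by
  obtain ⟨c, hc, hlow⟩ := hr.le_chainLength
  have hpos : ∀ n, 0 < F.chainLength n := fun n => by
    have h := hc.trans_le (hlow n)
    exact pos_of_mul_pos_left h (pow_nonneg hr.pos.le n)
  have hlog : Tendsto (fun n : ℕ => Real.log (F.chainLength n) / n) atTop (𝓝 (-Real.log r)) := by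
    have hdiv : ∀ a b : ℝ, Tendsto (fun n : ℕ => a / (n : ℝ) - b) atTop (𝓝 (-b)) := fun a b => by
      simpa using (tendsto_const_div_atTop_nhds_zero_nat a).sub_const b
    rw [tendsto_order]
    constructor
    · intro b hb
      filter_upwards [(hdiv (Real.log c) (Real.log r)).eventually_const_lt hb,
        eventually_gt_atTop 0] with n hn hn0
      have hn' : (0 : ℝ) < n := by exact_mod_cast hn0
      refine hn.trans_le ?_
      have h := Real.log_le_log hc (hlow n)
      rw [Real.log_mul (hpos n).ne' (pow_pos hr.pos n).ne', Real.log_pow] at h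
      rw [le_div_iff₀ hn', sub_mul, div_mul_cancel₀ _ hn'.ne']
      linarith
    · intro b hb
      -- With -log r < s < b, the upper bound is applied at the radius e⁻ˢ < r.
      obtain ⟨s, hs1, hs2⟩ := exists_between hb
      have hsr : Real.exp (-s) < r := by
        rw [← Real.lt_log_iff_exp_lt hr.pos]; linarith
      obtain ⟨C, hC, hup⟩ := hr.chainLength_le (Real.exp_pos (-s)) hsr
      have hlim := hdiv (Real.log C) (-s)
      rw [neg_neg] at hlim
      filter_upwards [hlim.eventually_lt_const hs2, eventually_gt_atTop 0] with n hn hn0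
      have hn' : (0 : ℝ) < n := by exact_mod_cast hn0
      refine lt_of_le_of_lt ?_ hn
      have h := Real.log_le_log (mul_pos (hpos n) (pow_pos (Real.exp_pos _) n)) (hup n)
      rw [Real.log_mul (hpos n).ne' (pow_pos (Real.exp_pos _) n).ne', Real.log_pow,
        Real.log_exp] at h
      rw [div_le_iff₀ hn', sub_mul, div_mul_cancel₀ _ hn'.ne']
      linarith
  have hexp := (Real.continuous_exp.tendsto _).comp hlog.neg
  rw [neg_neg, Real.exp_log hr.pos] at hexp
  refine hexp.congr' ?_
  filter_upwards [eventually_gt_atTop 0] with n hn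
  have hv : F.variation n = F.chainLength n := F.variation_eq hn
  rw [hv, Real.rpow_def_of_pos (hpos n), Function.comp_apply]
  congr 1
  ring

end PMMap

end PMGraph
end

noncomputable section
namespace PMGraph

/-! ### Entropy and the radius of convergence -/

variable {Ω : IntervalUnion}

namespace IntervalUnion

theorem exists_representatives {A : Set ℝ} (hA : A.Finite) (hb : Ω.boundary ⊆ A) :
    ∃ B : Set ℝ, B.Finite ∧ B.ncard ≤ 2 * A.ncard ∧ ∀ x ∈ Ω.carrier, ∃ y ∈ B, y ∈ Ω.carrier ∧
      (x = y ∨ ∃ I ∈ Ω.gaps A, x ∈ Ioo I.1 I.2 ∧ y ∈ Ioo I.1 I.2) := by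
  have hG := gaps_finite (Ω := Ω) hA
  refine ⟨A ∪ (fun I : ℝ × ℝ => (I.1 + I.2) / 2) '' Ω.gaps A, hA.union (hG.image _), ?_, ?_⟩
  · refine (ncard_union_le _ _).trans ?_
    rw [two_mul]
    refine Nat.add_le_add_left ((ncard_image_le hG).trans ?_) _
    exact ncard_le_ncard_of_injOn Prod.fst (fun I hI => gaps_fst_mem hI) gaps_injOn_fst hA
  · intro x hx
    by_cases hxA : x ∈ A
    · exact ⟨x, Or.inl hxA, hx, Or.inl rfl⟩
    · obtain ⟨I, hI, hxI⟩ := exists_gap hA hb hx hxA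
      have h : (I.1 + I.2) / 2 ∈ Ioo I.1 I.2 := ⟨by linarith [hI.1], by linarith [hI.1]⟩
      exact ⟨_, Or.inr ⟨I, hI, rfl⟩, hI.2.1 (Ioo_subset_Icc_self h), Or.inr ⟨I, hI, hxI, h⟩⟩

theorem exists_bound (Ω : IntervalUnion) : ∃ R, Ω.carrier ⊆ Icc (-R) R := by
  have hc : IsCompact Ω.carrier := isCompact_iUnion fun _ => isCompact_Icc
  obtain ⟨R, hR⟩ := hc.isBounded.subset_closedBall 0
  exact ⟨R, by simpa [Real.closedBall_eq_Icc] using hR⟩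

end IntervalUnion

/-- Multiples of δ. An interval in the range that misses them is shorter than δ. -/
theorem exists_finite_net (R : ℝ) {δ : ℝ} (hδ : 0 < δ) : ∃ E : Set ℝ, E.Finite ∧
    ∀ u v, -R ≤ u → v ≤ R → δ ≤ v - u → ∃ e ∈ E, e ∈ Icc u v := by
  refine ⟨(fun j : ℤ => j * δ) '' Icc ⌊-R / δ⌋ ⌈R / δ⌉, (finite_Icc _ _).image _,
    fun u v hu hv huv => ?_⟩
  have h1 : (⌊v / δ⌋ : ℝ) * δ ≤ v := (le_div_iff₀ hδ).1 (Int.floor_le _)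
  have h2 : u ≤ ⌊v / δ⌋ * δ := by
    have := (div_lt_iff₀ hδ).1 (Int.lt_floor_add_one (v / δ))
    linarith
  refine ⟨_, ⟨⌊v / δ⌋, ⟨?_, ?_⟩, rfl⟩, h2, h1⟩
  · exact Int.floor_mono (div_le_div_of_nonneg_right (by linarith) hδ.le)
  · exact (Int.floor_le_ceil _).trans (Int.ceil_mono (div_le_div_of_nonneg_right hv hδ.le))

namespace PMMap

open PowerSeries

variable (F : PMMap Ω)

theorem iterate_mem {n : ℕ} {x : ℝ} (hx : x ∈ Ω.carrier) (hn : x ∉ F.cutIter n) :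
    F.toFun^[n] x ∈ Ω.carrier := by
  induction n with
  | zero => exact hx
  | succ n ih =>
    rw [Function.iterate_succ_apply']
    refine F.mapsTo ⟨ih fun h => hn (F.cutIter_mono (Nat.le_succ n) h), fun h => hn ?_⟩
    exact ⟨hx, n, Nat.lt_succ_self n, h⟩

/-- The points whose orbit enters `E` before time `n`, while it is defined. -/
def hits (E : Set ℝ) (n : ℕ) : Set ℝ := ⋃ k ∈ Finset.range n, ⋃ e ∈ E, F.preimages k e

theorem mem_hits {E : Set ℝ} {n : ℕ} {x : ℝ} :
    x ∈ F.hits E n ↔ x ∈ Ω.carrier ∧ ∃ k < n, x ∉ F.cutIter k ∧ F.toFun^[k] x ∈ E := by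
  simp only [hits, mem_iUnion, Finset.mem_range, preimages, mem_ofPred_eq, exists_prop]
  constructor
  · rintro ⟨k, hk, e, he, hx, hxk, rfl⟩
    exact ⟨hx, k, hk, hxk, he⟩
  · rintro ⟨hx, k, hk, hxk, he⟩
    exact ⟨k, hk, _, he, hx, hxk, rfl⟩

theorem cutIter_subset_hits {E : Set ℝ} (hE : F.C ⊆ E) (n : ℕ) : F.cutIter n ⊆ F.hits E n := by
  classical
  rintro x ⟨hx, h⟩
  obtain ⟨hk, hkC⟩ := Nat.find_spec h
  -- At the first time the orbit meets C_F the iterate is still defined.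
  refine F.mem_hits.2 ⟨hx, Nat.find h, hk, ?_, hE hkC⟩
  rintro ⟨-, l, hl, hlC⟩
  exact Nat.find_min h hl ⟨hl.trans hk, hlC⟩

theorem preimages_finite (n : ℕ) (t : ℝ) : (F.preimages n t).Finite := by
  rcases Nat.eq_zero_or_pos n with rfl | hn
  · exact F.preimages_zero_finite t
  · exact (F.ncard_preimages_le hn (F.cutIter_finite n) t).1

theorem ncard_preimages_le_dominant (n : ℕ) (t : ℝ) :
    ((F.preimages n t).ncard : ℝ) ≤ |coeff n F.dominant| + 1 := by
  rcases Nat.eq_zero_or_pos n with rfl | hn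
  · have h : (F.preimages 0 t).ncard ≤ 1 := by
      rw [← ncard_singleton t]
      exact ncard_le_ncard (fun _ hx => hx.2.2) (finite_singleton t)
    have h' : ((F.preimages 0 t).ncard : ℝ) ≤ 1 := by exact_mod_cast h
    linarith [abs_nonneg (coeff 0 F.dominant)]
  · have h1 := (F.ncard_preimages_le hn (F.cutIter_finite n) t).2
    have h2 := F.abs_coeff_fundSeries_le zero_le_one (rightStep_bdd (Ω := Ω) t) n
    rw [fundSeries, coeff_orbitSeries, one_mul] at h2
    linarith [le_abs_self (coeff n F.dominant),
      le_abs_self (rightStep Ω t ((F.push1Ext ^ n) (fundamental Ω)))]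

theorem hits_finite {E : Set ℝ} (hE : E.Finite) (n : ℕ) : (F.hits E n).Finite :=
  (Finset.finite_toSet _).biUnion fun k _ => hE.biUnion fun e _ => F.preimages_finite k e

/-- Partial sums satisfy ∑_{k<n} aₖ ≤ t⁻ⁿ ∑ aₖtᵏ for aₖ ≥ 0 and 0 < t < 1. -/
theorem ncard_hits_le {E : Set ℝ} (hE : E.Finite) {t : ℝ} (ht0 : 0 < t) (ht1 : t < 1)
    (hc : ConvAt t F.totalSeries) :
    ∃ K : ℝ, 0 ≤ K ∧ ∀ n, ((F.hits E n).ncard : ℝ) ≤ K * t⁻¹ ^ n := by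
  have hs : Summable fun n => (|coeff n F.dominant| + 1) * t ^ n := by
    have h := Summable.add (F.convAt_dominant ht0.le ht1 hc) (summable_geometric_of_lt_one ht0.le ht1)
    exact h.congr fun n => by ring
  have hpos : ∀ n, 0 ≤ (|coeff n F.dominant| + 1) * t ^ n := fun n => by positivity
  refine ⟨E.ncard * ∑' n, (|coeff n F.dominant| + 1) * t ^ n,
    mul_nonneg (Nat.cast_nonneg _) (tsum_nonneg hpos), fun n => ?_⟩
  have h1 : (F.hits E n).ncard ≤
      ∑ k ∈ Finset.range n, ∑ e ∈ hE.toFinset, (F.preimages k e).ncard := by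
    have : F.hits E n = ⋃ k ∈ Finset.range n, ⋃ e ∈ hE.toFinset, F.preimages k e := by
      simp only [hits, hE.mem_toFinset]
    rw [this]
    exact (Finset.set_ncard_biUnion_le _ _).trans
      (Finset.sum_le_sum fun k _ => Finset.set_ncard_biUnion_le _ _)
  have h2 : ((F.hits E n).ncard : ℝ) ≤
      ∑ k ∈ Finset.range n, E.ncard * (|coeff k F.dominant| + 1) := by
    have h1' : ((F.hits E n).ncard : ℝ) ≤
        ∑ k ∈ Finset.range n, ∑ e ∈ hE.toFinset, ((F.preimages k e).ncard : ℝ) := by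
      exact_mod_cast h1
    refine h1'.trans (Finset.sum_le_sum fun k _ => ?_)
    refine (Finset.sum_le_sum fun e _ => F.ncard_preimages_le_dominant k e).trans_eq ?_
    rw [Finset.sum_const, nsmul_eq_mul, ncard_eq_toFinset_card _ hE]
  refine h2.trans ?_
  rw [← Finset.mul_sum, mul_assoc]
  refine mul_le_mul_of_nonneg_left ?_ (Nat.cast_nonneg _)
  have hinv : 1 ≤ t⁻¹ := (one_le_inv₀ ht0).2 ht1.le
  calc ∑ k ∈ Finset.range n, (|coeff k F.dominant| + 1)
      ≤ ∑ k ∈ Finset.range n, (|coeff k F.dominant| + 1) * t ^ k * t⁻¹ ^ n := by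
        refine Finset.sum_le_sum fun k hk => ?_
        rw [mul_assoc]
        refine le_mul_of_one_le_right (by positivity) ?_
        have hk' := pow_le_pow_right₀ hinv (Finset.mem_range.1 hk).le
        calc (1 : ℝ) = t ^ k * t⁻¹ ^ k := by rw [← mul_pow, mul_inv_cancel₀ ht0.ne', one_pow]
          _ ≤ t ^ k * t⁻¹ ^ n := mul_le_mul_of_nonneg_left hk' (by positivity)
    _ = (∑ k ∈ Finset.range n, (|coeff k F.dominant| + 1) * t ^ k) * t⁻¹ ^ n := by
        rw [Finset.sum_mul]
    _ ≤ _ := mul_le_mul_of_nonneg_right (hs.sum_le_tsum _ fun k _ => hpos k) (by positivity)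

/-- The image of a gap under Fᵏ is an interval without points of E, for such a point would be a hit
inside the gap; the net then limits its length. -/
theorem abs_iterate_sub_lt {R δ : ℝ} (hR : Ω.carrier ⊆ Icc (-R) R) {E : Set ℝ} (hC : F.C ⊆ E)
    (hE : ∀ u v, -R ≤ u → v ≤ R → δ ≤ v - u → ∃ e ∈ E, e ∈ Icc u v) {n k : ℕ} (hk : k < n)
    {I : ℝ × ℝ} (hI : I ∈ Ω.gaps (F.hits E n)) {x y : ℝ} (hx : x ∈ Ioo I.1 I.2)
    (hy : y ∈ Ioo I.1 I.2) : |F.toFun^[k] x - F.toFun^[k] y| < δ := by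
  have hcut : Ioo I.1 I.2 ⊆ Ω.carrier \ F.cutIter k := fun t ht =>
    ⟨(IntervalUnion.gaps_Ioo hI ht).1, fun h => (IntervalUnion.gaps_Ioo hI ht).2
      (F.cutIter_subset_hits hC n (F.cutIter_mono hk.le h))⟩
  obtain ⟨p, q, hL⟩ := F.exists_isLap (x := ⟨I.1, hI.2.1 (left_mem_Icc.2 hI.1.le)⟩)
    (y := ⟨I.2, hI.2.1 (right_mem_Icc.2 hI.1.le)⟩) hI.1 k hcut (IntervalUnion.gaps_component hI)
  have hpre : OrdConnected (F.toFun^[k] '' Ioo I.1 I.2) :=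
    (isPreconnected_Ioo.image _ hL.cont).ordConnected
  have key : ∀ s ∈ Ioo I.1 I.2, ∀ t ∈ Ioo I.1 I.2, F.toFun^[k] t - F.toFun^[k] s < δ := by
    intro s hs t ht
    by_contra! hst
    obtain ⟨e, heE, he⟩ := hE _ _ (hR (F.iterate_mem (hcut hs).1 (hcut hs).2)).1
      (hR (F.iterate_mem (hcut ht).1 (hcut ht).2)).2 hst
    obtain ⟨w, hw, rfl⟩ := hpre.out ⟨s, hs, rfl⟩ ⟨t, ht, rfl⟩ he
    exact (IntervalUnion.gaps_Ioo hI hw).2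
      (F.mem_hits.2 ⟨(hcut hw).1, k, hk, (hcut hw).2, heE⟩)
  exact abs_sub_lt_iff.2 ⟨key y hy x hx, key x hx y hy⟩

end PMMap

/-- The dynamical covering numbers of an induced map are bounded by numbers of preimages. -/
theorem exists_isDynCoverOf {G : Type*} [UniformSpace G] {f : G → G} {F : PMMap Ω}
    (hF : InducedBy f F) {U : SetRel G G} (hU : U ∈ uniformity G) :
    ∃ E : Set ℝ, E.Finite ∧ ∀ n, 0 < n → ∃ s : Finset G, Dynamics.IsDynCoverOf f univ U n s ∧
      s.card ≤ 2 * (F.hits E n).ncard := by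
  obtain ⟨π, hπ, -, -, hcompl, hsemi⟩ := hF
  have hsurj : Function.Surjective π := fun y => by
    by_cases hy : y ∈ π '' {x | (x : ℝ) ∈ Ω.boundary}
    · obtain ⟨x, -, h⟩ := hy; exact ⟨x, h⟩
    · obtain ⟨x, -, h⟩ := hcompl.symm.subset hy; exact ⟨x, h⟩
  have hcompact : CompactSpace Ω.carrier :=
    isCompact_iff_compactSpace.1 (isCompact_iUnion fun _ => isCompact_Icc)
  -- Uniform continuity of π turns δ-closeness in Ω into U-closeness in G. One representative from
  -- each gap of the hits, together with the hits, then gives a dynamical cover.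
  obtain ⟨δ, hδ, hUδ⟩ := Metric.mem_uniformity_dist.1
    (mem_map.1 (CompactSpace.uniformContinuous_of_continuous hπ hU))
  obtain ⟨R, hR⟩ := Ω.exists_bound
  obtain ⟨E₀, hE₀, hnet⟩ := exists_finite_net R hδ
  refine ⟨F.C ∪ E₀, F.finite_C.union hE₀, fun n hn => ?_⟩
  have hfin := F.hits_finite (F.finite_C.union hE₀) n
  have hcut := F.cutIter_subset_hits (E := F.C ∪ E₀) subset_union_left n
  have hb := (F.boundary_subset_cutIter hn).trans hcut
  have hit : ∀ (x : Ω.carrier) k (hk : (x : ℝ) ∉ F.cutIter k),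
      f^[k] (π x) = π ⟨F.toFun^[k] x, F.iterate_mem x.2 hk⟩ := by
    intro x k
    induction k with
    | zero => intro _; rfl
    | succ k ih =>
      intro hk
      have hk' : (x : ℝ) ∉ F.cutIter k := fun h => hk (F.cutIter_mono (Nat.le_succ k) h)
      have hkC : F.toFun^[k] x ∉ F.C := fun h => hk ⟨x.2, k, Nat.lt_succ_self k, h⟩
      rw [Function.iterate_succ_apply', ih hk',
        ← hsemi (F.toFun^[k] x) ⟨F.iterate_mem x.2 hk', hkC⟩]
      congr 2
      exact (Function.iterate_succ_apply' _ _ _).symm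
  obtain ⟨B, hB, hBcard, hBrep⟩ := IntervalUnion.exists_representatives hfin hb
  have hB' : ((↑) ⁻¹' B : Set Ω.carrier).Finite := hB.preimage Subtype.val_injective.injOn
  refine ⟨(hB'.image π).toFinset, ?_, ?_⟩
  · intro y _
    obtain ⟨x, rfl⟩ := hsurj y
    obtain ⟨z, hzB, hzΩ, hz⟩ := hBrep x x.2
    refine ⟨π ⟨z, hzΩ⟩, by
      rw [Finite.coe_toFinset]; exact ⟨⟨z, hzΩ⟩, hzB, rfl⟩, ?_⟩
    refine Dynamics.mem_dynEntourage.2 fun k hk => ?_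
    rcases hz with hz | ⟨I, hI, hxI, hzI⟩
    · obtain rfl : x = ⟨z, hzΩ⟩ := Subtype.ext hz
      exact refl_mem_uniformity hU
    · have hout : ∀ t ∈ Ioo I.1 I.2, t ∉ F.cutIter k := fun t ht h =>
        (IntervalUnion.gaps_Ioo hI ht).2 (hcut (F.cutIter_mono hk.le h))
      rw [hit x k (hout _ hxI), hit ⟨z, hzΩ⟩ k (hout _ hzI)]
      refine hUδ ?_
      exact F.abs_iterate_sub_lt hR subset_union_left
        (fun u v hu hv huv => (hnet u v hu hv huv).imp fun e he => ⟨Or.inr he.1, he.2⟩)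
        hk hI hxI hzI
  · rw [← ncard_eq_toFinset_card _ (hB'.image π)]
    refine (ncard_image_le hB').trans (le_trans ?_ hBcard)
    rw [← ncard_image_of_injective _ Subtype.val_injective]
    exact ncard_le_ncard (image_preimage_subset _ _) hB

/-- For every a > 1, convergence at t = 1/a bounds the covering numbers by a multiple of aⁿ. -/
theorem coverEntropy_nonpos {G : Type*} [UniformSpace G] {f : G → G} {F : PMMap Ω}
    (hF : InducedBy f F) (hc : ∀ t, 0 ≤ t → t < 1 → ConvAt t F.totalSeries) :
    Dynamics.coverEntropy f univ ≤ 0 := by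
  refine iSup₂_le fun U hU => ?_
  obtain ⟨E, hE, hcov⟩ := exists_isDynCoverOf hF hU
  have key : ∀ a : ENNReal, 1 < a →
      Dynamics.coverEntropyEntourage f univ U ≤ ENNReal.log a := by
    intro a ha
    rcases eq_or_ne a ⊤ with rfl | hatop
    · simp
    have ha1 : 1 < a.toReal := by
      rwa [← ENNReal.toReal_one, ENNReal.toReal_lt_toReal ENNReal.one_ne_top hatop]
    have ha0 : 0 < a.toReal := zero_lt_one.trans ha1
    obtain ⟨K, hK, hle⟩ := F.ncard_hits_le hE (inv_pos.2 ha0) (inv_lt_one_of_one_lt₀ ha1)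
      (hc _ (inv_pos.2 ha0).le (inv_lt_one_of_one_lt₀ ha1))
    rw [← ExpGrowth.expGrowthSup_pow (b := a)]
    refine ExpGrowth.expGrowthSup_le_of_eventually_le (b := ENNReal.ofReal (2 * K))
      ENNReal.ofReal_ne_top ?_
    filter_upwards [eventually_gt_atTop 0] with n hn
    obtain ⟨s, hs, hcard⟩ := hcov n hn
    have h1 : ((Dynamics.coverMincard f univ U n : ℕ∞) : ENNReal) ≤ (s.card : ENNReal) := by
      have := hs.coverMincard_le_card
      exact_mod_cast (ENat.toENNReal_le.2 this)
    refine h1.trans ?_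
    have h2 : (s.card : ℝ) ≤ 2 * K * a.toReal ^ n := by
      have h3 := hle n
      rw [inv_inv] at h3
      have h4 : (s.card : ℝ) ≤ 2 * (F.hits E n).ncard := by exact_mod_cast hcard
      linarith
    have h5 := ENNReal.ofReal_le_ofReal h2
    rwa [ENNReal.ofReal_natCast, ENNReal.ofReal_mul (by positivity),
      ENNReal.ofReal_pow ha0.le, ENNReal.ofReal_toReal hatop] at h5
  have hexp : EReal.exp (Dynamics.coverEntropyEntourage f univ U) ≤ 1 :=
    le_of_forall_gt_imp_ge_of_dense fun a ha =>
      (EReal.exp_monotone (key a ha)).trans_eq (ENNReal.exp_log a)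
  have hlog := ENNReal.log_monotone hexp
  rwa [EReal.log_exp, ENNReal.log_one] at hlog

namespace PMMap

open PowerSeries

variable (F : PMMap Ω)

/-- Composition with ψ₁ multiplies the bound of a functional by at most K, so growth is at most
exponential and the radius is positive. -/
theorem exists_convAt_totalSeries : ∃ t > 0, ConvAt t F.totalSeries := by
  set K : ℝ := 1 + ∑ j, norm1 (F.sideVal j) with hK
  have hK1 : 1 ≤ K := le_add_of_nonneg_right (Finset.sum_nonneg fun j _ => norm1_nonneg _)
  have hK0 : 0 < K := zero_lt_one.trans_le hK1
  have hstep : ∀ (θ : S0 Ω →ₗ[ℝ] ℝ) b, 0 ≤ b → IsBddFun θ b →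
      IsBddFun (θ ∘ₗ F.push1Ext) (b * K) := by
    intro θ b hb h x
    rw [LinearMap.comp_apply, F.push1Ext_eq, map_add, map_sum, hK, mul_add, mul_one,
      Finset.mul_sum]
    refine (abs_add_le _ _).trans (add_le_add (F.isBddFun_comp_signedPush0 hb h x) ?_)
    refine (Finset.abs_sum_le_sum_abs _ _).trans (Finset.sum_le_sum fun j _ => ?_)
    rw [map_smul, smul_eq_mul, abs_mul]
    refine (mul_le_mul (F.sideFun_bdd j x) (h.abs_le _) (abs_nonneg _) zero_le_one).trans_eq ?_
    ring
  have hpow : ∀ (θ : S0 Ω →ₗ[ℝ] ℝ), IsBddFun θ 1 → ∀ n,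
      IsBddFun (θ ∘ₗ (F.push1Ext ^ n)) (K ^ n) := by
    intro θ h n
    induction n with
    | zero => rw [pow_zero, pow_zero]; exact h
    | succ n ih =>
      have := hstep _ _ (by positivity) ih
      rwa [← pow_succ] at this
  refine ⟨(2 * K)⁻¹, by positivity, ?_⟩
  have ht : 0 ≤ (2 * K)⁻¹ := by positivity
  refine ConvAt.sum ht fun j _ => ?_
  have hg : Summable fun n : ℕ => norm1 (fundamental Ω) * (1 / 2 : ℝ) ^ n :=
    summable_geometric_two.mul_left _
  refine convAt_of_abs_le ht (fun n => ?_) (g := fun n => K ^ n * norm1 (fundamental Ω))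
    (hg.congr fun n => ?_)
  · rw [fundSeries, coeff_orbitSeries]
    exact (hpow _ (F.sideFun_bdd j) n).abs_le _
  · have h : (2 * K)⁻¹ ^ n * K ^ n = (1 / 2 : ℝ) ^ n := by
      rw [← mul_pow]
      congr 1
      field_simp
    rw [← h]
    ring

theorem exists_isRadius (h : ∃ t, 0 ≤ t ∧ t < 1 ∧ ¬ ConvAt t F.totalSeries) :
    ∃ r, F.IsRadius r := by
  obtain ⟨t₁, ht₁0, ht₁, hnot⟩ := h
  obtain ⟨t₀, ht₀, hc₀⟩ := F.exists_convAt_totalSeries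
  set S := {t | 0 ≤ t ∧ ConvAt t F.totalSeries} with hS
  have hub : ∀ s ∈ S, s ≤ t₁ := fun s hs => by
    by_contra! hlt
    exact hnot (hs.2.mono ht₁0 hlt.le)
  have hne : S.Nonempty := ⟨t₀, ht₀.le, hc₀⟩
  have hle : ∀ s ∈ S, s ≤ sSup S := fun s hs => le_csSup ⟨t₁, hub⟩ hs
  have hr : 0 < sSup S := ht₀.trans_le (hle t₀ ⟨ht₀.le, hc₀⟩)
  refine ⟨sSup S, hr, (csSup_le hne hub).trans_lt ht₁, fun t ht htr => ?_, fun t ht hct => ?_⟩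
  · obtain ⟨s, hs, hts⟩ := exists_lt_of_lt_csSup hne htr
    exact hs.2.mono ht hts.le
  · exact ht.not_ge (hle t ⟨(hr.trans ht).le, hct⟩)

end PMMap

end PMGraph
end

/-! ### The main theorem. -/

theorem theoremt8 {G : Type*} [TopologicalSpace G] [CompactSpace G] [T2Space G]
    (hG : PMGraph.IsGraph G) (f : G → G) (hf : PMGraph.IsPMGMap f)
    (Ω : PMGraph.IntervalUnion) (F : PMGraph.PMMap Ω) (hF : PMGraph.InducedBy f F)
    (hent : 0 < PMGraph.topEntropy f) :
    ∃ r : ℝ, Tendsto (fun n : ℕ => F.variation n ^ (-(1 / (n : ℝ)))) atTop (𝓝 r) ∧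
      ∃ z : ℂ, ‖z‖ = r ∧
        HasSum (fun n : ℕ => ((PowerSeries.coeff n F.kneadingDet : ℝ) : ℂ) * z ^ n) 0 := by
  -- Positive entropy enters only here: it forces the radius of convergence of the total series
  -- below 1.
  have hdiv : ∃ t, 0 ≤ t ∧ t < 1 ∧ ¬ PMGraph.ConvAt t F.totalSeries := by
    by_contra! hconv
    let _ : UniformSpace G := uniformSpaceOfCompactR1
    exact (PMGraph.coverEntropy_nonpos hF hconv).not_gt hent
  obtain ⟨r, hr⟩ := F.exists_isRadius hdiv
  have hnorm : ‖(r : ℂ)‖ = r := Complex.norm_of_nonneg hr.pos.le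
  refine ⟨r, hr.tendsto_variation, r, hnorm, ?_⟩
  have hsum : HasSum (fun n => PowerSeries.coeff n F.kneadingDet * r ^ n) 0 := by
    rw [← hr.evalAt_kneadingDet]
    exact PMGraph.ConvAt.hasSum (by
      rw [Real.norm_of_nonneg hr.pos.le]
      exact F.kneadingDet_mem.1 r hr.pos.le hr.lt_one)
  have hsum' := Complex.hasSum_ofReal.2 hsum
  rw [Complex.ofReal_zero] at hsum'
  exact hsum'.congr_fun fun n => by push_cast; rfl
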